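/- Let $N\in\mathbb N$, let $\Omega\subset\mathbb R^N$ be open, $T>0$, $Q=\Omega\times(0,T)$ and $1\le p<\infty$, $1/p'=1-1/p$. Notation. For $d\ge 0$, $\mathrm{AP}(\mathbb R^d)$ is the Banach algebra (sup norm) of real bounded continuous functions $u$ on $\mathbb R^d$ whose translates $u(\cdot+a)$, $a\in\mathbb R^d$, form a relatively compact set; $M(u)=\lim_{r\to\infty}|B_r|^{-1}\int_{B_r}u\,dy$ is the mean value; $\mathcal K$ is the spectrum of $\mathrm{AP}(\mathbb R^d)$ (its nonzero multiplicative linear forms with the weak-$*$ topology), $\widehat u(s)=s(u)$ is the Gelfand transform, and $\beta$ is the Radon probability measure on $\mathcal K$ with $\int_{\mathcal K}\widehat u\,d\beta=M(u)$ for all $u\in \mathrm{AP}(\mathbb R^d)$. $B^p_{\mathrm{AP}}(\mathbb R^d)$ is the closure of $\mathrm{AP}(\mathbb R^d)$ for the seminorm $\|u\|_p=\limsup_{r\to\infty}\bigl(|B_r|^{-1}\int_{B_r}|u|^p\,dy\bigr)^{1/p}$, and $\mathcal B^p_{\mathrm{AP}}(\mathbb R^d)$ is its quotient by the functions of zero seminorm;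 the Gelfand transformation extends by continuity to an isometry $u\mapsto\widehat u$ of $\mathcal B^p_{\mathrm{AP}}(\mathbb R^d)$ onto $L^p(\mathcal K)$. Write $\mathcal K_y$, $\mathcal K_\tau$ for the spectra of $\mathrm{AP}(\mathbb R^N)$, $\mathrm{AP}(\mathbb R)$, with measures $ds$, $ds_0$; the spectrum of $\mathrm{AP}(\mathbb R^{N+1})$ is identified with $\mathcal K_y\times\mathcal K_\tau$, with the product measure $ds\,ds_0$. A family $(u_\varepsilon)\subset L^p(Q)$, with $\varepsilon>0$ tending to $0$ continuously or along a sequence, is said to weakly $\Sigma$-converge in $L^p(Q)$ to $u_0\in L^p(Q;\mathcal B^p_{\mathrm{AP}}(\mathbb R^{N+1}))$ if, as $\varepsilon\to0$, $$\int_Q u_\varepsilon(x,t)\,f\Bigl(x,t,\frac x\varepsilon,\frac t\varepsilon\Bigr)dx\,dt\longrightarrow\iint_{Q\times\mathcal K_y\times\mathcal K_\tau}\widehat u_0(x,t,s,s_0)\,\widehat f(x,t,s,s_0)\,dx\,dt\,ds\,ds_0$$ for every $f\in L^{p'}(Q;\mathrm{AP}(\mathbb R^{N+1}))$. Statement. Let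 $(v_\varepsilon)\subset L^p(Q)$ weakly $\Sigma$-converge in $L^p(Q)$ to $v_0\in L^p(Q;\mathcal B^p_{\mathrm{AP}}(\mathbb R^{N+1}))$, and set $w_\varepsilon(x,t)=\int_0^t v_\varepsilon(x,\tau)\,d\tau$ for a.e. $(x,t)\in Q$. Then there is $w_0\in L^p(Q;\mathcal B^p_{\mathrm{AP}}(\mathbb R^N))$ with $$\widehat w_0(x,t,s)=\int_0^t\int_{\mathcal K_\tau}\widehat v_0(x,\tau,s,r_0)\,dr_0\,d\tau\qquad\text{for a.e. }(x,t,s)\in Q\times\mathcal K_y,$$ and $(w_\varepsilon)$ is contained in $L^p(Q)$ and weakly $\Sigma$-converges in $L^p(Q)$ to $w_0$, where $w_0$ is regarded as the element of $L^p(Q;\mathcal B^p_{\mathrm{AP}}(\mathbb R^{N+1}))$ that does not depend on the microscopic time variable. -/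

import Mathlib

open MeasureTheory Filter Topology Set Metric
open scoped ENNReal BoundedContinuousFunction

namespace APSigma

section AP
variable {V : Type*} [NormedAddCommGroup V]

/-- The translate `u(· + a)`. -/
def translate (a : V) (u : V →ᵇ ℝ) : V →ᵇ ℝ := u.compContinuous (ContinuousMap.addRight a)

@[simp] theorem translate_apply (a : V) (u : V →ᵇ ℝ) (y : V) : translate a u y = u (y + a) := rfl

/-- A bounded continuous function is almost periodic if its translates form a relatively compact set
for the sup norm. -/
def IsAlmostPeriodic (u : V →ᵇ ℝ) : Prop :=
  IsCompact (closure (range fun a : V => translate a u))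

theorem isAlmostPeriodic_of_subset {u : V →ᵇ ℝ} {S : Set (V →ᵇ ℝ)} (hS : IsCompact S)
    (h : ∀ a, translate a u ∈ S) : IsAlmostPeriodic u :=
  hS.closure_of_subset (by rintro _ ⟨a, rfl⟩; exact h a)

theorem mem_orbitClosure (u : V →ᵇ ℝ) (a : V) :
    translate a u ∈ closure (range fun a : V => translate a u) :=
  subset_closure ⟨a, rfl⟩

variable (V) in
/-- The almost periodic functions, as a subalgebra of the bounded continuous functions. -/
def apSubalgebra : Subalgebra ℝ (V →ᵇ ℝ) where
  carrier := {u | IsAlmostPeriodic u}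
  mul_mem' {u v} hu hv := isAlmostPeriodic_of_subset
    ((IsCompact.prod hu hv).image (f := fun q => q.1 * q.2) (by fun_prop))
    fun a => ⟨(translate a u, translate a v),
      ⟨mem_orbitClosure u a, mem_orbitClosure v a⟩, by ext; rfl⟩
  add_mem' {u v} hu hv := isAlmostPeriodic_of_subset
    ((IsCompact.prod hu hv).image (f := fun q => q.1 + q.2) (by fun_prop))
    fun a => ⟨(translate a u, translate a v),
      ⟨mem_orbitClosure u a, mem_orbitClosure v a⟩, by ext; rfl⟩
  algebraMap_mem' c := isAlmostPeriodic_of_subset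
    (isCompact_singleton (x := algebraMap ℝ (V →ᵇ ℝ) c)) fun a => by ext; rfl

theorem dist_translate_le (a : V) (u v : V →ᵇ ℝ) : dist (translate a u) (translate a v) ≤ dist u v :=
  (BoundedContinuousFunction.dist_le dist_nonneg).2 fun y =>
    BoundedContinuousFunction.dist_coe_le_dist (f := u) (g := v) (y + a)

/-- Every translate is uniformly close to one of finitely many. -/
theorem exists_bounded_translate {u : V →ᵇ ℝ} (hu : IsAlmostPeriodic u) {η : ℝ} (hη : 0 < η) :
    ∃ F : Finset V, ∀ a : V, ∃ b ∈ F, dist (translate a u) (translate b u) < η := by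
  classical
  have ht : TotallyBounded (range fun a : V => translate a u) :=
    hu.totallyBounded.subset subset_closure
  obtain ⟨t, hts, htf, htc⟩ := (totallyBounded_iff_subset.1 ht) _ (Metric.dist_mem_uniformity hη)
  have hts' : ∀ x ∈ t, ∃ b : V, translate b u = x := fun x hx => hts hx
  choose! g hg using hts'
  refine ⟨htf.toFinset.image g, fun a => ?_⟩
  obtain ⟨x, hx, hax⟩ := mem_iUnion₂.1 (htc ⟨a, rfl⟩)
  refine ⟨g x, Finset.mem_image.2 ⟨x, htf.mem_toFinset.2 hx, rfl⟩, ?_⟩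
  rw [hg x hx]; exact hax

theorem isClosed_apSubalgebra : IsClosed (apSubalgebra V : Set (V →ᵇ ℝ)) := by
  classical
  refine isClosed_of_closure_subset fun u hu => ?_
  change IsCompact _
  refine TotallyBounded.isCompact_of_isClosed (TotallyBounded.closure ?_) isClosed_closure
  refine Metric.totallyBounded_iff.2 fun η hη => ?_
  obtain ⟨v, hv, huv⟩ := Metric.mem_closure_iff.1 hu (η / 3) (by positivity)
  obtain ⟨F, hF⟩ := exists_bounded_translate (u := v) hv (η := η / 3) (by positivity)
  refine ⟨(fun b => translate b u) '' F, F.finite_toSet.image _, ?_⟩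
  rintro _ ⟨a, rfl⟩
  obtain ⟨b, hb, hab⟩ := hF a
  refine mem_iUnion₂.2 ⟨_, ⟨b, hb, rfl⟩, ?_⟩
  have h1 := dist_translate_le a u v
  have h2 := dist_translate_le b v u
  rw [dist_comm v u] at h2
  have := dist_triangle4 (translate a u) (translate a v) (translate b v) (translate b u)
  exact Metric.mem_ball.2 (by linarith)

variable (V) in
/-- The Banach algebra `AP(V)` of almost periodic functions on `V`, with the sup norm. -/
def AP : Type _ := ↥(apSubalgebra V)

noncomputable instance : NormedCommRing (AP V) := inferInstanceAs (NormedCommRing (apSubalgebra V))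

noncomputable instance : NormedAlgebra ℝ (AP V) :=
  inferInstanceAs (NormedAlgebra ℝ (apSubalgebra V))

instance : CompleteSpace (AP V) := isClosed_apSubalgebra.completeSpace_coe

/-- An element of `AP(V)` as a bounded continuous function. -/
def AP.toBCF (u : AP V) : V →ᵇ ℝ := u.1

/-- A bounded continuous almost periodic function as an element of `AP(V)`. -/
def AP.mk (u : V →ᵇ ℝ) (hu : IsAlmostPeriodic u) : AP V := ⟨u, hu⟩

instance : CoeFun (AP V) fun _ => V → ℝ := ⟨fun u => u.toBCF⟩

theorem AP.isAlmostPeriodic (u : AP V) : IsAlmostPeriodic u.toBCF := u.2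

@[simp] theorem AP.mk_apply (u : V →ᵇ ℝ) (hu : IsAlmostPeriodic u) (y : V) : AP.mk u hu y = u y :=
  rfl

@[ext] theorem AP.ext {u v : AP V} (h : ∀ y, u y = v y) : u = v :=
  Subtype.ext (BoundedContinuousFunction.ext h)

@[simp] theorem AP.add_apply (u v : AP V) (y : V) : (u + v) y = u y + v y := rfl
@[simp] theorem AP.sub_apply (u v : AP V) (y : V) : (u - v) y = u y - v y := rfl
@[simp] theorem AP.mul_apply (u v : AP V) (y : V) : (u * v) y = u y * v y := rfl
@[simp] theorem AP.smul_apply (c : ℝ) (u : AP V) (y : V) : (c • u) y = c * u y := rfl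
@[simp] theorem AP.one_apply (y : V) : (1 : AP V) y = 1 := rfl

theorem AP.norm_def (u : AP V) : ‖u‖ = ‖u.toBCF‖ := rfl
theorem AP.dist_def (u v : AP V) : dist u v = dist u.toBCF v.toBCF := rfl

theorem AP.abs_apply_le (u : AP V) (y : V) : |u y| ≤ ‖u‖ := u.toBCF.norm_coe_le_norm y

theorem AP.norm_le (u : AP V) {C : ℝ} (hC : 0 ≤ C) (h : ∀ y, |u y| ≤ C) : ‖u‖ ≤ C :=
  (BoundedContinuousFunction.norm_le hC).2 h

instance : NormOneClass (AP V) :=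
  ⟨by rw [AP.norm_def]; exact norm_one (α := V →ᵇ ℝ)⟩

/-- An almost periodic function is uniformly continuous. -/
theorem continuous_translate {u : V →ᵇ ℝ} (hu : IsAlmostPeriodic u) :
    Continuous fun a : V => translate a u := by
  refine Metric.continuous_iff.2 fun a η hη => ?_
  obtain ⟨F, hF⟩ := exists_bounded_translate hu (η := η / 4) (by positivity)
  have key : ∀ᶠ h in 𝓝 (0 : V), ∀ b ∈ F, dist (u (b + h)) (u b) < η / 4 := by
    refine (Finset.eventually_all F).2 fun b _ => ?_
    have : Tendsto (fun h : V => u (b + h)) (𝓝 0) (𝓝 (u b)) := by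
      have h : Continuous fun h : V => u (b + h) := by fun_prop
      simpa using h.tendsto 0
    exact Metric.tendsto_nhds.1 this _ (by positivity)
  obtain ⟨δ, hδ, hk⟩ := Metric.eventually_nhds_iff.1 key
  refine ⟨δ, hδ, fun a' ha' => ?_⟩
  refine lt_of_le_of_lt ((BoundedContinuousFunction.dist_le (C := 3 * (η / 4)) (by positivity)).2 ?_)
    (by linarith)
  intro y
  obtain ⟨b, hb, hab⟩ := hF (y + a)
  have h0 := BoundedContinuousFunction.dist_coe_le_dist (f := translate (y + a) u)
    (g := translate b u) 0
  have h1 := BoundedContinuousFunction.dist_coe_le_dist (f := translate (y + a) u)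
    (g := translate b u) (a' - a)
  have h2 := hk (y := a' - a) (by simpa [dist_eq_norm] using ha') b hb
  simp only [translate_apply, zero_add] at h0 h1 ⊢
  have e1 : a' - a + (y + a) = y + a' := by abel
  rw [e1, add_comm (a' - a) b] at h1
  have := dist_triangle4 (u (y + a')) (u (b + (a' - a))) (u b) (u (y + a))
  rw [dist_comm (u b) (u (y + a))] at this
  linarith

end AP

section Mean
variable {V : Type*} [NormedAddCommGroup V] [NormedSpace ℝ V] [FiniteDimensional ℝ V]
  [MeasureSpace V] [BorelSpace V] [(volume : Measure V).IsAddHaarMeasure]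

variable (V) in
/-- The normalized Lebesgue measure `dy / |B_r|` on the ball `B_r` centred at the origin. -/
noncomputable def unifBall (r : ℝ) : Measure V :=
  (volume (ball (0 : V) r))⁻¹ • volume.restrict (ball (0 : V) r)

theorem isProbabilityMeasure_unifBall {r : ℝ} (hr : 0 < r) : IsProbabilityMeasure (unifBall V r) :=
  ⟨by
    simp only [unifBall, Measure.smul_apply, Measure.restrict_apply MeasurableSet.univ, univ_inter,
      smul_eq_mul]
    exact ENNReal.inv_mul_cancel (measure_ball_pos _ _ hr).ne' measure_ball_lt_top.ne⟩

theorem integral_unifBall (r : ℝ) (f : V → ℝ) :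
    ∫ y, f y ∂(unifBall V r) = (volume.real (ball (0 : V) r))⁻¹ * ∫ y in ball (0 : V) r, f y := by
  simp [unifBall, integral_smul_measure, Measure.real, ENNReal.toReal_inv]

theorem integrable_unifBall (u : V →ᵇ ℝ) {r : ℝ} (hr : 0 < r) : Integrable u (unifBall V r) :=
  have := isProbabilityMeasure_unifBall (V := V) hr
  u.integrable _

theorem integrableOn_ball (u : V →ᵇ ℝ) (b : V) (r : ℝ) : IntegrableOn u (ball b r) := by
  have : IsFiniteMeasure (volume.restrict (ball b r)) := ⟨by
    simpa using measure_ball_lt_top⟩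
  exact u.integrable _

theorem abs_setIntegral_sub_le (u : V →ᵇ ℝ) {b : V} {r ρ : ℝ} (hsub : ball (0 : V) ρ ⊆ ball b r) :
    |(∫ y in ball b r, u y) - ∫ y in ball (0 : V) ρ, u y|
      ≤ ‖u‖ * (volume.real (ball (0 : V) r) - volume.real (ball (0 : V) ρ)) := by
  rw [← setIntegral_sdiff measurableSet_ball (integrableOn_ball u b r) hsub]
  have h := norm_setIntegral_le_of_norm_le_const (μ := (volume : Measure V))
    (s := ball b r \ ball (0 : V) ρ) (f := u) (C := ‖u‖)
    (lt_of_le_of_lt (measure_mono sdiff_subset) measure_ball_lt_top)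
    (fun y _ => u.norm_coe_le_norm y)
  rw [Real.norm_eq_abs, measureReal_sdiff hsub measurableSet_ball] at h
  rwa [Measure.addHaar_real_ball_center volume b r] at h

theorem volume_real_ball {r : ℝ} (hr : 0 < r) : volume.real (ball (0 : V) r)
    = r ^ Module.finrank ℝ V * volume.real (ball (0 : V) 1) := by
  rw [Measure.real, Measure.addHaar_ball_of_pos volume (0 : V) hr, ENNReal.toReal_mul,
    ENNReal.toReal_ofReal (by positivity), Measure.real]

theorem abs_shift_sub_le (u : V →ᵇ ℝ) {b : V} {r L : ℝ} (hb : ‖b‖ ≤ L) (hL : 0 ≤ L) (hr : L < r) :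
    |(∫ y, u (y + b) ∂(unifBall V r)) - ∫ y, u y ∂(unifBall V r)|
      ≤ 2 * ‖u‖ * (1 - ((r - L) / r) ^ Module.finrank ℝ V) := by
  have hr0 : 0 < r := hL.trans_lt hr
  have hB : ∫ y in ball (0 : V) r, u (y + b) = ∫ y in ball b r, u y := by
    have := (measurePreserving_add_right (volume : Measure V) b).setIntegral_preimage_emb
      (measurableEmbedding_addRight b) u (ball b r)
    rw [← this]
    congr 2
    ext y; simp [dist_eq_norm]
  have hsub : ball (0 : V) (r - L) ⊆ ball b r := fun y hy => by
    simp only [mem_ball, dist_eq_norm, sub_zero] at hy ⊢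
    linarith [norm_sub_le y b]
  have hsub0 : ball (0 : V) (r - L) ⊆ ball 0 r := ball_subset_ball (by linarith)
  have h1 := abs_setIntegral_sub_le u hsub
  have h2 := abs_setIntegral_sub_le u hsub0
  have hv1 : volume.real (ball (0 : V) r) = r ^ Module.finrank ℝ V * volume.real (ball (0 : V) 1) :=
    volume_real_ball hr0
  have hv2 : volume.real (ball (0 : V) (r - L))
      = (r - L) ^ Module.finrank ℝ V * volume.real (ball (0 : V) 1) :=
    volume_real_ball (by linarith)
  have hpos : 0 < volume.real (ball (0 : V) r) :=
    ENNReal.toReal_pos (measure_ball_pos _ _ hr0).ne' measure_ball_lt_top.ne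
  rw [integral_unifBall, integral_unifBall, hB, ← mul_sub, abs_mul, abs_of_pos (inv_pos.2 hpos),
    inv_mul_le_iff₀ hpos]
  have hv : volume.real (ball (0 : V) r) - volume.real (ball (0 : V) (r - L))
      = volume.real (ball (0 : V) r) * (1 - ((r - L) / r) ^ Module.finrank ℝ V) := by
    rw [hv2, hv1, div_pow]
    have : r ^ Module.finrank ℝ V ≠ 0 := by positivity
    field_simp
  rw [hv] at h1 h2
  set I := ∫ y in ball (0 : V) (r - L), u y
  set D := 1 - ((r - L) / r) ^ Module.finrank ℝ V
  have := abs_sub_le (∫ y in ball b r, u y) I (∫ y in ball (0 : V) r, u y)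
  rw [abs_sub_comm I] at this
  linarith

/-- Averages over large balls hardly depend on the centre of the ball. -/
theorem eventually_shift {u : V →ᵇ ℝ} (hu : IsAlmostPeriodic u) {η : ℝ} (hη : 0 < η) :
    ∀ᶠ r in atTop, ∀ a : V,
      |(∫ y, u (y + a) ∂(unifBall V r)) - ∫ y, u y ∂(unifBall V r)| ≤ η := by
  obtain ⟨F, hF⟩ := exists_bounded_translate hu (η := η / 2) (by positivity)
  set L : ℝ := ∑ b ∈ F, ‖b‖
  have hL0 : 0 ≤ L := Finset.sum_nonneg fun _ _ => norm_nonneg _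
  have hlim : Tendsto (fun r : ℝ => 2 * ‖u‖ * (1 - ((r - L) / r) ^ Module.finrank ℝ V)) atTop
      (𝓝 0) := by
    have h1 : Tendsto (fun r : ℝ => (r - L) / r) atTop (𝓝 1) := by
      have : Tendsto (fun r : ℝ => 1 - L * r⁻¹) atTop (𝓝 (1 - L * 0)) :=
        tendsto_const_nhds.sub (tendsto_const_nhds.mul tendsto_inv_atTop_zero)
      rw [mul_zero, sub_zero] at this
      refine this.congr' ?_
      filter_upwards [eventually_gt_atTop 0] with r hr
      field_simp
    have h2 := ((tendsto_const_nhds (x := (1 : ℝ))).sub (h1.pow (Module.finrank ℝ V))).const_mul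
      (2 * ‖u‖)
    simpa using h2
  filter_upwards [eventually_gt_atTop L, (tendsto_order.1 hlim).2 (η / 2) (by positivity)]
    with r hr hr2 a
  have := isProbabilityMeasure_unifBall (V := V) (hL0.trans_lt hr)
  obtain ⟨b, hb, hab⟩ := hF a
  have hbL : ‖b‖ ≤ L := Finset.single_le_sum (f := fun b : V => ‖b‖) (fun _ _ => norm_nonneg _) hb
  have h1 := abs_shift_sub_le u hbL hL0 hr
  have h2 : |(∫ y, u (y + a) ∂(unifBall V r)) - ∫ y, u (y + b) ∂(unifBall V r)| ≤ η / 2 := by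
    have hi := integral_sub ((translate a u).integrable (unifBall V r))
      ((translate b u).integrable (unifBall V r))
    simp only [translate_apply] at hi
    rw [← hi, ← Real.norm_eq_abs]
    refine (norm_integral_le_of_norm_le_const (C := η / 2) (ae_of_all _ fun y => ?_)).trans ?_
    · rw [← dist_eq_norm]
      exact (BoundedContinuousFunction.dist_coe_le_dist (f := translate a u)
        (g := translate b u) y).trans hab.le
    · simp
  have := abs_sub_le (∫ y, u (y + a) ∂(unifBall V r)) (∫ y, u (y + b) ∂(unifBall V r))
    (∫ y, u y ∂(unifBall V r))
  linarith

theorem abs_mean_sub_le (u : V →ᵇ ℝ) {r R η : ℝ} (hr : 0 < r) (hR : 0 < R)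
    (h : ∀ a : V, |(∫ y, u (y + a) ∂(unifBall V r)) - ∫ y, u y ∂(unifBall V r)| ≤ η) :
    |(∫ a, ∫ y, u (y + a) ∂(unifBall V r) ∂(unifBall V R)) - ∫ y, u y ∂(unifBall V r)| ≤ η := by
  have := isProbabilityMeasure_unifBall (V := V) hr
  have := isProbabilityMeasure_unifBall (V := V) hR
  have hint : Integrable (fun q : V × V => u (q.2 + q.1)) ((unifBall V R).prod (unifBall V r)) :=
    (u.compContinuous ⟨fun q : V × V => q.2 + q.1, by fun_prop⟩).integrable _
  have hi := integral_sub hint.integral_prod_left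
    (integrable_const (μ := unifBall V R) (∫ y, u y ∂(unifBall V r)))
  rw [integral_const, probReal_univ, one_smul] at hi
  rw [← hi, ← Real.norm_eq_abs]
  refine (norm_integral_le_of_norm_le_const (C := η) (ae_of_all _ fun a => h a)).trans ?_
  simp

theorem exists_mean {u : V →ᵇ ℝ} (hu : IsAlmostPeriodic u) :
    ∃ m, Tendsto (fun r : ℝ => ∫ y, u y ∂(unifBall V r)) atTop (𝓝 m) := by
  refine cauchy_map_iff_exists_tendsto.1 (Metric.cauchy_iff.2 ⟨inferInstance, fun η hη => ?_⟩)
  obtain ⟨r₀, hr₀⟩ := eventually_atTop.1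
    ((eventually_shift hu (η := η / 3) (by positivity)).and (eventually_gt_atTop 0))
  refine ⟨_, image_mem_map (Ici_mem_atTop r₀), ?_⟩
  rintro _ ⟨r, hr, rfl⟩ _ ⟨R, hR, rfl⟩
  have h1 := hr₀ r hr
  have h2 := hr₀ R hR
  have := isProbabilityMeasure_unifBall (V := V) h1.2
  have := isProbabilityMeasure_unifBall (V := V) h2.2
  have e1 := abs_mean_sub_le u h1.2 h2.2 h1.1
  have e2 := abs_mean_sub_le u h2.2 h1.2 h2.1
  have hint : Integrable (fun q : V × V => u (q.2 + q.1)) ((unifBall V R).prod (unifBall V r)) :=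
    (u.compContinuous ⟨fun q : V × V => q.2 + q.1, by fun_prop⟩).integrable _
  rw [integral_integral_swap hint] at e1
  simp only [add_comm] at e1 e2
  rw [Real.dist_eq]
  rw [abs_le] at e1 e2
  rw [abs_lt]
  constructor <;> linarith [e1.1, e1.2, e2.1, e2.2]

/-- The mean value `M(u) = lim_{r → ∞} |B_r|⁻¹ ∫_{B_r} u(y) dy`. -/
noncomputable def meanValue (u : AP V) : ℝ :=
  limUnder atTop fun r : ℝ => ∫ y, u y ∂(unifBall V r)

theorem tendsto_meanValue (u : AP V) :
    Tendsto (fun r : ℝ => ∫ y, u y ∂(unifBall V r)) atTop (𝓝 (meanValue u)) :=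
  tendsto_nhds_limUnder (exists_mean u.isAlmostPeriodic)

theorem meanValue_add (u v : AP V) : meanValue (u + v) = meanValue u + meanValue v := by
  refine tendsto_nhds_unique (tendsto_meanValue (u + v))
    (((tendsto_meanValue u).add (tendsto_meanValue v)).congr' ?_)
  filter_upwards [eventually_gt_atTop 0] with r hr
  exact (integral_add (integrable_unifBall _ hr) (integrable_unifBall _ hr)).symm

theorem meanValue_smul (c : ℝ) (u : AP V) : meanValue (c • u) = c * meanValue u := by
  refine tendsto_nhds_unique (tendsto_meanValue (c • u))
    (((tendsto_meanValue u).const_mul c).congr fun r => ?_)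
  exact (integral_const_mul c _).symm

theorem meanValue_nonneg (u : AP V) (hu : ∀ y, 0 ≤ u y) : 0 ≤ meanValue u :=
  ge_of_tendsto' (tendsto_meanValue u) fun _ => integral_nonneg hu

theorem meanValue_one : meanValue (1 : AP V) = 1 := by
  refine tendsto_nhds_unique (tendsto_meanValue 1) (tendsto_const_nhds.congr' ?_)
  filter_upwards [eventually_gt_atTop 0] with r hr
  have := isProbabilityMeasure_unifBall (V := V) hr
  simp

end Mean

section Spectrum
variable (V : Type*) [NormedAddCommGroup V]

/-- The spectrum of `AP(V)`: its nonzero multiplicative linear forms, with the weak-* topology. -/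
abbrev BohrSpace : Type _ := WeakDual.characterSpace ℝ (AP V)

noncomputable instance : MeasurableSpace (BohrSpace V) := borel _
instance : BorelSpace (BohrSpace V) := ⟨rfl⟩

variable {V}
/-- The Dirac mass `δ_y`, `u ↦ u(y)`. -/
noncomputable def dirac (y : V) : BohrSpace V :=
  WeakDual.CharacterSpace.equivAlgHom.symm
    ({ toFun := fun u => u y
       map_one' := rfl
       map_mul' := fun _ _ => rfl
       map_zero' := rfl
       map_add' := fun _ _ => rfl
       commutes' := fun _ => rfl } : AP V →ₐ[ℝ] ℝ)

@[simp] theorem dirac_apply (y : V) (u : AP V) : dirac y u = u y := rfl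

theorem abs_character_le (s : BohrSpace V) (u : AP V) : |s u| ≤ ‖u‖ :=
  AlgHom.norm_apply_le_self (WeakDual.CharacterSpace.toAlgHom s) u

theorem gelfand_bijective : Function.Bijective (WeakDual.gelfandTransform ℝ (AP V)) := by
  set G := WeakDual.gelfandTransform ℝ (AP V) with hG
  have hnorm : ∀ u, ‖G u‖ = ‖u‖ := fun u => by
    refine le_antisymm ((ContinuousMap.norm_le _ (norm_nonneg u)).2 fun s => abs_character_le s u)
      (AP.norm_le u (norm_nonneg _) fun y => ?_)
    exact (G u).norm_coe_le_norm (dirac y)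
  have hiso : Isometry G := AddMonoidHomClass.isometry_of_norm G hnorm
  refine ⟨hiso.injective, fun φ => ?_⟩
  have hcl : IsClosed (G.range : Set C(BohrSpace V, ℝ)) := by
    rw [AlgHom.coe_range]; exact hiso.isClosedEmbedding.isClosed_range
  have htop := ContinuousMap.subalgebra_topologicalClosure_eq_top_of_separatesPoints G.range ?_
  · have : φ ∈ G.range.topologicalClosure := htop ▸ Algebra.mem_top
    rw [← SetLike.mem_coe, Subalgebra.topologicalClosure_coe, hcl.closure_eq] at this
    exact this
  · intro s r hsr
    by_contra! h
    refine hsr (Subtype.ext (ContinuousLinearMap.ext fun u => ?_))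
    exact h (G u) ⟨G u, ⟨u, rfl⟩, rfl⟩

/-- The Gelfand transformation `𝒢 : AP(V) → C(K)`, `𝒢(u)(s) = s(u)`. -/
noncomputable def gelfand : AP V ≃ₐ[ℝ] C(BohrSpace V, ℝ) :=
  AlgEquiv.ofBijective (WeakDual.gelfandTransform ℝ (AP V)) gelfand_bijective

@[simp] theorem gelfand_apply (u : AP V) (s : BohrSpace V) : gelfand u s = s u := rfl

variable [NormedSpace ℝ V] [FiniteDimensional ℝ V]
  [MeasureSpace V] [BorelSpace V] [(volume : Measure V).IsAddHaarMeasure]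

open CompactlySupported in
/-- The mean value as a positive linear functional on `C(K)`, through the Gelfand isomorphism.
Since `K` is compact, `C_c(K)` is `C(K)`. -/
noncomputable def meanFunctional : C_c(BohrSpace V, ℝ) →ₚ[ℝ] ℝ :=
  PositiveLinearMap.mk₀
    { toFun := fun φ => meanValue (gelfand.symm (φ : C(BohrSpace V, ℝ)))
      map_add' := fun φ ψ => by
        rw [← meanValue_add, ← map_add]; rfl
      map_smul' := fun c φ => by
        rw [RingHom.id_apply, smul_eq_mul, ← meanValue_smul, ← map_smul]; rfl }
    fun φ hφ => meanValue_nonneg _ fun y => by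
      have h := gelfand_apply (gelfand.symm (φ : C(BohrSpace V, ℝ))) (dirac y)
      rw [AlgEquiv.apply_symm_apply, dirac_apply] at h
      exact h ▸ hφ (dirac y)

variable (V) in
/-- The Radon probability measure `β` on `K` that represents the mean value:
`M(u) = ∫ 𝒢(u) dβ` (it is the Haar measure of the compact group `K`). -/
noncomputable def bohrMeasure : Measure (BohrSpace V) := RealRMK.rieszMeasure meanFunctional

open CompactlySupported in
theorem integral_gelfand (u : AP V) : ∫ s, gelfand u s ∂(bohrMeasure V) = meanValue u := by
  have h := RealRMK.integral_rieszMeasure (meanFunctional (V := V))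
    (CompactlySupportedContinuousMap.continuousMapEquiv (gelfand u))
  have e : meanFunctional (CompactlySupportedContinuousMap.continuousMapEquiv (gelfand u))
      = meanValue u := congrArg meanValue (gelfand.symm_apply_apply u)
  exact h.trans e

instance : IsProbabilityMeasure (bohrMeasure V) := by
  have : IsFiniteMeasure (bohrMeasure V) :=
    inferInstanceAs (IsFiniteMeasure (RealRMK.rieszMeasure meanFunctional))
  have h := integral_gelfand (1 : AP V)
  rw [meanValue_one] at h
  simp only [map_one, ContinuousMap.one_apply, integral_const, smul_eq_mul, mul_one] at h
  exact ⟨by rw [← ENNReal.toReal_eq_one_iff]; exact h⟩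

end Spectrum

section Besicovitch
variable {V : Type*} [NormedAddCommGroup V] [NormedSpace ℝ V] [FiniteDimensional ℝ V]
  [MeasureSpace V] [BorelSpace V] [(volume : Measure V).IsAddHaarMeasure]

/-- The Besicovitch seminorm
`‖u‖_p = limsup_{r → ∞} (|B_r|⁻¹ ∫_{B_r} |u(y)|^p dy)^{1/p}`, used for `1 ≤ p < ∞`. -/
noncomputable def besNorm (p : ℝ≥0∞) (u : V → ℝ) : ℝ≥0∞ :=
  limsup (fun r : ℝ => eLpNorm u p (unifBall V r)) atTop

theorem unifBall_absolutelyContinuous (r : ℝ) : unifBall V r ≪ volume :=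
  (Measure.smul_absolutelyContinuous).trans Measure.restrict_le_self.absolutelyContinuous

theorem besNorm_add_le {p : ℝ≥0∞} (hp : 1 ≤ p) {u v : V → ℝ} (hu : AEStronglyMeasurable u volume)
    (hv : AEStronglyMeasurable v volume) : besNorm p (u + v) ≤ besNorm p u + besNorm p v := by
  refine ENNReal.le_of_forall_pos_le_add fun η hη hfin => ?_
  have hη2 : (0 : ℝ≥0∞) < (η / 2 : NNReal) := by simpa [pos_iff_ne_zero] using hη.ne'
  have hu' : besNorm p u < besNorm p u + (η / 2 : NNReal) :=
    ENNReal.lt_add_right (ne_top_of_le_ne_top hfin.ne le_self_add) hη2.ne'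
  have hv' : besNorm p v < besNorm p v + (η / 2 : NNReal) :=
    ENNReal.lt_add_right (ne_top_of_le_ne_top hfin.ne le_add_self) hη2.ne'
  refine limsup_le_of_le (by isBoundedDefault) ?_
  filter_upwards [eventually_lt_of_limsup_lt hu', eventually_lt_of_limsup_lt hv'] with r h1 h2
  refine (eLpNorm_add_le (hu.mono_ac (unifBall_absolutelyContinuous r))
    (hv.mono_ac (unifBall_absolutelyContinuous r)) hp).trans ((add_le_add h1.le h2.le).trans ?_)
  rw [add_add_add_comm, ← ENNReal.coe_add, add_halves]

theorem besNorm_smul (p : ℝ≥0∞) (c : ℝ) (u : V → ℝ) : besNorm p (c • u) = ‖c‖ₑ * besNorm p u := by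
  simp only [besNorm, eLpNorm_const_smul]
  exact ENNReal.limsup_const_mul_of_ne_top enorm_ne_top

theorem besNorm_zero (p : ℝ≥0∞) : besNorm p (0 : V → ℝ) = 0 := by simp [besNorm]

theorem besNorm_AP_lt_top (p : ℝ≥0∞) (g : AP V) : besNorm p g < ∞ := by
  refine lt_of_le_of_lt (b := ENNReal.ofReal ‖g‖) (limsup_le_of_le (by isBoundedDefault) ?_)
    ENNReal.ofReal_lt_top
  filter_upwards [eventually_gt_atTop 0] with r hr
  have := isProbabilityMeasure_unifBall (V := V) hr
  simpa using eLpNorm_le_of_ae_bound (p := p) (μ := unifBall V r) (f := g) (C := ‖g‖)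
    (ae_of_all _ fun y => g.abs_apply_le y)

theorem AP.aestronglyMeasurable (g : AP V) : AEStronglyMeasurable g (volume : Measure V) :=
  g.toBCF.continuous.aestronglyMeasurable

variable (V) in
/-- The space `B^p_AP(V)` of Besicovitch almost periodic functions: the closure of `AP(V)` for the
Besicovitch seminorm. -/
noncomputable def besSubmodule (p : ℝ≥0∞) [hp : Fact (1 ≤ p)] : Submodule ℝ (V → ℝ) where
  carrier := {u | AEStronglyMeasurable u volume ∧
    ∀ η : ℝ≥0∞, 0 < η → ∃ g : AP V, besNorm p (u - ⇑g) < η}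
  zero_mem' := ⟨aestronglyMeasurable_const, fun η hη => ⟨0, by
    have : ((0 : V → ℝ) - ((0 : AP V) : V → ℝ)) = 0 := by ext y; simp; rfl
    rw [this, besNorm_zero]; exact hη⟩⟩
  add_mem' := by
    rintro u v ⟨hu, hu'⟩ ⟨hv, hv'⟩
    refine ⟨hu.add hv, fun η hη => ?_⟩
    obtain ⟨g, hg⟩ := hu' (η / 2) (ENNReal.half_pos hη.ne')
    obtain ⟨h, hh⟩ := hv' (η / 2) (ENNReal.half_pos hη.ne')
    refine ⟨g + h, ?_⟩
    have : (u + v - ((g + h : AP V) : V → ℝ)) = (u - ⇑g) + (v - ⇑h) := by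
      ext y; simp; ring
    rw [this]
    refine (besNorm_add_le hp.out (hu.sub g.aestronglyMeasurable)
      (hv.sub h.aestronglyMeasurable)).trans_lt ?_
    calc _ < η / 2 + η / 2 := ENNReal.add_lt_add hg hh
      _ = η := ENNReal.add_halves η
  smul_mem' := by
    rintro c u ⟨hu, hu'⟩
    refine ⟨hu.const_smul c, fun η hη => ?_⟩
    obtain ⟨g, hg⟩ := hu' (η / (‖c‖ₑ + 1)) (ENNReal.div_pos hη.ne' (by simp))
    refine ⟨c • g, ?_⟩
    have : (c • u - ((c • g : AP V) : V → ℝ)) = c • (u - ⇑g) := by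
      ext y; simp; ring
    rw [this, besNorm_smul]
    by_cases hc : c = 0
    · simpa [hc] using hη
    have hc' : ‖c‖ₑ ≠ 0 := by simpa using hc
    calc ‖c‖ₑ * besNorm p (u - ⇑g) < ‖c‖ₑ * (η / (‖c‖ₑ + 1)) :=
          (ENNReal.mul_lt_mul_iff_right hc' enorm_ne_top).2 hg
      _ ≤ (‖c‖ₑ + 1) * (η / (‖c‖ₑ + 1)) := by gcongr; exact le_self_add
      _ ≤ η := ENNReal.mul_div_le

theorem besNorm_lt_top {p : ℝ≥0∞} [hp : Fact (1 ≤ p)] {u : V → ℝ} (hu : u ∈ besSubmodule V p) :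
    besNorm p u < ∞ := by
  obtain ⟨g, hg⟩ := hu.2 1 one_pos
  have h := besNorm_add_le hp.out (hu.1.sub g.aestronglyMeasurable) g.aestronglyMeasurable
  rw [sub_add_cancel] at h
  exact h.trans_lt (ENNReal.add_lt_top.2 ⟨hg.trans ENNReal.one_lt_top, besNorm_AP_lt_top p g⟩)

theorem AP.mem_besSubmodule (p : ℝ≥0∞) [Fact (1 ≤ p)] (g : AP V) :
    (g : V → ℝ) ∈ besSubmodule V p :=
  ⟨g.aestronglyMeasurable, fun η hη => ⟨g, by rw [sub_self, besNorm_zero]; exact hη⟩⟩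

variable (V) in
/-- `B^p_AP(V)` as a type, with the Besicovitch seminorm. -/
def BesFun (p : ℝ≥0∞) [Fact (1 ≤ p)] : Type _ := ↥(besSubmodule V p)

noncomputable instance (p : ℝ≥0∞) [Fact (1 ≤ p)] : AddCommGroup (BesFun V p) :=
  inferInstanceAs (AddCommGroup (besSubmodule V p))

noncomputable instance (p : ℝ≥0∞) [Fact (1 ≤ p)] : Module ℝ (BesFun V p) :=
  inferInstanceAs (Module ℝ (besSubmodule V p))

noncomputable instance (p : ℝ≥0∞) [Fact (1 ≤ p)] : SeminormedAddCommGroup (BesFun V p) :=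
  AddGroupSeminorm.toSeminormedAddCommGroup
    { toFun := fun u => (besNorm p u.1).toReal
      map_zero' := by
        have : ((0 : BesFun V p).1 : V → ℝ) = 0 := rfl
        rw [this, besNorm_zero, ENNReal.toReal_zero]
      add_le' := fun u v => by
        rw [← ENNReal.toReal_add (besNorm_lt_top u.2).ne (besNorm_lt_top v.2).ne]
        exact ENNReal.toReal_mono
          (ENNReal.add_lt_top.2 ⟨besNorm_lt_top u.2, besNorm_lt_top v.2⟩).ne
          (besNorm_add_le Fact.out u.2.1 v.2.1)
      neg' := fun u => by
        have : ((-u).1 : V → ℝ) = (-1 : ℝ) • u.1 := by ext y; simp; rfl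
        rw [this, besNorm_smul]; simp }

theorem BesFun.norm_def {p : ℝ≥0∞} [Fact (1 ≤ p)] (u : BesFun V p) :
    ‖u‖ = (besNorm p u.1).toReal := rfl

noncomputable instance (p : ℝ≥0∞) [Fact (1 ≤ p)] : NormedSpace ℝ (BesFun V p) where
  norm_smul_le c u := by
    rw [BesFun.norm_def, BesFun.norm_def]
    have : ((c • u).1 : V → ℝ) = c • u.1 := rfl
    rw [this, besNorm_smul, ENNReal.toReal_mul]; simp

variable (V) in
/-- The normed space `𝓑^p_AP(V)`: the quotient of `B^p_AP(V)` by the functions of zero seminorm. -/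
abbrev Bes (p : ℝ≥0∞) [Fact (1 ≤ p)] : Type _ := SeparationQuotient (BesFun V p)

/-- The class in `𝓑^p_AP(V)` of an almost periodic function. -/
noncomputable def AP.toBes (p : ℝ≥0∞) [Fact (1 ≤ p)] (g : AP V) : Bes V p :=
  SeparationQuotient.mk (⟨g, g.mem_besSubmodule p⟩ : besSubmodule V p)

end Besicovitch

section TwoVariables
variable {V W : Type*} [NormedAddCommGroup V] [NormedAddCommGroup W]

/-- The translate `u(· + a)` of an almost periodic function. -/
def AP.shift (a : V) (u : AP V) : AP V :=
  AP.mk (translate a u.toBCF) (isAlmostPeriodic_of_subset u.isAlmostPeriodic fun b => by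
    have : translate b (translate a u.toBCF) = translate (b + a) u.toBCF := by
      ext y; simp [add_assoc]
    rw [this]; exact mem_orbitClosure _ _)

@[simp] theorem AP.shift_apply (a : V) (u : AP V) (y : V) : u.shift a y = u (y + a) := rfl

theorem AP.continuous_shift (u : AP V) : Continuous fun a : V => u.shift a :=
  Continuous.subtype_mk (continuous_translate u.isAlmostPeriodic) _

theorem AP.exists_finset_shift (u : AP V) {η : ℝ} (hη : 0 < η) :
    ∃ F : Finset V, ∀ a : V, ∃ b ∈ F, dist (u.shift a) (u.shift b) < η :=
  exists_bounded_translate u.isAlmostPeriodic hη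

/-- Continuous operations that intertwine translations preserve almost periodicity. -/
theorem isAlmostPeriodic_of_intertwine (Φ : AP V → (W →ᵇ ℝ)) (hΦ : Continuous Φ) (u : AP V)
    (h : ∀ b, ∃ a, translate b (Φ u) = Φ (u.shift a)) : IsAlmostPeriodic (Φ u) := by
  have hemb : IsClosedEmbedding (Subtype.val : AP V → (V →ᵇ ℝ)) :=
    isClosed_apSubalgebra.isClosedEmbedding_subtypeVal
  refine isAlmostPeriodic_of_subset ((hemb.isCompact_preimage u.isAlmostPeriodic).image hΦ)
    fun b => ?_
  obtain ⟨a, ha⟩ := h b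
  exact ⟨u.shift a, mem_orbitClosure _ a, ha.symm⟩

/-- The bounded continuous function `u(y, ·)`. -/
noncomputable def AP.sliceBCF (y : V) (u : AP (WithLp 2 (V × W))) : W →ᵇ ℝ :=
  u.toBCF.compContinuous ⟨fun w => WithLp.toLp 2 (y, w), by fun_prop⟩

theorem AP.dist_sliceBCF_le (y : V) (u v : AP (WithLp 2 (V × W))) :
    dist (u.sliceBCF y) (v.sliceBCF y) ≤ dist u v :=
  (BoundedContinuousFunction.dist_le dist_nonneg).2 fun _ =>
    BoundedContinuousFunction.dist_coe_le_dist (f := u.toBCF) (g := v.toBCF) _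

/-- The partial function `u(y, ·)` of an almost periodic function `u` of two variables. -/
noncomputable def AP.slice (y : V) (u : AP (WithLp 2 (V × W))) : AP W :=
  AP.mk (u.sliceBCF y) <| isAlmostPeriodic_of_intertwine _
    (LipschitzWith.mk_one (AP.dist_sliceBCF_le y)).continuous u fun b =>
      ⟨WithLp.toLp 2 (0, b), by
        ext w
        change u (WithLp.toLp 2 (y, w + b)) = u (WithLp.toLp 2 (y, w) + WithLp.toLp 2 (0, b))
        rw [← WithLp.toLp_add]; simp⟩

@[simp] theorem AP.slice_apply (y : V) (u : AP (WithLp 2 (V × W))) (w : W) :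
    u.slice y w = u (WithLp.toLp 2 (y, w)) := rfl

theorem AP.dist_slice_le (y : V) (u v : AP (WithLp 2 (V × W))) :
    dist (u.slice y) (v.slice y) ≤ dist u v := AP.dist_sliceBCF_le y u v

theorem AP.slice_shift (y a : V) (u : AP (WithLp 2 (V × W))) :
    (u.shift (WithLp.toLp 2 (a, 0))).slice y = u.slice (y + a) := by
  ext w
  change u (WithLp.toLp 2 (y, w) + WithLp.toLp 2 (a, 0)) = u (WithLp.toLp 2 (y + a, w))
  rw [← WithLp.toLp_add]; simp

theorem AP.continuous_slice (u : AP (WithLp 2 (V × W))) : Continuous fun y : V => u.slice y := by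
  have h : (fun y : V => u.slice y)
      = fun y : V => (u.shift (WithLp.toLp 2 (y, 0))).slice 0 := by
    ext1 y; rw [AP.slice_shift, zero_add]
  rw [h]
  exact (LipschitzWith.mk_one (AP.dist_slice_le (0 : V))).continuous.comp
    (u.continuous_shift.comp (by fun_prop))

theorem abs_character_sub_le (r : BohrSpace W) (u v : AP W) : |r u - r v| ≤ dist u v := by
  rw [← map_sub, dist_eq_norm]; exact abs_character_le r _

/-- The bounded continuous function `y ↦ r(u(y, ·))`. -/
noncomputable def AP.partialBCF (r : BohrSpace W) (u : AP (WithLp 2 (V × W))) : V →ᵇ ℝ :=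
  BoundedContinuousFunction.ofNormedAddCommGroup (fun y => r (u.slice y))
    ((map_continuous r).comp u.continuous_slice) ‖u‖ fun _ =>
      (abs_character_le r _).trans (AP.norm_le _ (norm_nonneg u) fun _ => u.abs_apply_le _)

@[simp] theorem AP.partialBCF_apply (r : BohrSpace W) (u : AP (WithLp 2 (V × W))) (y : V) :
    u.partialBCF r y = r (u.slice y) := rfl

/-- The almost periodic function `y ↦ r(u(y, ·))`, i.e. the Gelfand transformation of `u` with
respect to the second variable, at the character `r`. -/
noncomputable def AP.partialGelfand (r : BohrSpace W) (u : AP (WithLp 2 (V × W))) : AP V :=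
  AP.mk (u.partialBCF r) <| isAlmostPeriodic_of_intertwine _
    (LipschitzWith.mk_one fun u v => (BoundedContinuousFunction.dist_le dist_nonneg).2 fun y => by
      exact (abs_character_sub_le r _ _).trans (AP.dist_slice_le y u v)).continuous u fun b =>
      ⟨WithLp.toLp 2 (b, 0), by
        ext y
        rw [AP.partialBCF_apply, AP.slice_shift]; rfl⟩

@[simp] theorem AP.partialGelfand_apply (r : BohrSpace W) (u : AP (WithLp 2 (V × W))) (y : V) :
    u.partialGelfand r y = r (u.slice y) := rfl

theorem AP.continuous_partialGelfand (u : AP (WithLp 2 (V × W))) :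
    Continuous fun r : BohrSpace W => u.partialGelfand r := by
  refine Metric.continuous_iff'.2 fun r₀ η hη => ?_
  obtain ⟨F, hF⟩ := u.exists_finset_shift (η := η / 4) (by positivity)
  have h1 : ∀ᶠ r in 𝓝 r₀, ∀ b ∈ F, |r ((u.shift b).slice 0) - r₀ ((u.shift b).slice 0)| < η / 4 := by
    refine (Finset.eventually_all F).2 fun b _ => ?_
    have := (WeakDual.gelfandTransform ℝ (AP W) ((u.shift b).slice 0)).continuous.tendsto r₀
    exact Metric.tendsto_nhds.1 this _ (by positivity)
  filter_upwards [h1] with r hr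
  rw [dist_eq_norm]
  refine lt_of_le_of_lt (AP.norm_le _ (C := 3 * (η / 4)) (by positivity) fun y => ?_) (by linarith)
  obtain ⟨b, hb, hab⟩ := hF (WithLp.toLp 2 (y, 0))
  have e := AP.slice_shift (0 : V) y u
  rw [zero_add] at e
  have hd := (AP.dist_slice_le (0 : V) _ _).trans hab.le
  rw [e] at hd
  have k1 := (abs_character_sub_le r _ _).trans hd
  have k2 := (abs_character_sub_le r₀ _ _).trans hd
  have k3 := hr b hb
  rw [AP.sub_apply, AP.partialGelfand_apply, AP.partialGelfand_apply]
  rw [abs_le] at k1 k2 ⊢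
  rw [abs_lt] at k3
  constructor <;> linarith [k1.1, k1.2, k2.1, k2.2, k3.1, k3.2]

/-- The identification of `K_V × K_W` with the spectrum of `AP(V × W)`: the pair `(s, r)` is the
character `u ↦ s(y ↦ r(u(y, ·)))`. For `s = δ_y` and `r = δ_w` this is `δ_(y, w)`. -/
noncomputable def prodCharacter (s : BohrSpace V) (r : BohrSpace W) :
    BohrSpace (WithLp 2 (V × W)) :=
  WeakDual.CharacterSpace.equivAlgHom.symm
    ({ toFun := fun u => s (u.partialGelfand r)
       map_one' := by
         have : (1 : AP (WithLp 2 (V × W))).partialGelfand r = 1 := by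
           ext y
           have : (1 : AP (WithLp 2 (V × W))).slice y = 1 := rfl
           rw [AP.partialGelfand_apply, this, map_one, AP.one_apply]
         rw [this, map_one]
       map_mul' := fun u v => by
         have : (u * v).partialGelfand r = u.partialGelfand r * v.partialGelfand r := by
           ext y
           have : (u * v).slice y = u.slice y * v.slice y := rfl
           rw [AP.partialGelfand_apply, this, map_mul]; rfl
         rw [this, map_mul]
       map_zero' := by
         have : (0 : AP (WithLp 2 (V × W))).partialGelfand r = 0 := by
           ext y
           have : (0 : AP (WithLp 2 (V × W))).slice y = 0 := rfl
           rw [AP.partialGelfand_apply, this, map_zero]; rfl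
         rw [this, map_zero]
       map_add' := fun u v => by
         have : (u + v).partialGelfand r = u.partialGelfand r + v.partialGelfand r := by
           ext y
           have : (u + v).slice y = u.slice y + v.slice y := rfl
           rw [AP.partialGelfand_apply, this, map_add]; rfl
         rw [this, map_add]
       commutes' := fun c => by
         have : (algebraMap ℝ (AP (WithLp 2 (V × W))) c).partialGelfand r
             = algebraMap ℝ (AP V) c := by
           ext y
           have : (algebraMap ℝ (AP (WithLp 2 (V × W))) c).slice y = algebraMap ℝ (AP W) c := rfl
           rw [AP.partialGelfand_apply, this, AlgHomClass.commutes]; rfl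
         rw [this, AlgHomClass.commutes] } : AP (WithLp 2 (V × W)) →ₐ[ℝ] ℝ)

theorem prodCharacter_apply (s : BohrSpace V) (r : BohrSpace W) (u : AP (WithLp 2 (V × W))) :
    prodCharacter s r u = s (u.partialGelfand r) := rfl

theorem prodCharacter_dirac (y : V) (w : W) :
    prodCharacter (dirac y) (dirac w) = dirac (WithLp.toLp 2 (y, w)) :=
  Subtype.ext (ContinuousLinearMap.ext fun _ => rfl)

theorem continuous_prodCharacter (u : AP (WithLp 2 (V × W))) :
    Continuous fun q : BohrSpace V × BohrSpace W => prodCharacter q.1 q.2 u := by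
  refine continuous_iff_continuousAt.2 fun ⟨s₀, r₀⟩ => Metric.tendsto_nhds.2 fun η hη => ?_
  have h1 := Metric.continuous_iff'.1 u.continuous_partialGelfand r₀ (η / 2) (by positivity)
  have h2 : ∀ᶠ s in 𝓝 s₀, |s (u.partialGelfand r₀) - s₀ (u.partialGelfand r₀)| < η / 2 := by
    have := (WeakDual.gelfandTransform ℝ (AP V) (u.partialGelfand r₀)).continuous.tendsto s₀
    exact Metric.tendsto_nhds.1 this _ (by positivity)
  rw [nhds_prod_eq]
  filter_upwards [h2.prod_mk h1] with ⟨s, r⟩ ⟨hs, hr⟩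
  have h3 := abs_character_sub_le s (u.partialGelfand r) (u.partialGelfand r₀)
  have h4 := abs_sub_le (s (u.partialGelfand r)) (s (u.partialGelfand r₀)) (s₀ (u.partialGelfand r₀))
  rw [Real.dist_eq, prodCharacter_apply, prodCharacter_apply]
  simp only at hs hr ⊢
  linarith

/-- The Gelfand transform of an almost periodic function of two variables, as a continuous function
on `K_V × K_W`. -/
noncomputable def gelfandProd (u : AP (WithLp 2 (V × W))) : C(BohrSpace V × BohrSpace W, ℝ) :=
  ⟨fun q => gelfand u (prodCharacter q.1 q.2), continuous_prodCharacter u⟩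

/-- Continuous functions on a product of compact Hausdorff spaces are measurable for the product of
the Borel sigma-algebras. -/
theorem measurable_continuousMap_prod {X Y : Type*} [TopologicalSpace X] [TopologicalSpace Y]
    [CompactSpace X] [CompactSpace Y] [T2Space X] [T2Space Y] [MeasurableSpace X]
    [MeasurableSpace Y] [BorelSpace X] [BorelSpace Y] (φ : C(X × Y, ℝ)) : Measurable φ := by
  let A : Subalgebra ℝ C(X × Y, ℝ) :=
    { carrier := {φ | Measurable φ}
      mul_mem' := fun h k => Measurable.mul h k
      add_mem' := fun h k => Measurable.add h k
      algebraMap_mem' := fun _ => measurable_const }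
  have hcl : IsClosed (A : Set C(X × Y, ℝ)) := by
    refine isSeqClosed_iff_isClosed.1 fun φ ψ hφ hψ => ?_
    refine measurable_of_tendsto_metrizable (f := fun n => ⇑(φ n)) hφ (tendsto_pi_nhds.2 fun q => ?_)
    exact (continuous_eval_const q).continuousAt.tendsto.comp hψ
  have htop := ContinuousMap.subalgebra_topologicalClosure_eq_top_of_separatesPoints A ?_
  · have : φ ∈ A.topologicalClosure := htop ▸ Algebra.mem_top
    rw [← SetLike.mem_coe, Subalgebra.topologicalClosure_coe, hcl.closure_eq] at this
    exact this
  · rintro ⟨x, y⟩ ⟨x', y'⟩ hne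
    by_cases hx : x = x'
    · have hy : y ≠ y' := fun h => hne (by rw [hx, h])
      obtain ⟨f, hf0, hf1, -⟩ := exists_continuous_zero_one_of_isClosed
        (isClosed_singleton (x := y)) (isClosed_singleton (x := y')) (by simpa using hy)
      refine ⟨_, ⟨f.comp ⟨Prod.snd, continuous_snd⟩, f.continuous.measurable.comp measurable_snd,
        rfl⟩, ?_⟩
      simp [hf0 (mem_singleton y), hf1 (mem_singleton y')]
    · obtain ⟨f, hf0, hf1, -⟩ := exists_continuous_zero_one_of_isClosed
        (isClosed_singleton (x := x)) (isClosed_singleton (x := x')) (by simpa using hx)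
      refine ⟨_, ⟨f.comp ⟨Prod.fst, continuous_fst⟩, f.continuous.measurable.comp measurable_fst,
        rfl⟩, ?_⟩
      simp [hf0 (mem_singleton x), hf1 (mem_singleton x')]

theorem memLp_continuousMap_prod {X Y : Type*} [TopologicalSpace X] [TopologicalSpace Y]
    [CompactSpace X] [CompactSpace Y] [T2Space X] [T2Space Y] [MeasurableSpace X]
    [MeasurableSpace Y] [BorelSpace X] [BorelSpace Y] (φ : C(X × Y, ℝ)) (p : ℝ≥0∞)
    (μ : Measure (X × Y)) [IsFiniteMeasure μ] : MemLp φ p μ :=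
  MemLp.of_bound (measurable_continuousMap_prod φ).aestronglyMeasurable ‖φ‖
    (ae_of_all _ fun q => φ.norm_coe_le_norm q)

end TwoVariables

section ProductMean

section Uniqueness
variable {V : Type*} [NormedAddCommGroup V] [NormedSpace ℝ V] [FiniteDimensional ℝ V]
  [MeasureSpace V] [BorelSpace V] [(volume : Measure V).IsAddHaarMeasure]

theorem meanValue_shift (a : V) (u : AP V) : meanValue (u.shift a) = meanValue u := by
  refine tendsto_nhds_unique (tendsto_meanValue (u.shift a)) ?_
  have h : Tendsto (fun r : ℝ => (∫ y, u (y + a) ∂(unifBall V r)) - ∫ y, u y ∂(unifBall V r)) atTop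
      (𝓝 0) := by
    refine Metric.tendsto_nhds.2 fun η hη => ?_
    filter_upwards [eventually_shift u.isAlmostPeriodic (η := η / 2) (by positivity)] with r hr
    rw [Real.dist_eq, sub_zero]
    linarith [hr a]
  simpa using h.add (tendsto_meanValue u)

/-- Evaluation at a point as a continuous linear form on `AP(V)`. -/
noncomputable def evalCLM (y : V) : AP V →L[ℝ] ℝ :=
  (WeakDual.CharacterSpace.toAlgHom (dirac y)).toContinuousLinearMap

/-- The mean value is the only translation invariant continuous linear form with value `1` at `1`. -/
theorem eq_meanValue (L : AP V →L[ℝ] ℝ) (h1 : L 1 = 1) (hL : ∀ a u, L (u.shift a) = L u)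
    (u : AP V) : L u = meanValue u := by
  have key : ∀ η > 0, |L u - meanValue u| ≤ ‖L‖ * η + η := fun η hη => by
    obtain ⟨r, hr, hr2, hr0⟩ := ((eventually_shift u.isAlmostPeriodic hη).and
      ((Metric.tendsto_nhds.1 (tendsto_meanValue u) η hη).and (eventually_gt_atTop 0))).exists
    have := isProbabilityMeasure_unifBall (V := V) hr0
    have hint : Integrable (fun a : V => u.shift a) (unifBall V r) := by
      refine Integrable.of_bound u.continuous_shift.aestronglyMeasurable ‖u‖
        (ae_of_all _ fun a => AP.norm_le _ (norm_nonneg u) fun y => u.abs_apply_le _)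
    set w : AP V := ∫ a, u.shift a ∂(unifBall V r)
    have hLw : L w = L u := by
      rw [← L.integral_comp_comm hint]; simp [hL]
    have hw : ‖w - (∫ y, u y ∂(unifBall V r)) • (1 : AP V)‖ ≤ η := by
      refine AP.norm_le _ hη.le fun y => ?_
      have e : w y = ∫ a, u (a + y) ∂(unifBall V r) := by
        have := (evalCLM y).integral_comp_comm hint
        change _ = w y at this
        rw [← this]
        exact integral_congr_ae (ae_of_all _ fun a => congrArg u (add_comm y a))
      rw [AP.sub_apply, AP.smul_apply, AP.one_apply, mul_one, e]
      exact hr y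
    have h2 := L.le_opNorm (w - (∫ y, u y ∂(unifBall V r)) • (1 : AP V))
    rw [map_sub, map_smul, h1, smul_eq_mul, mul_one, hLw, Real.norm_eq_abs] at h2
    have h3 := mul_le_mul_of_nonneg_left hw (norm_nonneg L)
    rw [Real.dist_eq] at hr2
    linarith [abs_sub_le (L u) (∫ y, u y ∂(unifBall V r)) (meanValue u)]
  have h0 : |L u - meanValue u| ≤ 0 := by
    have ht : Tendsto (fun η : ℝ => ‖L‖ * η + η) (𝓝[>] 0) (𝓝 0) := by
      have : Continuous fun η : ℝ => ‖L‖ * η + η := by fun_prop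
      simpa using (this.tendsto 0).mono_left nhdsWithin_le_nhds
    exact ge_of_tendsto ht (eventually_mem_nhdsWithin.mono key)
  exact sub_eq_zero.1 (abs_nonpos_iff.1 h0)

end Uniqueness

variable {V W : Type*} [NormedAddCommGroup V] [InnerProductSpace ℝ V] [FiniteDimensional ℝ V]
  [MeasurableSpace V] [BorelSpace V] [NormedAddCommGroup W] [InnerProductSpace ℝ W]
  [FiniteDimensional ℝ W] [MeasurableSpace W] [BorelSpace W]

theorem integrable_gelfandProd (u : AP (WithLp 2 (V × W))) :
    Integrable (gelfandProd u) ((bohrMeasure V).prod (bohrMeasure W)) :=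
  memLp_one_iff_integrable.1 (memLp_continuousMap_prod _ _ _)

theorem integral_gelfandProd_shift_left (a : V) (u : AP (WithLp 2 (V × W))) :
    ∫ q, gelfandProd (u.shift (WithLp.toLp 2 (a, 0))) q ∂((bohrMeasure V).prod (bohrMeasure W))
      = ∫ q, gelfandProd u q ∂((bohrMeasure V).prod (bohrMeasure W)) := by
  rw [integral_prod_symm _ (integrable_gelfandProd _),
    integral_prod_symm _ (integrable_gelfandProd _)]
  refine integral_congr_ae (ae_of_all _ fun r => ?_)
  have e : (u.shift (WithLp.toLp 2 (a, 0))).partialGelfand r = (u.partialGelfand r).shift a := by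
    ext y
    rw [AP.partialGelfand_apply, AP.slice_shift]; rfl
  have h1 := integral_gelfand ((u.partialGelfand r).shift a)
  have h2 := integral_gelfand (u.partialGelfand r)
  rw [meanValue_shift, ← h2, ← e] at h1
  exact h1

theorem integral_gelfandProd_shift_right (b : W) (u : AP (WithLp 2 (V × W))) :
    ∫ q, gelfandProd (u.shift (WithLp.toLp 2 (0, b))) q ∂((bohrMeasure V).prod (bohrMeasure W))
      = ∫ q, gelfandProd u q ∂((bohrMeasure V).prod (bohrMeasure W)) := by
  have hint : ∀ v : AP (WithLp 2 (V × W)),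
      Integrable (fun r : BohrSpace W => v.partialGelfand r) (bohrMeasure W) := fun v =>
    v.continuous_partialGelfand.integrable_of_hasCompactSupport (HasCompactSupport.of_compactSpace _)
  have key : (∫ r, (u.shift (WithLp.toLp 2 (0, b))).partialGelfand r ∂(bohrMeasure W))
      = ∫ r, u.partialGelfand r ∂(bohrMeasure W) := by
    ext y
    have h : ∀ v : AP (WithLp 2 (V × W)),
        (∫ r, v.partialGelfand r ∂(bohrMeasure W)) y = meanValue (v.slice y) := fun v => by
      have := (evalCLM y).integral_comp_comm (hint v)
      rw [← integral_gelfand]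
      exact this.symm
    rw [h, h]
    have e : (u.shift (WithLp.toLp 2 (0, b))).slice y = (u.slice y).shift b := by
      ext w
      change u (WithLp.toLp 2 (y, w) + WithLp.toLp 2 (0, b)) = u (WithLp.toLp 2 (y, w + b))
      rw [← WithLp.toLp_add]; simp
    rw [e, meanValue_shift]
  rw [integral_prod _ (integrable_gelfandProd _), integral_prod _ (integrable_gelfandProd _)]
  refine integral_congr_ae (ae_of_all _ fun s => ?_)
  let S : AP V →L[ℝ] ℝ := (WeakDual.CharacterSpace.toAlgHom s).toContinuousLinearMap
  have h1 := S.integral_comp_comm (hint (u.shift (WithLp.toLp 2 (0, b))))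
  have h2 := S.integral_comp_comm (hint u)
  rw [key, ← h2] at h1
  exact h1

/-- The measure on `K_V × K_W` that represents the mean value on `AP(V × W)` is the product of the
measures on `K_V` and `K_W`. -/
theorem integral_gelfandProd (u : AP (WithLp 2 (V × W))) :
    ∫ q, gelfandProd u q ∂((bohrMeasure V).prod (bohrMeasure W)) = meanValue u := by
  let L : AP (WithLp 2 (V × W)) →L[ℝ] ℝ := LinearMap.mkContinuous
    { toFun := fun u => ∫ q, gelfandProd u q ∂((bohrMeasure V).prod (bohrMeasure W))
      map_add' := fun u v => by
        rw [← integral_add (integrable_gelfandProd u) (integrable_gelfandProd v)]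
        exact integral_congr_ae (ae_of_all _ fun q => map_add (prodCharacter q.1 q.2) u v)
      map_smul' := fun c u => by
        rw [RingHom.id_apply, ← integral_smul]
        exact integral_congr_ae (ae_of_all _ fun q => map_smul (prodCharacter q.1 q.2) c u) } 1
    fun u => by
      refine (norm_integral_le_of_norm_le_const (C := ‖u‖)
        (ae_of_all _ fun q => abs_character_le (prodCharacter q.1 q.2) u)).trans ?_
      simp
  refine eq_meanValue L ?_ (fun c v => ?_) u
  · change ∫ q, gelfandProd (1 : AP (WithLp 2 (V × W))) q ∂_ = 1
    have : ∀ q : BohrSpace V × BohrSpace W, gelfandProd (1 : AP (WithLp 2 (V × W))) q = 1 :=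
      fun q => map_one (prodCharacter q.1 q.2)
    simp [this]
  · have e : v.shift c
        = (v.shift (WithLp.toLp 2 (0, c.snd))).shift (WithLp.toLp 2 (c.fst, 0)) := by
      have e0 : WithLp.toLp 2 (c.fst, (0 : W)) + WithLp.toLp 2 ((0 : V), c.snd) = c := by
        rw [← WithLp.toLp_add, Prod.mk_add_mk, add_zero, zero_add]; rfl
      ext y
      rw [AP.shift_apply, AP.shift_apply, AP.shift_apply, add_assoc, e0]
    change ∫ q, gelfandProd (v.shift c) q ∂_ = ∫ q, gelfandProd v q ∂_
    rw [e, integral_gelfandProd_shift_left, integral_gelfandProd_shift_right]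

end ProductMean

section Extension
variable {V : Type*} [NormedAddCommGroup V] [NormedSpace ℝ V] [FiniteDimensional ℝ V]
  [MeasureSpace V] [BorelSpace V] [(volume : Measure V).IsAddHaarMeasure]
  {p : ℝ≥0∞} [Fact (1 ≤ p)]

/-- The extension by continuity to `𝓑^p_AP(V)` of a map defined on `AP(V)`. -/
noncomputable def extendBes {X : Type*} [TopologicalSpace X] [Nonempty X] (T : AP V → X)
    (u : Bes V p) : X :=
  limUnder (comap (AP.toBes p) (𝓝 u)) T

theorem AP.toBes_sub (g h : AP V) : (g - h).toBes p = g.toBes p - h.toBes p := rfl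

theorem AP.norm_toBes (g : AP V) : ‖g.toBes p‖ = (besNorm p g).toReal := rfl

theorem AP.denseRange_toBes : DenseRange (AP.toBes p : AP V → Bes V p) := by
  intro u
  obtain ⟨u, rfl⟩ := SeparationQuotient.surjective_mk u
  refine Metric.mem_closure_iff.2 fun η hη => ?_
  obtain ⟨g, hg⟩ := u.2.2 (ENNReal.ofReal η) (by simpa using hη)
  refine ⟨_, ⟨g, rfl⟩, ?_⟩
  rw [dist_eq_norm]
  change (besNorm p (u.1 - ⇑g)).toReal < η
  exact (ENNReal.lt_ofReal_iff_toReal_lt (hg.trans_le le_top).ne).1 hg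

/-- The extension by continuity of an isometric map is given by an honest limit. -/
theorem tendsto_extendBes {X : Type*} [MetricSpace X] [CompleteSpace X] [Nonempty X]
    {T : AP V → X} (hT : ∀ g h, dist (T g) (T h) = dist (g.toBes p) (h.toBes p)) (u : Bes V p) :
    Tendsto T (comap (AP.toBes p) (𝓝 u)) (𝓝 (extendBes T u)) := by
  have hne : NeBot (comap (AP.toBes p) (𝓝 u)) :=
    forall_mem_nonempty_iff_neBot.1 fun t ht => by
      obtain ⟨U, hU, hUt⟩ := mem_comap.1 ht
      obtain ⟨g, hg⟩ := AP.denseRange_toBes.exists_mem_open isOpen_interior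
        ⟨u, mem_interior_iff_mem_nhds.2 hU⟩
      exact ⟨g, hUt (show AP.toBes p g ∈ U from interior_subset hg)⟩
  refine tendsto_nhds_limUnder (cauchy_map_iff_exists_tendsto.1
    (Metric.cauchy_iff.2 ⟨inferInstance, fun η hη => ?_⟩))
  refine ⟨_, image_mem_map (preimage_mem_comap (ball_mem_nhds u (half_pos hη))), ?_⟩
  rintro _ ⟨g, hg, rfl⟩ _ ⟨h, hh, rfl⟩
  rw [hT]
  linarith [dist_triangle_right (g.toBes p) (h.toBes p) u, mem_ball.1 hg, mem_ball.1 hh]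

/-- `|g|^q` is almost periodic, and the characters commute with this operation. -/
theorem AP.exists_rpow (g : AP V) {q : ℝ} (hq : 0 ≤ q) :
    ∃ h : AP V, (∀ y, h y = |g y| ^ q) ∧ ∀ s : BohrSpace V, s h = |s g| ^ q := by
  let φ : C(BohrSpace V, ℝ) := ⟨fun s => |s g| ^ q,
    ((gelfand g).continuous.abs).rpow_const fun _ => Or.inr hq⟩
  have hs : ∀ s : BohrSpace V, s (gelfand.symm φ) = |s g| ^ q := fun s => by
    have := gelfand_apply (gelfand.symm φ) s
    rw [AlgEquiv.apply_symm_apply] at this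
    exact this.symm
  exact ⟨gelfand.symm φ, fun y => hs (dirac y), hs⟩

theorem AP.norm_toBes_eq (hp : p ≠ ∞) (g h : AP V) (hh : ∀ y, h y = |g y| ^ p.toReal) :
    ‖g.toBes p‖ = meanValue h ^ (p.toReal)⁻¹ := by
  have hp0 : p ≠ 0 := (zero_lt_one.trans_le (Fact.out : 1 ≤ p)).ne'
  have hp1 : 0 < p.toReal := ENNReal.toReal_pos hp0 hp
  have hlim : Tendsto (fun r : ℝ => eLpNorm g p (unifBall V r)) atTop
      (𝓝 (ENNReal.ofReal (meanValue h ^ (p.toReal)⁻¹))) := by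
    have h1 := ENNReal.tendsto_ofReal
      ((tendsto_meanValue h).rpow_const (p := (p.toReal)⁻¹) (Or.inr (by positivity)))
    refine h1.congr' ?_
    filter_upwards [eventually_gt_atTop 0] with r hr
    have := isProbabilityMeasure_unifBall (V := V) hr
    have hm : MemLp g p (unifBall V r) := MemLp.of_bound
      g.toBCF.continuous.aestronglyMeasurable ‖g‖ (ae_of_all _ fun y => g.abs_apply_le y)
    rw [hm.eLpNorm_eq_integral_rpow_norm hp0 hp]
    simp only [hh, Real.norm_eq_abs]
  rw [AP.norm_toBes, besNorm, hlim.limsup_eq, ENNReal.toReal_ofReal]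
  refine Real.rpow_nonneg (meanValue_nonneg _ fun y => ?_) _
  rw [hh]; positivity

theorem norm_toLp_eq_integral {X : Type*} [MeasurableSpace X] {μ : Measure X} (hp : p ≠ ∞)
    {f : X → ℝ} (hf : MemLp f p μ) :
    ‖hf.toLp f‖ = (∫ x, |f x| ^ p.toReal ∂μ) ^ (p.toReal)⁻¹ := by
  have hp0 : p ≠ 0 := (zero_lt_one.trans_le (Fact.out : 1 ≤ p)).ne'
  rw [Lp.norm_toLp, hf.eLpNorm_eq_integral_rpow_norm hp0 hp, ENNReal.toReal_ofReal]
  · simp only [Real.norm_eq_abs]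
  · exact Real.rpow_nonneg (integral_nonneg fun _ => by positivity) _

theorem memLp_gelfand (g : AP V) : MemLp (gelfand g) p (bohrMeasure V) :=
  MemLp.of_bound (gelfand g).continuous.aestronglyMeasurable ‖g‖
    (ae_of_all _ fun s => abs_character_le s g)

variable (p) in
/-- The Gelfand transform of an almost periodic function as an element of `L^p(K)`. -/
noncomputable def gelfandLp (g : AP V) : Lp ℝ p (bohrMeasure V) := (memLp_gelfand g).toLp _

theorem dist_gelfandLp (hp : p ≠ ∞) (g h : AP V) :
    dist (gelfandLp p g) (gelfandLp p h) = dist (g.toBes p) (h.toBes p) := by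
  rw [dist_eq_norm, dist_eq_norm, ← AP.toBes_sub]
  have e : gelfandLp p g - gelfandLp p h = gelfandLp p (g - h) := by
    rw [gelfandLp, gelfandLp, ← MemLp.toLp_sub]
    exact MemLp.toLp_congr _ _ (ae_of_all _ fun s => (map_sub s g h).symm)
  rw [e]
  obtain ⟨w, hw, hws⟩ := (g - h).exists_rpow (q := p.toReal) ENNReal.toReal_nonneg
  rw [AP.norm_toBes_eq hp _ w hw, ← integral_gelfand, gelfandLp, norm_toLp_eq_integral hp]
  simp only [gelfand_apply, hws]

/-- The transformation `𝒢₁ : 𝓑^p_AP(V) → L^p(K_V)`, `u ↦ û`: the extension by continuity of the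
Gelfand transformation. -/
noncomputable def hat (u : Bes V p) : Lp ℝ p (bohrMeasure V) := extendBes (gelfandLp p) u

theorem tendsto_hat (hp : p ≠ ∞) (u : Bes V p) :
    Tendsto (gelfandLp p) (comap (AP.toBes p) (𝓝 u)) (𝓝 (hat u)) :=
  tendsto_extendBes (dist_gelfandLp hp) u

end Extension

section ExtensionProd
variable {V W : Type*} [NormedAddCommGroup V] [InnerProductSpace ℝ V] [FiniteDimensional ℝ V]
  [MeasurableSpace V] [BorelSpace V] [NormedAddCommGroup W] [InnerProductSpace ℝ W]
  [FiniteDimensional ℝ W] [MeasurableSpace W] [BorelSpace W] {p : ℝ≥0∞} [Fact (1 ≤ p)]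

variable (p) in
/-- The Gelfand transform of an almost periodic function of two variables as an element of
`L^p(K_V × K_W)`. -/
noncomputable def gelfandProdLp (g : AP (WithLp 2 (V × W))) :
    Lp ℝ p ((bohrMeasure V).prod (bohrMeasure W)) :=
  (memLp_continuousMap_prod (gelfandProd g) p _).toLp _

theorem dist_gelfandProdLp (hp : p ≠ ∞) (g h : AP (WithLp 2 (V × W))) :
    dist (gelfandProdLp p g) (gelfandProdLp p h) = dist (g.toBes p) (h.toBes p) := by
  rw [dist_eq_norm, dist_eq_norm, ← AP.toBes_sub]
  have e : gelfandProdLp p g - gelfandProdLp p h = gelfandProdLp p (g - h) := by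
    rw [gelfandProdLp, gelfandProdLp, ← MemLp.toLp_sub]
    exact MemLp.toLp_congr _ _ (ae_of_all _ fun q => (map_sub (prodCharacter q.1 q.2) g h).symm)
  rw [e]
  obtain ⟨w, hw, hws⟩ := (g - h).exists_rpow (q := p.toReal) ENNReal.toReal_nonneg
  rw [AP.norm_toBes_eq hp _ w hw, ← integral_gelfandProd, gelfandProdLp, norm_toLp_eq_integral hp]
  congr 1
  exact integral_congr_ae (ae_of_all _ fun q => (hws (prodCharacter q.1 q.2)).symm)

/-- The transformation `𝒢₁ : 𝓑^p_AP(V × W) → L^p(K_V × K_W)`, `u ↦ û`: the extension by continuity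
of the Gelfand transformation. -/
noncomputable def hatProd (u : Bes (WithLp 2 (V × W)) p) :
    Lp ℝ p ((bohrMeasure V).prod (bohrMeasure W)) :=
  extendBes (gelfandProdLp p) u

theorem tendsto_hatProd (hp : p ≠ ∞) (u : Bes (WithLp 2 (V × W)) p) :
    Tendsto (gelfandProdLp p) (comap (AP.toBes p) (𝓝 u)) (𝓝 (hatProd u)) :=
  tendsto_extendBes (dist_gelfandProdLp hp) u

end ExtensionProd

section PartialIntegral
variable {X Y : Type*} [MeasurableSpace X] [MeasurableSpace Y] {μ : Measure X} {ν : Measure Y}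
  [IsProbabilityMeasure μ] [IsProbabilityMeasure ν] {p : ℝ≥0∞}

theorem memLp_partialIntegral (hp : 1 ≤ p) {f : X × Y → ℝ} (hf : MemLp f p (μ.prod ν)) :
    MemLp (fun x => ∫ y, f (x, y) ∂ν) p μ := by
  refine ⟨hf.1.integral_prod_right', ?_⟩
  by_cases hpt : p = ∞
  · subst hpt
    have h := ae_le_eLpNormEssSup (f := f) (μ := μ.prod ν)
    have h2 : ∀ᵐ x ∂μ, ‖∫ y, f (x, y) ∂ν‖ₑ ≤ eLpNormEssSup f (μ.prod ν) := by
      filter_upwards [Measure.ae_ae_of_ae_prod h] with x hx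
      refine (enorm_integral_le_lintegral_enorm _).trans ((lintegral_mono_ae hx).trans ?_)
      simp
    rw [eLpNorm_exponent_top]
    refine (essSup_le_of_ae_le _ h2).trans_lt ?_
    rw [← eLpNorm_exponent_top]; exact hf.2
  · have hp0 : p ≠ 0 := (zero_lt_one.trans_le hp).ne'
    have hp1 : 0 < p.toReal := ENNReal.toReal_pos hp0 hpt
    rw [eLpNorm_lt_top_iff_lintegral_rpow_enorm_lt_top hp0 hpt]
    have hfin := hf.2
    rw [eLpNorm_lt_top_iff_lintegral_rpow_enorm_lt_top hp0 hpt,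
      lintegral_prod _ (hf.1.enorm.pow_const _)] at hfin
    refine (lintegral_mono_ae ?_).trans_lt hfin
    filter_upwards [hf.1.prodMk_left] with x hx
    have h1 : ‖∫ y, f (x, y) ∂ν‖ₑ ≤ eLpNorm (fun y => f (x, y)) p ν := by
      refine (enorm_integral_le_lintegral_enorm _).trans ?_
      rw [← eLpNorm_one_eq_lintegral_enorm]
      exact eLpNorm_le_eLpNorm_of_exponent_le hp hx
    rw [eLpNorm_eq_lintegral_rpow_enorm_toReal hp0 hpt] at h1
    calc _ ≤ _ := ENNReal.rpow_le_rpow h1 hp1.le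
      _ = _ := by rw [← ENNReal.rpow_mul, one_div, inv_mul_cancel₀ hp1.ne', ENNReal.rpow_one]

/-- The partial integral `x ↦ ∫ f(x, y) dν(y)`, as a map from `L^p(X × Y)` to `L^p(X)`. -/
noncomputable def partialIntegral [hp : Fact (1 ≤ p)] (f : Lp ℝ p (μ.prod ν)) : Lp ℝ p μ :=
  (memLp_partialIntegral hp.out (Lp.memLp f)).toLp fun x => ∫ y, f (x, y) ∂ν

end PartialIntegral

section ConstInSecond
variable {V W : Type*} [NormedAddCommGroup V] [InnerProductSpace ℝ V] [FiniteDimensional ℝ V]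
  [MeasurableSpace V] [BorelSpace V] [NormedAddCommGroup W] [InnerProductSpace ℝ W]
  [FiniteDimensional ℝ W] [MeasurableSpace W] [BorelSpace W] {p : ℝ≥0∞}

theorem quasiMeasurePreserving_fst :
    Measure.QuasiMeasurePreserving (fun q : WithLp 2 (V × W) => q.fst) volume volume :=
  Measure.quasiMeasurePreserving_fst.comp
    (WithLp.volume_preserving_ofLp V W).quasiMeasurePreserving

variable (V W) in
/-- The ratio of the volumes of a cylinder and of the ball inscribed in it. -/
noncomputable def ballRatio : ℝ≥0∞ :=
  volume (ball (0 : V) 1) * volume (ball (0 : W) 1) * (volume (ball (0 : WithLp 2 (V × W)) 1))⁻¹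

theorem ballRatio_ne_top : ballRatio V W ≠ ∞ :=
  ENNReal.mul_ne_top (ENNReal.mul_ne_top measure_ball_lt_top.ne measure_ball_lt_top.ne)
    (ENNReal.inv_ne_top.2 (measure_ball_pos _ _ one_pos).ne')

theorem map_fst_unifBall_le {r : ℝ} (hr : 0 < r) :
    (unifBall (WithLp 2 (V × W)) r).map (fun q => q.fst) ≤ ballRatio V W • unifBall V r := by
  refine Measure.le_iff.2 fun S hS => ?_
  have hm : Measurable fun q : WithLp 2 (V × W) => q.fst := quasiMeasurePreserving_fst.measurable
  have hsub : ball (0 : WithLp 2 (V × W)) r ∩ (fun q => q.fst) ⁻¹' S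
      ⊆ WithLp.ofLp ⁻¹' ((ball (0 : V) r ∩ S) ×ˢ ball (0 : W) r) := by
    rintro q ⟨hq, hqS⟩
    rw [mem_ball_zero_iff] at hq
    refine ⟨⟨?_, hqS⟩, ?_⟩
    · exact mem_ball_zero_iff.2 ((WithLp.norm_fst_le _ q).trans_lt hq)
    · exact mem_ball_zero_iff.2 ((WithLp.norm_snd_le _ q).trans_lt hq)
  have hvol : volume (ball (0 : WithLp 2 (V × W)) r ∩ (fun q => q.fst) ⁻¹' S)
      ≤ volume (ball (0 : V) r ∩ S) * volume (ball (0 : W) r) := by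
    refine (measure_mono hsub).trans_eq ?_
    rw [(WithLp.volume_preserving_ofLp V W).measure_preimage
      ((measurableSet_ball.inter hS).prod measurableSet_ball).nullMeasurableSet]
    exact Measure.prod_prod _ _
  have hvW := Measure.addHaar_ball_of_pos volume (0 : W) hr
  have hvV := Measure.addHaar_ball_of_pos volume (0 : V) hr
  have hvVW := Measure.addHaar_ball_of_pos volume (0 : WithLp 2 (V × W)) hr
  have hdim : Module.finrank ℝ (WithLp 2 (V × W)) = Module.finrank ℝ V + Module.finrank ℝ W := by
    rw [← Module.finrank_prod, (WithLp.linearEquiv 2 ℝ (V × W)).finrank_eq]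
  rw [hdim, pow_add, ENNReal.ofReal_mul (by positivity)] at hvVW
  have key : (volume (ball (0 : WithLp 2 (V × W)) r))⁻¹ * volume (ball (0 : W) r)
      = ballRatio V W * (volume (ball (0 : V) r))⁻¹ := by
    rw [hvW, hvV, hvVW, ballRatio]
    have a0 : ENNReal.ofReal (r ^ Module.finrank ℝ V) ≠ 0 := by simp; positivity
    have b0 : ENNReal.ofReal (r ^ Module.finrank ℝ W) ≠ 0 := by simp; positivity
    have v0 : volume (ball (0 : V) 1) ≠ 0 := (measure_ball_pos _ _ one_pos).ne'
    have c0 : volume (ball (0 : WithLp 2 (V × W)) 1) ≠ 0 := (measure_ball_pos _ _ one_pos).ne'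
    have vt : volume (ball (0 : V) 1) ≠ ∞ := measure_ball_lt_top.ne
    have wt : volume (ball (0 : W) 1) ≠ ∞ := measure_ball_lt_top.ne
    have ct : volume (ball (0 : WithLp 2 (V × W)) 1) ≠ ∞ := measure_ball_lt_top.ne
    have a1 := ENNReal.ofReal_ne_top (r := r ^ Module.finrank ℝ V)
    have b1 := ENNReal.ofReal_ne_top (r := r ^ Module.finrank ℝ W)
    generalize ENNReal.ofReal (r ^ Module.finrank ℝ V) = a at *
    generalize ENNReal.ofReal (r ^ Module.finrank ℝ W) = b at *
    generalize volume (ball (0 : V) 1) = v at *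
    generalize volume (ball (0 : W) 1) = w at *
    generalize volume (ball (0 : WithLp 2 (V × W)) 1) = c at *
    lift a to NNReal using a1
    lift b to NNReal using b1
    lift v to NNReal using vt
    lift w to NNReal using wt
    lift c to NNReal using ct
    rw [ENNReal.coe_ne_zero] at a0 b0 v0 c0
    have hl : a * b * c ≠ 0 := by positivity
    have hr' : a * v ≠ 0 := by positivity
    rw [← ENNReal.coe_mul, ← ENNReal.coe_mul, ← ENNReal.coe_mul, ← ENNReal.coe_mul,
      ← ENNReal.coe_mul, ← ENNReal.coe_inv hl, ← ENNReal.coe_inv c0, ← ENNReal.coe_inv hr',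
      ← ENNReal.coe_mul, ← ENNReal.coe_mul, ← ENNReal.coe_mul, ENNReal.coe_inj]
    field_simp
  rw [Measure.map_apply hm hS]
  simp only [unifBall, Measure.smul_apply, smul_eq_mul, Measure.restrict_apply hS,
    Measure.restrict_apply (hm hS)]
  rw [inter_comm, inter_comm S]
  calc _ ≤ (volume (ball (0 : WithLp 2 (V × W)) r))⁻¹
        * (volume (ball (0 : V) r ∩ S) * volume (ball (0 : W) r)) := by gcongr
    _ = (volume (ball (0 : WithLp 2 (V × W)) r))⁻¹ * volume (ball (0 : W) r)
        * volume (ball (0 : V) r ∩ S) := by ring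
    _ ≤ _ := by rw [key, mul_assoc]

theorem besNorm_comp_fst_le {u : V → ℝ} (hu : AEStronglyMeasurable u volume) :
    besNorm p (fun q : WithLp 2 (V × W) => u q.fst)
      ≤ (ballRatio V W) ^ (1 / p).toReal * besNorm p u := by
  have hC : (ballRatio V W) ^ (1 / p).toReal ≠ ∞ :=
    ENNReal.rpow_ne_top_of_nonneg ENNReal.toReal_nonneg ballRatio_ne_top
  rw [besNorm, besNorm, ← ENNReal.limsup_const_mul_of_ne_top hC]
  refine limsup_le_limsup ?_ (by isBoundedDefault) (by isBoundedDefault)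
  filter_upwards [eventually_gt_atTop 0] with r hr
  have hq := quasiMeasurePreserving_fst (V := V) (W := W)
  have hac : (unifBall (WithLp 2 (V × W)) r).map (fun q => q.fst) ≪ volume :=
    ((unifBall_absolutelyContinuous r).map hq.measurable).trans hq.absolutelyContinuous
  have h1 := eLpNorm_map_measure (p := p) (hu.mono_ac hac) hq.measurable.aemeasurable
  change eLpNorm (u ∘ fun q : WithLp 2 (V × W) => q.fst) p (unifBall _ r) ≤ _
  rw [← h1]
  exact (eLpNorm_mono_measure u (map_fst_unifBall_le hr)).trans (eLpNorm_smul_measure_le _ _ _ _)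

/-- An almost periodic function of the first variable as a function of both variables. -/
noncomputable def AP.compFst (g : AP V) : AP (WithLp 2 (V × W)) :=
  AP.mk (g.toBCF.compContinuous ⟨fun q : WithLp 2 (V × W) => q.fst, by fun_prop⟩) <|
    isAlmostPeriodic_of_intertwine
      (fun g : AP V => g.toBCF.compContinuous ⟨fun q : WithLp 2 (V × W) => q.fst, by fun_prop⟩)
      (LipschitzWith.mk_one fun u v => (BoundedContinuousFunction.dist_le dist_nonneg).2 fun _ =>
        BoundedContinuousFunction.dist_coe_le_dist (f := u.toBCF) (g := v.toBCF) _).continuous g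
      fun b => ⟨b.fst, by ext q; rfl⟩

@[simp] theorem AP.compFst_apply (g : AP V) (q : WithLp 2 (V × W)) : g.compFst q = g q.fst := rfl

variable [hp : Fact (1 ≤ p)]

theorem comp_fst_mem_besSubmodule {u : V → ℝ} (hu : u ∈ besSubmodule V p) :
    (fun q : WithLp 2 (V × W) => u q.fst) ∈ besSubmodule (WithLp 2 (V × W)) p := by
  refine ⟨hu.1.comp_quasiMeasurePreserving quasiMeasurePreserving_fst, fun η hη => ?_⟩
  have hC : (ballRatio V W) ^ (1 / p).toReal ≠ ∞ :=
    ENNReal.rpow_ne_top_of_nonneg ENNReal.toReal_nonneg ballRatio_ne_top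
  set C := (ballRatio V W) ^ (1 / p).toReal
  obtain ⟨g, hg⟩ := hu.2 (η / (C + 1)) (ENNReal.div_pos hη.ne' (by simp [hC]))
  refine ⟨g.compFst, ?_⟩
  refine (besNorm_comp_fst_le (hu.1.sub g.aestronglyMeasurable)).trans_lt ?_
  have h1 : besNorm p (u - ⇑g) ≠ ∞ := (hg.trans_le le_top).ne
  rw [ENNReal.lt_div_iff_mul_lt (Or.inl (by simp)) (Or.inl (by simp [hC]))] at hg
  refine lt_of_le_of_lt ?_ hg
  rw [mul_comm]
  gcongr
  exact le_self_add

/-- A function `u(y)` in `B^p_AP(V)` as the function `(y, w) ↦ u(y)` in `B^p_AP(V × W)`. -/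
def BesFun.compFst (u : BesFun V p) : BesFun (WithLp 2 (V × W)) p :=
  ⟨fun q => u.1 q.fst, comp_fst_mem_besSubmodule u.2⟩

theorem BesFun.continuous_compFst :
    Continuous (BesFun.compFst : BesFun V p → BesFun (WithLp 2 (V × W)) p) := by
  have hC : (ballRatio V W) ^ (1 / p).toReal ≠ ∞ :=
    ENNReal.rpow_ne_top_of_nonneg ENNReal.toReal_nonneg ballRatio_ne_top
  refine (LipschitzWith.of_dist_le_mul (K := ((ballRatio V W) ^ (1 / p).toReal).toNNReal)
    fun u v => ?_).continuous
  rw [dist_eq_norm, dist_eq_norm, BesFun.norm_def, BesFun.norm_def]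
  have h := besNorm_comp_fst_le (W := W) (p := p) (u := (u - v).1) (u - v).2.1
  have h2 := ENNReal.toReal_mono (ENNReal.mul_ne_top hC (besNorm_lt_top (u - v).2).ne) h
  rw [ENNReal.toReal_mul] at h2
  exact h2

/-- The embedding of `𝓑^p_AP(V)` into `𝓑^p_AP(V × W)`: the class of `u(y)` is sent to the class of
`(y, w) ↦ u(y)`. -/
noncomputable def constInSecond : Bes V p → Bes (WithLp 2 (V × W)) p :=
  SeparationQuotient.lift (fun u => SeparationQuotient.mk u.compFst) fun _ _ h =>
    SeparationQuotient.mk_eq_mk.2 (h.map BesFun.continuous_compFst)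

end ConstInSecond

section Sigma

/-- The Euclidean space `ℝ^N` of the variables `x` and `y`. -/
abbrev Space (N : ℕ) : Type := EuclideanSpace ℝ (Fin N)

/-- The Euclidean space `ℝ^{N+1} = ℝ^N × ℝ` of the microscopic variables `(y, τ)`. -/
abbrev MicroSpaceTime (N : ℕ) : Type := WithLp 2 (Space N × ℝ)

/-- The cylinder `Q = Ω × (0, T)`. -/
def cyl {N : ℕ} (Ω : Set (Space N)) (T : ℝ) : Set (Space N × ℝ) := Ω ×ˢ Ioo 0 T

/-- `u_ε → u₀` in `L^p(Q)`-weak Σ, along a filter `l` on the index set of the family, the scale of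
the member with index `i` being `ε i`. The exponent `p'` is the conjugate of `p`, and the inner
integral on the right is over `K_y × K_τ`. -/
structure WeakSigmaConverges {N : ℕ} {ι : Type*} (l : Filter ι) (ε : ι → ℝ)
    (Q : Set (Space N × ℝ)) (p : ℝ≥0∞) [Fact (1 ≤ p)] (u : ι → Space N × ℝ → ℝ)
    (u₀ : Space N × ℝ → Bes (MicroSpaceTime N) p) : Prop where
  memLp (i : ι) : MemLp (u i) p (volume.restrict Q)
  memLp_limit : MemLp u₀ p (volume.restrict Q)
  tendsto (p' : ℝ≥0∞) (hp' : p⁻¹ + p'⁻¹ = 1) (f : Space N × ℝ → AP (MicroSpaceTime N))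
    (hf : MemLp f p' (volume.restrict Q)) :
    Tendsto
      (fun i => ∫ z in Q, u i z * f z (WithLp.toLp 2 ((ε i)⁻¹ • z.1, (ε i)⁻¹ * z.2))) l
      (𝓝 (∫ z in Q, ∫ k, hatProd (u₀ z) k * gelfandProd (f z) k
        ∂((bohrMeasure (Space N)).prod (bohrMeasure ℝ))))

/-- The time primitive `w(x, t) = ∫₀ᵗ v(x, τ) dτ`. -/
noncomputable def timePrimitive {N : ℕ} (v : Space N × ℝ → ℝ) (z : Space N × ℝ) : ℝ :=
  ∫ τ in (0 : ℝ)..z.2, v (z.1, τ)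

end Sigma

end APSigma

open APSigma

/-
By Fubini, `∫_Q w_ε f(x, t, x/ε, t/ε)` equals the integral over `Q` of `v_ε(x, τ)` against the
backward time integral `∫_τ^T f(x, t, x/ε, t/ε) dt`. As `ε → 0` the latter approaches the same
integral of the mean value of `f` in the microscopic time variable, uniformly in the microscopic
space variable, for almost every `(x, τ)` and with a majorant in `L^{p'}(Q)`. A sequence such as
`(v_ε)`, which converges weakly in `L^p`, may be paired with such a dominated sequence that tends to
`0` almost everywhere: by Baire's theorem on the unit ball of `L^∞`, which is complete for
convergence in measure, the functionals `φ ↦ ∫_Q v_ε H φ`, where `H` is the majorant, are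
equicontinuous at `0`. The backward integral of the mean value is itself an admissible
test function, and in the limit the integration by parts is undone. The limit `w₀` exists because
`B^p_AP` is complete (Marcinkiewicz), so that its Gelfand transformation is onto `L^p(K)`.
-/

namespace APSigma

section WeakLOne

theorem exists_isOpen_forall_dist_le {X Y : Type*} [TopologicalSpace X] [BaireSpace X] [Nonempty X]
    [PseudoMetricSpace Y] {F : ℕ → X → Y} (hF : ∀ n, Continuous (F n))
    (hc : ∀ x, CauchySeq fun n => F n x) {η : ℝ} (hη : 0 < η) :
    ∃ m, ∃ U : Set X, IsOpen U ∧ U.Nonempty ∧ ∀ n ≥ m, ∀ x ∈ U, dist (F n x) (F m x) ≤ η := by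
  let C : ℕ → Set X := fun m => ⋂ n ≥ m, {x | dist (F n x) (F m x) ≤ η}
  have hC : ∀ m, IsClosed (C m) := fun m => isClosed_biInter fun n _ =>
    isClosed_le ((hF n).dist (hF m)) continuous_const
  have hU : ⋃ m, C m = univ := eq_univ_of_forall fun x => by
    obtain ⟨m, hm⟩ := Metric.cauchySeq_iff'.1 (hc x) η hη
    exact mem_iUnion.2 ⟨m, mem_iInter₂.2 fun n hn => (hm n hn).le⟩
  obtain ⟨m, hm⟩ := nonempty_interior_of_iUnion_of_closed hC hU
  exact ⟨m, _, isOpen_interior, hm, fun n hn x hx => mem_iInter₂.1 (interior_subset hx) n hn⟩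

variable {α : Type*} [MeasurableSpace α] {μ : Measure α} [SFinite μ]

/-- The Saks space of `μ`: the measurable functions bounded by `1`, with the distance of `L¹`. The
distance is that of the finite measure `μ.toFinite`, which has the same null sets as `μ` and for
which all these functions are integrable. -/
abbrev SaksSpace (μ : Measure α) [SFinite μ] : Type _ :=
  {φ : Lp ℝ 1 μ.toFinite // ∀ᵐ x ∂μ, |φ x| ≤ 1}

namespace SaksSpace

theorem aestronglyMeasurable (φ : SaksSpace μ) : AEStronglyMeasurable φ.1 μ :=
  (Lp.aestronglyMeasurable φ.1).mono_ac (absolutelyContinuous_toFinite μ)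

theorem integrable_mul {u : α → ℝ} (hu : Integrable u μ) (φ : SaksSpace μ) :
    Integrable (fun x => u x * φ.1 x) μ :=
  hu.mul_bdd (c := 1) φ.aestronglyMeasurable φ.2

theorem exists_seq_tendsto_ae {φ : ℕ → Lp ℝ 1 μ.toFinite} {ψ : Lp ℝ 1 μ.toFinite}
    (h : Tendsto φ atTop (𝓝 ψ)) :
    ∃ ns : ℕ → ℕ, ∀ᵐ x ∂μ, Tendsto (fun n => φ (ns n) x) atTop (𝓝 (ψ x)) := by
  obtain ⟨ns, -, hns⟩ := (tendstoInMeasure_of_tendsto_Lp h).exists_seq_tendsto_ae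
  exact ⟨ns, ae_toFinite (μ := μ) ▸ hns⟩

instance : CompleteSpace (SaksSpace μ) := by
  have hclosed : IsClosed {φ : Lp ℝ 1 μ.toFinite | ∀ᵐ x ∂μ, |φ x| ≤ 1} := by
    refine isClosed_of_closure_subset fun ψ hψ => ?_
    obtain ⟨φ, hφ, hlim⟩ := mem_closure_iff_seq_limit.1 hψ
    obtain ⟨ns, hns⟩ := exists_seq_tendsto_ae hlim
    filter_upwards [hns, ae_all_iff.2 hφ] with x hx hb
    exact le_of_tendsto hx.abs (Eventually.of_forall fun n => hb (ns n))
  exact hclosed.completeSpace_coe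

theorem coeFn_zero_ae : ⇑(0 : Lp ℝ 1 μ.toFinite) =ᵐ[μ] 0 :=
  (absolutelyContinuous_toFinite μ).ae_eq (Lp.coeFn_zero ℝ 1 μ.toFinite)

noncomputable instance : Zero (SaksSpace μ) :=
  ⟨0, by filter_upwards [coeFn_zero_ae (μ := μ)] with x hx; simp only [hx, Pi.zero_apply, abs_zero,
    zero_le_one]⟩

theorem dist_zero (φ : SaksSpace μ) : dist φ 0 = ‖φ.1‖ :=
  dist_zero_right φ.1

theorem continuous_integral_mul {u : α → ℝ} (hu : Integrable u μ) :
    Continuous fun φ : SaksSpace μ => ∫ x, u x * φ.1 x ∂μ := by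
  refine continuous_iff_seqContinuous.2 fun φ ψ hφ => tendsto_of_subseq_tendsto fun ns hns => ?_
  obtain ⟨ms, hms⟩ := exists_seq_tendsto_ae ((continuous_subtype_val.tendsto ψ).comp (hφ.comp hns))
  refine ⟨ms, tendsto_integral_of_dominated_convergence (fun x => ‖u x‖)
    (fun n => (integrable_mul hu _).1) hu.norm (fun n => ?_) ?_⟩
  · filter_upwards [(φ (ns (ms n))).2] with x hx
    rw [norm_mul]
    exact mul_le_of_le_one_right (norm_nonneg _) hx
  · filter_upwards [hms] with x hx
    exact hx.const_mul _

theorem exists_ae_eq {f : α → ℝ} (hf : AEStronglyMeasurable f μ) (hb : ∀ᵐ x ∂μ, |f x| ≤ 1) :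
    ∃ φ : SaksSpace μ, φ.1 =ᵐ[μ] f := by
  have hm : MemLp f 1 μ.toFinite :=
    MemLp.of_bound (hf.mono_ac (toFinite_absolutelyContinuous μ)) 1 (by rwa [ae_toFinite])
  have h : hm.toLp f =ᵐ[μ] f := (absolutelyContinuous_toFinite μ).ae_eq hm.coeFn_toLp
  exact ⟨⟨hm.toLp f, by filter_upwards [h, hb] with x h1 h2; rwa [h1]⟩, h⟩

theorem dist_le_of_ae_abs_sub_le {φ ψ h : SaksSpace μ}
    (hle : ∀ᵐ x ∂μ, |φ.1 x - ψ.1 x| ≤ |h.1 x|) : dist φ ψ ≤ dist h 0 := by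
  rw [dist_zero, Subtype.dist_eq, dist_eq_norm]
  refine Lp.norm_le_norm_of_ae_le ?_
  filter_upwards [Lp.coeFn_sub φ.1 ψ.1, (toFinite_absolutelyContinuous μ).ae_le hle] with x h1 h2
  rwa [h1]

theorem abs_clip_add_le {s t : ℝ} (hs : |s| ≤ 1) (ht : |t| ≤ 1) :
    |max (-1) (min 1 (s + t))| ≤ 1 ∧ |max (-1) (min 1 (s + t)) - t| ≤ 1 ∧
      |max (-1) (min 1 (s + t)) - s| ≤ |t| ∧ |max (-1) (min 1 (s + t)) - t - s| ≤ |t| := by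
  rw [abs_le] at hs ht
  simp only [abs_le]
  rcases max_cases (-1) (min 1 (s + t)) with h1 | h1 <;>
    rcases min_cases 1 (s + t) with h2 | h2 <;> rcases abs_cases t with h3 | h3 <;>
      refine ⟨⟨?_, ?_⟩, ⟨?_, ?_⟩, ⟨?_, ?_⟩, ?_, ?_⟩ <;> linarith

theorem exists_sub_ae_eq (φ h : SaksSpace μ) :
    ∃ a b : SaksSpace μ, (∀ᵐ x ∂μ, a.1 x - b.1 x = h.1 x) ∧
      dist a φ ≤ dist h 0 ∧ dist b φ ≤ dist h 0 := by
  have hclip := φ.2.mp (h.2.mono fun x ht hs => abs_clip_add_le hs ht)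
  have hmeas : AEStronglyMeasurable (fun x => max (-1) (min 1 (φ.1 x + h.1 x))) μ :=
    aestronglyMeasurable_const.sup
      (aestronglyMeasurable_const.inf (φ.aestronglyMeasurable.add h.aestronglyMeasurable))
  obtain ⟨a, ha⟩ := exists_ae_eq hmeas (hclip.mono fun x hx => hx.1)
  obtain ⟨b, hb⟩ := exists_ae_eq (hmeas.sub h.aestronglyMeasurable) (hclip.mono fun x hx => hx.2.1)
  refine ⟨a, b, ?_, dist_le_of_ae_abs_sub_le ?_, dist_le_of_ae_abs_sub_le ?_⟩
  · filter_upwards [ha, hb] with x h1 h2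
    simp only [h1, h2, Pi.sub_apply, sub_sub_cancel]
  · filter_upwards [ha, hclip] with x h1 h2
    simpa only [h1] using h2.2.2.1
  · filter_upwards [hb, hclip] with x h1 h2
    simpa only [h1, Pi.sub_apply] using h2.2.2.2

variable {u : ℕ → α → ℝ}

theorem exists_forall_dist_integral_mul_le (hu : ∀ n, Integrable (u n) μ)
    (hc : ∀ φ : SaksSpace μ, CauchySeq fun n => ∫ x, u n x * φ.1 x ∂μ) {η : ℝ} (hη : 0 < η) :
    ∃ m, ∃ δ > 0, ∀ h ∈ ball (0 : SaksSpace μ) δ, ∀ n ≥ m,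
      dist (∫ x, u n x * h.1 x ∂μ) (∫ x, u m x * h.1 x ∂μ) ≤ η := by
  obtain ⟨m, U, hU, ⟨φ, hφ⟩, hm⟩ :=
    exists_isOpen_forall_dist_le (fun n => continuous_integral_mul (hu n)) hc (half_pos hη)
  obtain ⟨δ, hδ, hball⟩ := Metric.isOpen_iff.1 hU φ hφ
  refine ⟨m, δ, hδ, fun h hlt n hn => ?_⟩
  obtain ⟨a, b, hab, ha, hb⟩ := exists_sub_ae_eq φ h
  have split : ∀ k, ∫ x, u k x * h.1 x ∂μ
      = (∫ x, u k x * a.1 x ∂μ) - ∫ x, u k x * b.1 x ∂μ := fun k => by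
    rw [← integral_sub (integrable_mul (hu k) a) (integrable_mul (hu k) b)]
    refine integral_congr_ae ?_
    filter_upwards [hab] with x hx
    rw [← hx, mul_sub]
  rw [split n, split m]
  refine (dist_sub_sub_le _ _ _ _).trans ?_
  linarith [hm n hn a (hball (ha.trans_lt hlt)), hm n hn b (hball (hb.trans_lt hlt))]

theorem tendsto_integral_mul_of_tendsto_zero (hu : ∀ n, Integrable (u n) μ)
    (hc : ∀ φ : SaksSpace μ, CauchySeq fun n => ∫ x, u n x * φ.1 x ∂μ) {h : ℕ → SaksSpace μ}
    (hh : Tendsto h atTop (𝓝 0)) :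
    Tendsto (fun n => ∫ x, u n x * (h n).1 x ∂μ) atTop (𝓝 0) := by
  refine Metric.tendsto_nhds.2 fun η hη => ?_
  obtain ⟨m, δ, hδ, hm⟩ := exists_forall_dist_integral_mul_le hu hc (half_pos hη)
  have hum : Tendsto (fun n => ∫ x, u m x * (h n).1 x ∂μ) atTop (𝓝 0) := by
    have h0 : ∫ x, u m x * (0 : SaksSpace μ).1 x ∂μ = 0 := integral_eq_zero_of_ae <| by
      filter_upwards [coeFn_zero_ae (μ := μ)] with x hx
      exact (congrArg (u m x * ·) hx).trans (mul_zero _)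
    exact h0 ▸ ((continuous_integral_mul (hu m)).tendsto 0).comp hh
  filter_upwards [hh (ball_mem_nhds 0 hδ), Metric.tendsto_nhds.1 hum _ (half_pos hη),
    eventually_ge_atTop m] with n h1 h2 h3
  linarith [dist_triangle (∫ x, u n x * (h n).1 x ∂μ) (∫ x, u m x * (h n).1 x ∂μ) 0,
    hm (h n) h1 n h3]

theorem tendsto_zero_of_tendsto_ae {h : ℕ → SaksSpace μ}
    (hlim : ∀ᵐ x ∂μ, Tendsto (fun n => (h n).1 x) atTop (𝓝 0)) : Tendsto h atTop (𝓝 0) := by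
  refine tendsto_iff_dist_tendsto_zero.2 ?_
  simp only [dist_zero, L1.norm_eq_integral_norm]
  have hdom := tendsto_integral_of_dominated_convergence (μ := μ.toFinite)
    (F := fun n x => ‖(h n).1 x‖) (f := fun _ => 0) (fun _ => 1)
    (fun n => (Lp.aestronglyMeasurable _).norm) (integrable_const _)
    (fun n => by
      rw [ae_toFinite]
      filter_upwards [(h n).2] with x hx using (norm_norm _).trans_le hx)
    (by
      rw [ae_toFinite]
      filter_upwards [hlim] with x hx using tendsto_zero_iff_norm_tendsto_zero.1 hx)
  simpa only [integral_zero] using hdom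

end SaksSpace

/-- Dividing by the majorant `H` turns weak convergence in `L^p` into weak convergence in `L¹` of
`u n * H`, tested against elements of the Saks space. -/
theorem tendsto_integral_mul_of_abs_le {p q : ℝ≥0∞} [ENNReal.HolderConjugate p q]
    {u : ℕ → α → ℝ} (hu : ∀ n, MemLp (u n) p μ)
    (hc : ∀ φ : α → ℝ, MemLp φ q μ → CauchySeq fun n => ∫ x, u n x * φ x ∂μ)
    {h : ℕ → α → ℝ} {H : α → ℝ} (hH : MemLp H q μ)
    (hm : ∀ n, AEStronglyMeasurable (h n) μ) (hb : ∀ n, ∀ᵐ x ∂μ, |h n x| ≤ H x)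
    (hlim : ∀ᵐ x ∂μ, Tendsto (fun n => h n x) atTop (𝓝 0)) :
    Tendsto (fun n => ∫ x, u n x * h n x ∂μ) atTop (𝓝 0) := by
  have hquot : ∀ n, ∃ φ : SaksSpace μ, φ.1 =ᵐ[μ] fun x => h n x / H x := fun n => by
    refine SaksSpace.exists_ae_eq
      ((hm n).aemeasurable.div hH.1.aemeasurable).aestronglyMeasurable ?_
    filter_upwards [hb n] with x hx
    rw [abs_div]
    exact div_le_one_of_le₀ (hx.trans (le_abs_self _)) (abs_nonneg _)
  choose φ hφ using hquot
  have hcH : ∀ ψ : SaksSpace μ, CauchySeq fun n => ∫ x, (u n x * H x) * ψ.1 x ∂μ := fun ψ => by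
    simp only [mul_assoc]
    refine hc _ (hH.of_le_mul (c := 1) (hH.1.mul ψ.aestronglyMeasurable) ?_)
    filter_upwards [ψ.2] with x hx
    rw [norm_mul, one_mul]
    exact mul_le_of_le_one_right (norm_nonneg _) hx
  refine (SaksSpace.tendsto_integral_mul_of_tendsto_zero (fun n => (hu n).integrable_mul hH) hcH
    (SaksSpace.tendsto_zero_of_tendsto_ae (h := φ) ?_)).congr fun n => integral_congr_ae ?_
  · filter_upwards [hlim, ae_all_iff.2 hφ] with x hx hφx
    simpa only [hφx, zero_div] using hx.div_const (H x)
  · filter_upwards [hb n, hφ n] with x hx hφx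
    have hzero : H x = 0 → h n x = 0 := fun h0 => abs_nonpos_iff.1 (h0 ▸ hx)
    rw [hφx, Pi.mul_apply, mul_assoc, mul_div_cancel_of_imp' hzero]

end WeakLOne

section Slices
variable {X Y E : Type*} [MeasurableSpace X] [MeasurableSpace Y] {μ : Measure X} {ν : Measure Y}
  [NormedAddCommGroup E] {p : ℝ≥0∞}

theorem eLpNorm_eLpNorm_prodMk_le [SFinite ν] {f : X × Y → E}
    (hf : AEStronglyMeasurable f (μ.prod ν)) :
    eLpNorm (fun x => eLpNorm (fun y => f (x, y)) p ν) p μ ≤ eLpNorm f p (μ.prod ν) := by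
  rcases eq_or_ne p 0 with rfl | hp0
  · simp only [eLpNorm_exponent_zero, le_refl]
  rcases eq_or_ne p ∞ with rfl | hpt
  · simp only [eLpNorm_exponent_top]
    refine essSup_le_of_ae_le _ ?_
    filter_upwards [Measure.ae_ae_of_ae_prod (ae_le_eLpNormEssSup (f := f) (μ := μ.prod ν))]
      with x hx using essSup_le_of_ae_le _ hx
  · simp only [eLpNorm_eq_lintegral_rpow_enorm_toReal hp0 hpt, enorm_eq_self, ← ENNReal.rpow_mul,
      one_div_mul_cancel (ENNReal.toReal_pos hp0 hpt).ne', ENNReal.rpow_one]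
    rw [lintegral_prod _ (hf.enorm.pow_const _)]

theorem ae_lt_top_of_eLpNorm_ne_top {g : X → ℝ≥0∞} (hp : p ≠ 0) (hg : AEMeasurable g μ)
    (h : eLpNorm g p μ ≠ ∞) : ∀ᵐ x ∂μ, g x < ∞ := by
  rcases eq_or_ne p ∞ with rfl | hpt
  · rw [eLpNorm_exponent_top] at h
    filter_upwards [ae_le_eLpNormEssSup (f := g) (μ := μ)] with x hx
      using hx.trans_lt h.lt_top
  · have hfin := (eLpNorm_lt_top_iff_lintegral_rpow_enorm_lt_top hp hpt).1 h.lt_top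
    filter_upwards [ae_lt_top' (hg.pow_const _) hfin.ne] with x hx
    exact (ENNReal.rpow_lt_top_iff_of_pos (ENNReal.toReal_pos hp hpt)).1 hx

variable [IsFiniteMeasure ν]

theorem eLpNorm_lintegral_enorm_prodMk_lt_top (hp : 1 ≤ p) {f : X × Y → E}
    (hf : MemLp f p (μ.prod ν)) : eLpNorm (fun x => ∫⁻ y, ‖f (x, y)‖ₑ ∂ν) p μ < ∞ := by
  have hC : ν univ ^ (1 / (1 : ℝ≥0∞).toReal - 1 / p.toReal) ≠ ∞ := by
    refine ENNReal.rpow_ne_top_of_nonneg ?_ (measure_ne_top ν _)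
    rw [ENNReal.toReal_one, sub_nonneg]
    rcases eq_or_ne p ∞ with rfl | hpt
    · simp
    · exact one_div_le_one_div_of_le one_pos (ENNReal.toReal_mono hpt hp)
  lift ν univ ^ (1 / (1 : ℝ≥0∞).toReal - 1 / p.toReal) to NNReal using hC with C hC'
  have hle : ∀ᵐ x ∂μ, ∫⁻ y, ‖f (x, y)‖ₑ ∂ν ≤ C * eLpNorm (fun y => f (x, y)) p ν := by
    filter_upwards [hf.1.prodMk_left] with x hx
    rw [← eLpNorm_one_eq_lintegral_enorm, mul_comm, hC']
    exact eLpNorm_le_eLpNorm_mul_rpow_measure_univ hp hx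
  exact (eLpNorm_le_mul_eLpNorm_of_ae_le_mul' hle p).trans_lt <|
    ENNReal.mul_lt_top ENNReal.coe_lt_top ((eLpNorm_eLpNorm_prodMk_le hf.1).trans_lt hf.2)

theorem ae_integrable_prodMk (hp : 1 ≤ p) {f : X × Y → E} (hf : MemLp f p (μ.prod ν)) :
    ∀ᵐ x ∂μ, Integrable (fun y => f (x, y)) ν := by
  filter_upwards [hf.1.prodMk_left, ae_lt_top_of_eLpNorm_ne_top (zero_lt_one.trans_le hp).ne'
    hf.1.enorm.lintegral_prod_right' (eLpNorm_lintegral_enorm_prodMk_lt_top hp hf).ne]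
    with x hx hfin using ⟨hx, hfin⟩

theorem ae_integrable_prodMk_fst [SFinite μ] (hp : 1 ≤ p) {f : X × Y → E}
    (hf : MemLp f p (μ.prod ν)) : ∀ᵐ z ∂(μ.prod ν), Integrable (fun y => f (z.1, y)) ν :=
  Measure.quasiMeasurePreserving_fst.ae (ae_integrable_prodMk hp hf)

theorem memLp_integral_norm_prodMk (hp : 1 ≤ p) {f : X × Y → E} (hf : MemLp f p (μ.prod ν)) :
    MemLp (fun x => ∫ y, ‖f (x, y)‖ ∂ν) p μ := by
  refine ⟨hf.1.norm.integral_prod_right', lt_of_le_of_lt (eLpNorm_mono_enorm fun x => ?_)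
    (eLpNorm_lintegral_enorm_prodMk_lt_top hp hf)⟩
  simpa only [enorm_norm, enorm_eq_self] using
    enorm_integral_le_lintegral_enorm (μ := ν) fun y => ‖f (x, y)‖

end Slices

section KernelIntegral
variable {X Y E F : Type*} [MeasurableSpace Y] {ν : Measure Y}
  [NormedAddCommGroup E] [NormedSpace ℝ E] [NormedAddCommGroup F] [NormedSpace ℝ F] {p q : ℝ≥0∞}
  {S : Set (Y × Y)}

/-- The function `(x, t) ↦ ∫ 1_S(t, τ) f(x, τ) dν(τ)`, the image of `f` under the integral operator
whose kernel is the indicator function of `S`. -/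
noncomputable def kernelIntegral (ν : Measure Y) (S : Set (Y × Y)) (f : X × Y → E) (z : X × Y) :
    E :=
  ∫ τ in {τ | (z.2, τ) ∈ S}, f (z.1, τ) ∂ν

theorem norm_kernelIntegral_le {f : X × Y → E} {z : X × Y}
    (hf : Integrable (fun τ => f (z.1, τ)) ν) :
    ‖kernelIntegral ν S f z‖ ≤ ∫ τ, ‖f (z.1, τ)‖ ∂ν :=
  (norm_integral_le_integral_norm _).trans
    (setIntegral_le_integral hf.norm (ae_of_all _ fun _ => norm_nonneg _))

theorem kernelIntegral_eq_integral_indicator (hS : MeasurableSet S) (f : X × Y → E) (z : X × Y) :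
    kernelIntegral ν S f z = ∫ τ, S.indicator (fun a => f (z.1, a.2)) (z.2, τ) ∂ν :=
  (integral_indicator (hS.preimage measurable_prodMk_left)).symm

variable [MeasurableSpace X] {μ : Measure X} [SFinite μ]

theorem quasiMeasurePreserving_prodMap {X' Y' : Type*} [MeasurableSpace X'] [MeasurableSpace Y']
    {μ' : Measure X'} {ν' : Measure Y'} [SFinite ν] [SFinite ν'] {f : X → X'} {g : Y → Y'}
    (hf : Measure.QuasiMeasurePreserving f μ μ') (hg : Measure.QuasiMeasurePreserving g ν ν') :
    Measure.QuasiMeasurePreserving (Prod.map f g) (μ.prod ν) (μ'.prod ν') := by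
  refine ⟨hf.measurable.prodMap hg.measurable, ?_⟩
  rw [← Measure.map_prod_map _ _ hf.measurable hg.measurable]
  exact hf.absolutelyContinuous.prod hg.absolutelyContinuous

variable [IsFiniteMeasure ν]

theorem aestronglyMeasurable_kernelIntegral (hS : MeasurableSet S)
    {f : X × Y → E} (hf : AEStronglyMeasurable f (μ.prod ν)) :
    AEStronglyMeasurable (kernelIntegral ν S f) (μ.prod ν) := by
  have hm : MeasurableSet {a : (X × Y) × Y | (a.1.2, a.2) ∈ S} :=
    hS.preimage (by fun_prop : Measurable fun a : (X × Y) × Y => (a.1.2, a.2))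
  have hq := quasiMeasurePreserving_prodMap (Measure.quasiMeasurePreserving_fst (μ := μ) (ν := ν))
    (Measure.QuasiMeasurePreserving.id ν)
  refine ((hf.comp_quasiMeasurePreserving hq).indicator hm).integral_prod_right'.congr
    (ae_of_all _ fun z => (kernelIntegral_eq_integral_indicator hS f z).symm)

theorem memLp_kernelIntegral (hp : 1 ≤ p) (hS : MeasurableSet S)
    {f : X × Y → E} (hf : MemLp f p (μ.prod ν)) :
    MemLp (kernelIntegral ν S f) p (μ.prod ν) := by
  refine ((memLp_integral_norm_prodMk hp hf).comp_fst ν).mono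
    (aestronglyMeasurable_kernelIntegral hS hf.1) ?_
  filter_upwards [ae_integrable_prodMk_fst hp hf] with z hz
  exact (norm_kernelIntegral_le hz).trans (le_abs_self _)

theorem integrable_bilin [ENNReal.HolderConjugate p q] {α : Type*} [MeasurableSpace α]
    {m : Measure α} (L : E →L[ℝ] F →L[ℝ] ℝ) {f : α → E} {g : α → F} (hf : MemLp f p m)
    (hg : MemLp g q m) : Integrable (fun x => L (f x) (g x)) m :=
  memLp_one_iff_integrable.1 (L.memLp_of_bilin 1 hf hg)

/-- Both sides are the integral of `L (f (x, τ)) (g (x, t))` over the `(x, t, τ)` with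
`(t, τ) ∈ S`. -/
theorem integral_bilin_kernelIntegral [CompleteSpace E] [CompleteSpace F]
    [ENNReal.HolderConjugate p q] (L : E →L[ℝ] F →L[ℝ] ℝ) (hS : MeasurableSet S)
    {f : X × Y → E} {g : X × Y → F} (hf : MemLp f p (μ.prod ν)) (hg : MemLp g q (μ.prod ν)) :
    ∫ z, L (kernelIntegral ν S f z) (g z) ∂(μ.prod ν)
      = ∫ z, L (f z) (kernelIntegral ν (Prod.swap ⁻¹' S) g z) ∂(μ.prod ν) := by
  have hp : 1 ≤ p := ENNReal.HolderTriple.le p q 1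
  have hq : 1 ≤ q := ENNReal.HolderTriple.le q p 1
  have hS' : MeasurableSet (Prod.swap ⁻¹' S) := hS.preimage measurable_swap
  rw [integral_prod _ (integrable_bilin L (memLp_kernelIntegral hp hS hf) hg),
    integral_prod _ (integrable_bilin L hf (memLp_kernelIntegral hq hS' hg))]
  refine integral_congr_ae ?_
  filter_upwards [ae_integrable_prodMk hp hf, ae_integrable_prodMk hq hg] with x hfx hgx
  let K : Y × Y → ℝ := S.indicator fun a => L (f (x, a.2)) (g (x, a.1))
  have hleft : ∀ t, L (kernelIntegral ν S f (x, t)) (g (x, t)) = ∫ τ, K (t, τ) ∂ν := fun t => by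
    rw [kernelIntegral, ← ContinuousLinearMap.flip_apply,
      ← (L.flip (g (x, t))).integral_comp_comm hfx.restrict]
    exact (integral_indicator (hS.preimage measurable_prodMk_left)).symm
  have hright : ∀ τ, L (f (x, τ)) (kernelIntegral ν (Prod.swap ⁻¹' S) g (x, τ))
      = ∫ t, K (t, τ) ∂ν := fun τ => by
    rw [kernelIntegral, ← (L (f (x, τ))).integral_comp_comm hgx.restrict]
    exact (integral_indicator (hS'.preimage measurable_prodMk_left)).symm
  have hK : Integrable K (ν.prod ν) := Integrable.indicator
    (hgx.op_fst_snd (op := fun b a => L a b) (by fun_prop)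
      ⟨‖L‖, fun b a => (L.le_opNorm₂ a b).trans_eq (by ring)⟩ hfx) hS
  simp only [hleft, hright]
  exact integral_integral_swap hK

end KernelIntegral

section TimeIntegral
variable {X E F : Type*} [NormedAddCommGroup E] [NormedSpace ℝ E] [NormedAddCommGroup F]
  [NormedSpace ℝ F] {p q : ℝ≥0∞} {T : ℝ}

theorem intervalIntegral_zero_eq_kernelIntegral (f : X × ℝ → E) {z : X × ℝ} (hz : z.2 ∈ Ioo 0 T) :
    ∫ τ in (0 : ℝ)..z.2, f (z.1, τ)
      = kernelIntegral (volume.restrict (Ioo 0 T)) {a | a.2 ≤ a.1} f z := by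
  have hset : {τ | τ ≤ z.2} ∩ Ioo 0 T = Ioc 0 z.2 := by
    ext τ
    simp only [mem_inter_iff, mem_ofPred_eq, mem_Ioo, mem_Ioc]
    grind
  rw [kernelIntegral, intervalIntegral.integral_of_le hz.1.le, ← hset]
  exact congrArg (fun m => ∫ τ, f (z.1, τ) ∂m) (Measure.restrict_restrict measurableSet_Iic).symm

theorem intervalIntegral_last_eq_kernelIntegral (f : X × ℝ → E) {z : X × ℝ} (hz : z.2 ∈ Ioo 0 T) :
    ∫ t in z.2..T, f (z.1, t)
      = kernelIntegral (volume.restrict (Ioo 0 T)) (Prod.swap ⁻¹' {a | a.2 ≤ a.1}) f z := by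
  have hset : {t | z.2 ≤ t} ∩ Ioo 0 T = Ico z.2 T := by
    ext t
    simp only [mem_inter_iff, mem_ofPred_eq, mem_Ioo, mem_Ico]
    grind
  rw [kernelIntegral, intervalIntegral.integral_of_le hz.2.le, integral_Ioc_eq_integral_Ioo,
    ← integral_Ico_eq_integral_Ioo, ← hset]
  exact congrArg (fun m => ∫ t, f (z.1, t) ∂m) (Measure.restrict_restrict measurableSet_Ici).symm

theorem measurableSet_snd_le_fst : MeasurableSet {a : ℝ × ℝ | a.2 ≤ a.1} :=
  measurableSet_le measurable_snd measurable_fst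

variable [MeasurableSpace X] {μ : Measure X}

theorem ae_snd_mem_Ioo : ∀ᵐ z ∂(μ.prod (volume.restrict (Ioo (0 : ℝ) T))), z.2 ∈ Ioo 0 T :=
  Measure.quasiMeasurePreserving_snd.ae (ae_restrict_mem measurableSet_Ioo)

variable [SFinite μ]

theorem memLp_intervalIntegral_zero (hp : 1 ≤ p) {f : X × ℝ → E}
    (hf : MemLp f p (μ.prod (volume.restrict (Ioo 0 T)))) :
    MemLp (fun z : X × ℝ => ∫ τ in (0 : ℝ)..z.2, f (z.1, τ)) p
      (μ.prod (volume.restrict (Ioo 0 T))) :=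
  (memLp_kernelIntegral hp measurableSet_snd_le_fst hf).ae_eq <|
    ae_snd_mem_Ioo.mono fun _ hz => (intervalIntegral_zero_eq_kernelIntegral f hz).symm

theorem memLp_intervalIntegral_last (hp : 1 ≤ p) {f : X × ℝ → E}
    (hf : MemLp f p (μ.prod (volume.restrict (Ioo 0 T)))) :
    MemLp (fun z : X × ℝ => ∫ t in z.2..T, f (z.1, t)) p
      (μ.prod (volume.restrict (Ioo 0 T))) :=
  (memLp_kernelIntegral hp (measurableSet_snd_le_fst.preimage measurable_swap) hf).ae_eq <|
    ae_snd_mem_Ioo.mono fun _ hz => (intervalIntegral_last_eq_kernelIntegral f hz).symm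

theorem integral_bilin_intervalIntegral [CompleteSpace E] [CompleteSpace F]
    [ENNReal.HolderConjugate p q] (L : E →L[ℝ] F →L[ℝ] ℝ) {f : X × ℝ → E} {g : X × ℝ → F}
    (hf : MemLp f p (μ.prod (volume.restrict (Ioo 0 T))))
    (hg : MemLp g q (μ.prod (volume.restrict (Ioo 0 T)))) :
    ∫ z, L (∫ τ in (0 : ℝ)..z.2, f (z.1, τ)) (g z) ∂(μ.prod (volume.restrict (Ioo 0 T)))
      = ∫ z, L (f z) (∫ t in z.2..T, g (z.1, t)) ∂(μ.prod (volume.restrict (Ioo 0 T))) := calc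
  _ = ∫ z, L (kernelIntegral _ _ f z) (g z) ∂(μ.prod (volume.restrict (Ioo 0 T))) :=
    integral_congr_ae <| ae_snd_mem_Ioo.mono fun z hz =>
      congrArg (fun a => L a (g z)) (intervalIntegral_zero_eq_kernelIntegral f hz)
  _ = ∫ z, L (f z) (kernelIntegral _ _ g z) ∂(μ.prod (volume.restrict (Ioo 0 T))) :=
    integral_bilin_kernelIntegral L measurableSet_snd_le_fst hf hg
  _ = _ := integral_congr_ae <| ae_snd_mem_Ioo.mono fun z hz =>
      congrArg (L (f z)) (intervalIntegral_last_eq_kernelIntegral g hz).symm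

end TimeIntegral

section MeanInSecond

theorem AP.continuous_eval {V : Type*} [NormedAddCommGroup V] :
    Continuous fun q : AP V × V => q.1 q.2 :=
  (ContinuousEval.continuous_eval (F := V →ᵇ ℝ)).comp
    ((continuous_subtype_val.comp continuous_fst).prodMk continuous_snd)

variable {V W : Type*} [NormedAddCommGroup V] [NormedAddCommGroup W]

theorem norm_partialGelfand_le (r : BohrSpace W) (c : AP (WithLp 2 (V × W))) :
    ‖c.partialGelfand r‖ ≤ ‖c‖ :=
  AP.norm_le _ (norm_nonneg c) fun _ => (abs_character_le r _).trans
    (AP.norm_le _ (norm_nonneg c) fun _ => c.abs_apply_le _)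

theorem gelfandProd_compFst (g : AP V) (k : BohrSpace V × BohrSpace W) :
    gelfandProd (g.compFst : AP (WithLp 2 (V × W))) k = k.1 g := by
  have hconst : (g.compFst : AP (WithLp 2 (V × W))).partialGelfand k.2 = g := by
    ext y
    have hslice : (g.compFst : AP (WithLp 2 (V × W))).slice y = algebraMap ℝ (AP W) (g y) := rfl
    rw [AP.partialGelfand_apply, hslice, AlgHomClass.commutes]
    rfl
  exact congrArg k.1 hconst

variable [InnerProductSpace ℝ W] [FiniteDimensional ℝ W] [MeasurableSpace W] [BorelSpace W]

theorem integrable_partialGelfand (c : AP (WithLp 2 (V × W))) :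
    Integrable (fun r : BohrSpace W => c.partialGelfand r) (bohrMeasure W) :=
  c.continuous_partialGelfand.integrable_of_hasCompactSupport (HasCompactSupport.of_compactSpace _)

/-- The mean value in the second variable of an almost periodic function of two variables. It is
defined by integrating over the spectrum; `avgSnd_apply` identifies it with a limit of averages. -/
noncomputable def avgSnd : AP (WithLp 2 (V × W)) →L[ℝ] AP V :=
  LinearMap.mkContinuous
    { toFun := fun c => ∫ r, c.partialGelfand r ∂(bohrMeasure W)
      map_add' := fun c d => by
        rw [← integral_add (integrable_partialGelfand c) (integrable_partialGelfand d)]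
        exact integral_congr_ae <| ae_of_all _ fun r =>
          AP.ext fun y => map_add r (c.slice y) (d.slice y)
      map_smul' := fun a c => by
        rw [RingHom.id_apply, ← integral_smul]
        exact integral_congr_ae <| ae_of_all _ fun r => AP.ext fun y => map_smul r a (c.slice y) } 1
    fun c => by
      refine (norm_integral_le_of_norm_le_const (C := ‖c‖)
        (ae_of_all _ fun r => norm_partialGelfand_le r c)).trans ?_
      simp

theorem norm_avgSnd_le (c : AP (WithLp 2 (V × W))) : ‖avgSnd c‖ ≤ ‖c‖ := by
  simpa using avgSnd.le_of_opNorm_le (LinearMap.mkContinuous_norm_le _ zero_le_one _) c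

theorem avgSnd_apply (c : AP (WithLp 2 (V × W))) (y : V) : avgSnd c y = meanValue (c.slice y) := by
  rw [← integral_gelfand]
  exact ((evalCLM y).integral_comp_comm (integrable_partialGelfand c)).symm

theorem character_avgSnd (s : BohrSpace V) (c : AP (WithLp 2 (V × W))) :
    s (avgSnd c) = ∫ r, gelfandProd c (s, r) ∂(bohrMeasure W) :=
  ((WeakDual.CharacterSpace.toAlgHom s).toContinuousLinearMap.integral_comp_comm
    (integrable_partialGelfand c)).symm

/-- The embedding of the almost periodic functions on `V` into those on `V × W`, as functions that
do not depend on the second variable. -/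
noncomputable def compFstCLM : AP V →L[ℝ] AP (WithLp 2 (V × W)) :=
  LinearMap.mkContinuous
    { toFun := AP.compFst
      map_add' := fun _ _ => rfl
      map_smul' := fun _ _ => rfl } 1
    fun g => (AP.norm_le (g.compFst : AP (WithLp 2 (V × W))) (norm_nonneg g) fun _ =>
      g.abs_apply_le _).trans_eq (one_mul _).symm

theorem dist_integral_unifBall_le (u v : AP W) {r : ℝ} (hr : 0 < r) :
    dist (∫ y, u y ∂(unifBall W r)) (∫ y, v y ∂(unifBall W r)) ≤ dist u v := by
  have := isProbabilityMeasure_unifBall (V := W) hr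
  rw [dist_eq_norm, ← integral_sub (integrable_unifBall _ hr) (integrable_unifBall _ hr)]
  refine (norm_integral_le_of_norm_le_const (C := dist u v) (ae_of_all _ fun y => ?_)).trans
    (by simp)
  exact BoundedContinuousFunction.dist_coe_le_dist (f := u.toBCF) (g := v.toBCF) y

theorem dist_meanValue_le (u v : AP W) : dist (meanValue u) (meanValue v) ≤ dist u v :=
  le_of_tendsto ((tendsto_meanValue u).dist (tendsto_meanValue v)) <|
    (eventually_gt_atTop 0).mono fun _ hr => dist_integral_unifBall_le u v hr

/-- Almost periodicity reduces the claim, through a finite net of translates of `c`, to the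
convergence of the means of finitely many functions. -/
theorem eventually_dist_integral_slice_avgSnd_le (c : AP (WithLp 2 (V × W))) {η : ℝ} (hη : 0 < η) :
    ∀ᶠ r in atTop, ∀ (y : V) (w : W),
      dist (∫ σ, c (WithLp.toLp 2 (y, σ + w)) ∂(unifBall W r)) (avgSnd c y) ≤ η := by
  obtain ⟨S, hS⟩ := c.exists_finset_shift (η := η / 3) (by positivity)
  have hmean : ∀ᶠ r in atTop, ∀ b ∈ S, dist (∫ σ, (c.shift b).slice 0 σ ∂(unifBall W r))
      (meanValue ((c.shift b).slice 0)) < η / 3 :=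
    (Finset.eventually_all S).2 fun b _ =>
      Metric.tendsto_nhds.1 (tendsto_meanValue ((c.shift b).slice 0)) (η / 3) (by positivity)
  filter_upwards [hmean, eventually_gt_atTop 0] with r hr hr0 y w
  obtain ⟨b, hb, hcb⟩ := hS (WithLp.toLp 2 (y, w))
  set u := (c.slice y).shift w
  set v := (c.shift b).slice 0
  have hu : (c.shift (WithLp.toLp 2 (y, w))).slice 0 = u := by
    ext σ
    change c (WithLp.toLp 2 (0, σ) + WithLp.toLp 2 (y, w)) = c (WithLp.toLp 2 (y, σ + w))
    rw [← WithLp.toLp_add]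
    simp
  have huv : dist u v ≤ η / 3 := hu ▸ (AP.dist_slice_le (0 : V) _ _).trans hcb.le
  calc dist (∫ σ, u σ ∂(unifBall W r)) (avgSnd c y)
      = dist (∫ σ, u σ ∂(unifBall W r)) (meanValue u) := by rw [avgSnd_apply, meanValue_shift]
    _ ≤ dist (∫ σ, u σ ∂(unifBall W r)) (∫ σ, v σ ∂(unifBall W r))
        + dist (∫ σ, v σ ∂(unifBall W r)) (meanValue v) + dist (meanValue v) (meanValue u) :=
      dist_triangle4 _ _ _ _
    _ ≤ dist u v + η / 3 + dist v u := by
      gcongr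
      exacts [dist_integral_unifBall_le u v hr0, (hr b hb).le, dist_meanValue_le v u]
    _ ≤ η := by linarith [dist_comm u v]

end MeanInSecond

section Oscillation

theorem integral_unifBall_comp_add (g : ℝ → ℝ) (c : ℝ) {r : ℝ} (hr : 0 < r) :
    ∫ σ, g (σ + c) ∂(unifBall ℝ r) = (2 * r)⁻¹ * ∫ σ in (c - r)..(c + r), g σ := by
  rw [integral_unifBall, Real.ball_eq_Ioo, zero_sub, zero_add,
    Real.volume_real_Ioo_of_le (by linarith), ← integral_Ioc_eq_integral_Ioo,
    ← intervalIntegral.integral_of_le (by linarith), intervalIntegral.integral_comp_add_right]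
  ring_nf

theorem integral_Ioo_comp_inv_mul (g : ℝ → ℝ) {a b e : ℝ} (he : 0 < e) (hab : a < b) :
    ∫ t in Ioo a b, g (e⁻¹ * t)
      = (b - a) * ∫ σ, g (σ + (a + b) / (2 * e)) ∂(unifBall ℝ ((b - a) / (2 * e))) := by
  have hba : 0 < b - a := sub_pos.2 hab
  have hleft : (a + b) / (2 * e) - (b - a) / (2 * e) = e⁻¹ * a := by field_simp; ring
  have hright : (a + b) / (2 * e) + (b - a) / (2 * e) = e⁻¹ * b := by field_simp; ring
  rw [integral_unifBall_comp_add g _ (by positivity), hleft, hright,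
    ← integral_Ioc_eq_integral_Ioo, ← intervalIntegral.integral_of_le hab.le,
    intervalIntegral.integral_comp_mul_left g (inv_ne_zero he.ne'), inv_inv, smul_eq_mul]
  field_simp

theorem integrable_AP_eval {V α : Type*} [NormedAddCommGroup V] [MeasurableSpace V] [BorelSpace V]
    [MeasurableSpace α] {m : Measure α} {f : α → AP V} (hf : Integrable f m) {φ : α → V}
    (hφ : AEStronglyMeasurable φ m) : Integrable (fun t => f t (φ t)) m :=
  hf.norm.mono' (AP.continuous_eval.comp_aestronglyMeasurable (hf.1.prodMk hφ))
    (ae_of_all _ fun t => (f t).abs_apply_le _)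

variable {V : Type*} [NormedAddCommGroup V] {a b : ℝ} {f g : ℝ → AP (WithLp 2 (V × ℝ))}

/-- The deviation of the function `t ↦ f(t)(y, t/e)`, which oscillates at the scale `e`, from its
mean value in the microscopic time variable. -/
noncomputable def oscillation (f : ℝ → AP (WithLp 2 (V × ℝ))) (e : ℝ) (y : V) (t : ℝ) : ℝ :=
  f t (WithLp.toLp 2 (y, e⁻¹ * t)) - avgSnd (f t) y

theorem oscillation_add (f g : ℝ → AP (WithLp 2 (V × ℝ))) (e : ℝ) (y : V) :
    oscillation (f + g) e y = oscillation f e y + oscillation g e y := by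
  ext t
  simp only [oscillation, Pi.add_apply, map_add, AP.add_apply]
  ring

theorem oscillation_sub (f g : ℝ → AP (WithLp 2 (V × ℝ))) (e : ℝ) (y : V) :
    oscillation (f - g) e y = oscillation f e y - oscillation g e y := by
  ext t
  simp only [oscillation, Pi.sub_apply, map_sub, AP.sub_apply]
  ring

theorem oscillation_indicator (f : ℝ → AP (WithLp 2 (V × ℝ))) (S : Set ℝ) (e : ℝ) (y : V) :
    oscillation (S.indicator f) e y = S.indicator (oscillation f e y) := by
  ext t
  by_cases ht : t ∈ S
  · simp [oscillation, ht]
  · simp only [oscillation, indicator_of_notMem ht, map_zero]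
    exact sub_self (0 : ℝ)

theorem abs_oscillation_le (f : ℝ → AP (WithLp 2 (V × ℝ))) (e : ℝ) (y : V) (t : ℝ) :
    |oscillation f e y t| ≤ 2 * ‖f t‖ := calc
  |oscillation f e y t| ≤ ‖f t‖ + ‖avgSnd (f t)‖ :=
    (abs_sub _ _).trans (add_le_add ((f t).abs_apply_le _) ((avgSnd (f t)).abs_apply_le _))
  _ ≤ 2 * ‖f t‖ := by linarith [norm_avgSnd_le (f t)]

theorem abs_integral_oscillation_le (hf : IntegrableOn f (Ioo a b)) (e : ℝ) (y : V) :
    |∫ t in Ioo a b, oscillation f e y t| ≤ 2 * ∫ t in Ioo a b, ‖f t‖ := by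
  rw [← integral_const_mul]
  exact norm_integral_le_of_norm_le (f := oscillation f e y) (hf.norm.const_mul 2)
    (ae_of_all _ (abs_oscillation_le f e y))

variable (a b) in
/-- Over `(a, b)`, the oscillating function `t ↦ f(t)(y, t/e)` has asymptotically the same integral
as its mean value in the microscopic time variable, uniformly in `y`. -/
def Averages (f : ℝ → AP (WithLp 2 (V × ℝ))) : Prop :=
  TendstoUniformly (fun e (y : V) => ∫ t in Ioo a b, oscillation f e y t) 0 (𝓝[>] 0)

theorem Averages.congr (hf : Averages a b f) (hfg : f =ᵐ[volume.restrict (Ioo a b)] g) :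
    Averages a b g := by
  have heq : ∀ e (y : V),
      ∫ t in Ioo a b, oscillation g e y t = ∫ t in Ioo a b, oscillation f e y t := fun e y =>
    integral_congr_ae <| hfg.mono fun t ht => by simp only [oscillation, ht]
  rwa [Averages, funext₂ heq]

theorem integrableOn_indicator_const (c : AP (WithLp 2 (V × ℝ))) {S : Set ℝ}
    (hS : MeasurableSet S) : IntegrableOn (S.indicator fun _ => c) (Ioo a b) :=
  Integrable.indicator (integrable_const c) hS

variable [InnerProductSpace ℝ V] [FiniteDimensional ℝ V] [MeasurableSpace V] [BorelSpace V]

theorem integrable_oscillation (hf : IntegrableOn f (Ioo a b)) (e : ℝ) (y : V) :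
    IntegrableOn (oscillation f e y) (Ioo a b) :=
  (integrable_AP_eval hf (φ := fun t => WithLp.toLp 2 (y, e⁻¹ * t))
    (by fun_prop : Continuous _).aestronglyMeasurable).sub
    (integrable_AP_eval (avgSnd.integrable_comp hf) aestronglyMeasurable_const)

theorem integral_oscillation_add (hf : IntegrableOn f (Ioo a b)) (hg : IntegrableOn g (Ioo a b))
    (e : ℝ) (y : V) : ∫ t in Ioo a b, oscillation (f + g) e y t
      = (∫ t in Ioo a b, oscillation f e y t) + ∫ t in Ioo a b, oscillation g e y t := by
  rw [oscillation_add]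
  exact integral_add (integrable_oscillation hf e y) (integrable_oscillation hg e y)

theorem integral_oscillation_sub (hf : IntegrableOn f (Ioo a b)) (hg : IntegrableOn g (Ioo a b))
    (e : ℝ) (y : V) : ∫ t in Ioo a b, oscillation (f - g) e y t
      = (∫ t in Ioo a b, oscillation f e y t) - ∫ t in Ioo a b, oscillation g e y t := by
  rw [oscillation_sub]
  exact integral_sub (integrable_oscillation hf e y) (integrable_oscillation hg e y)

theorem Averages.add (hf : IntegrableOn f (Ioo a b)) (hg : IntegrableOn g (Ioo a b))
    (hf' : Averages a b f) (hg' : Averages a b g) : Averages a b (f + g) := by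
  have h := TendstoUniformly.add hf' hg'
  rw [add_zero] at h
  rwa [Averages, funext₂ (integral_oscillation_add hf hg)]

theorem Averages.sub (hf : IntegrableOn f (Ioo a b)) (hg : IntegrableOn g (Ioo a b))
    (hf' : Averages a b f) (hg' : Averages a b g) : Averages a b (f - g) := by
  have h := TendstoUniformly.sub hf' hg'
  rw [sub_zero] at h
  rwa [Averages, funext₂ (integral_oscillation_sub hf hg)]

theorem Averages.of_forall_exists_integral_norm_sub_lt (hf : IntegrableOn f (Ioo a b))
    (h : ∀ δ > 0, ∃ g, IntegrableOn g (Ioo a b) ∧ Averages a b g ∧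
      ∫ t in Ioo a b, ‖f t - g t‖ < δ) : Averages a b f := by
  refine Metric.tendstoUniformly_iff.2 fun η hη => ?_
  obtain ⟨g, hg, hg', hfg⟩ := h (η / 4) (by positivity)
  filter_upwards [Metric.tendstoUniformly_iff.1 hg' (η / 2) (by positivity)] with e he y
  have hsmall := (abs_integral_oscillation_le (hf.sub hg) e y).trans_lt
    (mul_lt_mul_of_pos_left hfg two_pos)
  have hgy := he y
  rw [integral_oscillation_sub hf hg] at hsmall
  rw [Pi.zero_apply, dist_zero_left, Real.norm_eq_abs, abs_lt] at hgy ⊢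
  rw [abs_lt] at hsmall
  constructor <;> linarith

theorem averages_const (c : AP (WithLp 2 (V × ℝ))) : Averages a b fun _ => c := by
  refine Metric.tendstoUniformly_iff.2 fun η hη => ?_
  rcases le_or_gt b a with hab | hab
  · exact Eventually.of_forall fun e y => by simp [Ioo_eq_empty hab.not_gt, hη]
  have hba : 0 < b - a := sub_pos.2 hab
  have hradius : Tendsto (fun e : ℝ => (b - a) / (2 * e)) (𝓝[>] 0) atTop :=
    (tendsto_inv_nhdsGT_zero.const_mul_atTop (half_pos hba)).congr fun e => by
      rw [div_mul_eq_div_div, div_eq_mul_inv _ e]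
  filter_upwards [hradius.eventually (eventually_dist_integral_slice_avgSnd_le c
    (η := η / (2 * (b - a))) (by positivity)), self_mem_nhdsWithin] with e hmean he y
  have hosc : ∫ t in Ioo a b, oscillation (fun _ => c) e y t
      = (b - a) * ((∫ σ, c (WithLp.toLp 2 (y, σ + (a + b) / (2 * e)))
          ∂(unifBall ℝ ((b - a) / (2 * e)))) - avgSnd c y) := by
    have hconst : IntegrableOn (fun _ => c) (Ioo a b) := integrable_const c
    simp only [oscillation]
    rw [integral_sub (integrable_AP_eval hconst
        (by fun_prop : Continuous _).aestronglyMeasurable) (integrable_const _),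
      integral_Ioo_comp_inv_mul (fun t => c (WithLp.toLp 2 (y, t))) he hab, integral_const,
      measureReal_restrict_apply_univ, Real.volume_real_Ioo_of_le hab.le, smul_eq_mul, mul_sub]
  rw [Pi.zero_apply, dist_zero_left, hosc, norm_mul, Real.norm_of_nonneg hba.le]
  calc (b - a) * ‖_‖ ≤ (b - a) * (η / (2 * (b - a))) :=
        mul_le_mul_of_nonneg_left (hmean y _) hba.le
    _ = η / 2 := by field_simp
    _ < η := half_lt_self hη

theorem averages_indicator_Iio (c : AP (WithLp 2 (V × ℝ))) (s : ℝ) :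
    Averages a b ((Iio s).indicator fun _ => c) := by
  have heq : ∀ e (y : V), ∫ t in Ioo a b, oscillation ((Iio s).indicator fun _ => c) e y t
      = ∫ t in Ioo a (min s b), oscillation (fun _ => c) e y t := fun e y => by
    rw [oscillation_indicator, integral_indicator measurableSet_Iio,
      Measure.restrict_restrict measurableSet_Iio, Iio_inter_Ioo]
  rw [Averages, funext₂ heq]
  exact averages_const c

theorem Averages.indicator_iUnion {c : AP (WithLp 2 (V × ℝ))} {S : ℕ → Set ℝ}
    (hd : Pairwise (Function.onFun Disjoint S)) (hS : ∀ n, MeasurableSet (S n))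
    (h : ∀ n, Averages a b ((S n).indicator fun _ => c)) :
    Averages a b ((⋃ n, S n).indicator fun _ => c) := by
  let f (n : ℕ) : ℝ → AP (WithLp 2 (V × ℝ)) := (accumulate S n).indicator fun _ => c
  let F : ℝ → AP (WithLp 2 (V × ℝ)) := (⋃ n, S n).indicator fun _ => c
  have hmeas : ∀ n, MeasurableSet (accumulate S n) := fun n =>
    MeasurableSet.biUnion (to_countable _) fun i _ => hS i
  have hf : ∀ n, IntegrableOn (f n) (Ioo a b) := fun n => integrableOn_indicator_const c (hmeas n)
  have hF : IntegrableOn F (Ioo a b) := integrableOn_indicator_const c (MeasurableSet.iUnion hS)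
  have havg : ∀ n, Averages a b (f n) := fun n => by
    induction n with
    | zero => simpa only [f, accumulate_zero_nat] using h 0
    | succ n ih =>
      simp only [f, accumulate_succ]
      rw [indicator_union_of_disjoint (disjoint_accumulate hd n.lt_succ_self)]
      exact ih.add (hf n) (integrableOn_indicator_const c (hS _)) (h _)
  have hlim : Tendsto (fun n => ∫ t in Ioo a b, ‖F t - f n t‖) atTop (𝓝 0) := by
    rw [← integral_zero ℝ ℝ (μ := volume.restrict (Ioo a b))]
    refine tendsto_integral_of_dominated_convergence (fun _ => ‖c‖ + ‖c‖)
      (fun n => (hF.sub (hf n)).norm.aestronglyMeasurable) (integrable_const _)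
      (fun n => ae_of_all _ fun t => ?_) (ae_of_all _ fun t => ?_)
    · rw [norm_norm]
      exact norm_sub_le_of_le (norm_indicator_le_norm_self _ _) (norm_indicator_le_norm_self _ _)
    · have ht : Tendsto (fun n => f n t) atTop (𝓝 (F t)) := by
        simp only [F, ← iUnion_accumulate (s := S)]
        exact (monotone_accumulate.tendsto_indicator _ _ t).mono_right (pure_le_nhds _)
      simpa only [sub_self, norm_zero] using (ht.const_sub (F t)).norm
  refine .of_forall_exists_integral_norm_sub_lt hF fun δ hδ => ?_
  obtain ⟨n, hn⟩ := ((tendsto_order.1 hlim).2 δ hδ).exists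
  exact ⟨f n, hf n, havg n, hn⟩

theorem averages_indicator (c : AP (WithLp 2 (V × ℝ))) {S : Set ℝ} (hS : MeasurableSet S) :
    Averages a b (S.indicator fun _ => c) := by
  induction S, hS using MeasurableSpace.induction_on_inter
    ((BorelSpace.measurable_eq (α := ℝ)).trans (borel_eq_generateFrom_Iio ℝ)) isPiSystem_Iio with
  | empty => simpa only [indicator_empty] using averages_const (0 : AP (WithLp 2 (V × ℝ)))
  | basic S hS =>
    obtain ⟨s, rfl⟩ := hS
    exact averages_indicator_Iio c s
  | compl S hS h =>
    rw [indicator_compl]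
    exact (averages_const c).sub (integrable_const c) (integrableOn_indicator_const c hS) h
  | iUnion S hd hS h => exact Averages.indicator_iUnion hd hS h

theorem averages_of_integrableOn (hf : IntegrableOn f (Ioo a b)) : Averages a b f := by
  refine Integrable.induction (Averages a b) (fun c S hS _ => averages_indicator c hS)
    (fun f g _ hf hg hf' hg' => hf'.add hf hg hg') ?_ (fun f g hfg _ h => h.congr hfg) hf
  refine isClosed_of_closure_subset fun f hf => ?_
  refine .of_forall_exists_integral_norm_sub_lt (L1.integrable_coeFn f) fun δ hδ => ?_
  obtain ⟨g, hg, hfg⟩ := Metric.mem_closure_iff.1 hf δ hδ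
  refine ⟨g, L1.integrable_coeFn g, hg, ?_⟩
  rw [L1.dist_eq_integral_dist] at hfg
  simpa only [dist_eq_norm] using hfg

end Oscillation

section Completeness

theorem eLpNorm_tsum_le {α E : Type*} [MeasurableSpace α] {μ : Measure α} [NormedAddCommGroup E]
    {p : ℝ≥0∞} (hp : 1 ≤ p) {v : ℕ → α → E} (hv : ∀ n, AEStronglyMeasurable (v n) μ)
    (hs : ∀ᵐ y ∂μ, Summable fun n => v n y) :
    eLpNorm (fun y => ∑' n, v n y) p μ ≤ ∑' n, eLpNorm (v n) p μ := by
  refine (Lp.eLpNorm_lim_le_liminf_eLpNorm (f := fun m => ∑ n ∈ Finset.range m, v n)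
    (fun m => Finset.aestronglyMeasurable_sum _ fun n _ => hv n) _
    (hs.mono fun y hy => by simpa only [Finset.sum_apply] using hy.hasSum.tendsto_sum_nat)).trans ?_
  exact liminf_le_of_frequently_le' <| Frequently.of_forall fun m =>
    (eLpNorm_sum_le (fun n _ => hv n) hp).trans (ENNReal.sum_le_tsum _)

theorem summable_of_eq_zero_on_ball {V : Type*} [SeminormedAddCommGroup V] {v : ℕ → V → ℝ}
    (hv : ∀ n : ℕ, ∀ y ∈ ball 0 (n : ℝ), v n y = 0) (y : V) : Summable fun n => v n y := by
  obtain ⟨m, hm⟩ := exists_nat_gt ‖y‖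
  refine summable_of_ne_finset_zero (s := Finset.range m) fun n hn => hv n y ?_
  have hmn : (m : ℝ) ≤ n := Nat.cast_le.2 (not_lt.1 fun h => hn (Finset.mem_range.2 h))
  exact mem_ball_zero_iff.2 (hm.trans_le hmn)

variable {V : Type*} [NormedAddCommGroup V] [NormedSpace ℝ V] [FiniteDimensional ℝ V]
  [MeasureSpace V] [BorelSpace V] [(volume : Measure V).IsAddHaarMeasure]
  {p : ℝ≥0∞}

theorem tendsto_volume_ball_atTop [Nontrivial V] :
    Tendsto (fun r : ℝ => volume (ball (0 : V) r)) atTop (𝓝 ∞) := by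
  have hpow : Tendsto (fun r : ℝ => ENNReal.ofReal (r ^ Module.finrank ℝ V)) atTop (𝓝 ∞) :=
    ENNReal.tendsto_ofReal_atTop.comp (tendsto_pow_atTop Module.finrank_pos.ne')
  have hmul := ENNReal.Tendsto.mul_const (b := volume (ball (0 : V) 1)) hpow (Or.inl (by simp))
  rw [ENNReal.top_mul (measure_ball_pos _ _ one_pos).ne'] at hmul
  refine hmul.congr' ?_
  filter_upwards [eventually_gt_atTop 0] with r hr
  rw [Measure.addHaar_ball_of_pos volume (0 : V) hr]

theorem memLp_indicator_ball_of_lt_top {w : V → ℝ} (hw : AEStronglyMeasurable w volume) {r : ℝ}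
    (hr : eLpNorm w p (unifBall V r) < ∞) : MemLp ((ball 0 r).indicator w) p volume := by
  rcases le_or_gt r 0 with hr0 | hr0
  · simpa only [ball_eq_empty.2 hr0, indicator_empty] using MemLp.zero'
  have hball : volume (ball (0 : V) r) ≠ 0 := (measure_ball_pos _ _ hr0).ne'
  have hle : volume.restrict (ball (0 : V) r) ≤ volume (ball (0 : V) r) • unifBall V r := by
    rw [unifBall, smul_smul, ENNReal.mul_inv_cancel hball measure_ball_lt_top.ne, one_smul]
  exact (memLp_indicator_iff_restrict measurableSet_ball).2 <|
    MemLp.of_measure_le_smul measure_ball_lt_top.ne hle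
      ⟨hw.mono_ac (unifBall_absolutelyContinuous r), hr⟩

variable [hp1 : Fact (1 ≤ p)]

theorem besNorm_eq_zero_of_memLp [Nontrivial V] (hp : p ≠ ∞) {f : V → ℝ} (hf : MemLp f p volume) :
    besNorm p f = 0 := by
  have hp0 : 0 < p.toReal := ENNReal.toReal_pos (zero_lt_one.trans_le hp1.out).ne' hp
  have hpos : 0 < (1 / p).toReal := by rw [one_div, ENNReal.toReal_inv]; positivity
  have hlim : Tendsto (fun r : ℝ =>
      (volume (ball (0 : V) r))⁻¹ ^ (1 / p).toReal * eLpNorm f p volume) atTop (𝓝 0) := by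
    have hinv := (continuous_inv.tendsto (∞ : ℝ≥0∞)).comp (tendsto_volume_ball_atTop (V := V))
    rw [ENNReal.inv_top] at hinv
    have hrpow := ((ENNReal.continuous_rpow_const (y := (1 / p).toReal)).tendsto 0).comp hinv
    rw [ENNReal.zero_rpow_of_pos hpos] at hrpow
    have hmul := ENNReal.Tendsto.mul_const (b := eLpNorm f p volume) hrpow (Or.inr hf.2.ne)
    rwa [zero_mul] at hmul
  refine (tendsto_of_tendsto_of_tendsto_of_le_of_le tendsto_const_nhds hlim (fun _ => zero_le)
    fun r => ?_).limsup_eq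
  refine (eLpNorm_smul_measure_of_ne_top hp _ _).trans_le ?_
  rw [smul_eq_mul]
  gcongr
  exact Measure.restrict_le_self

theorem mem_besSubmodule_of_forall_exists {u : V → ℝ} (hu : AEStronglyMeasurable u volume)
    (h : ∀ η : ℝ≥0∞, 0 < η → ∃ v ∈ besSubmodule V p, besNorm p (u - v) < η) :
    u ∈ besSubmodule V p := by
  refine ⟨hu, fun η hη => ?_⟩
  obtain ⟨v, hv, huv⟩ := h (η / 2) (ENNReal.half_pos hη.ne')
  obtain ⟨g, hg⟩ := hv.2 (η / 2) (ENNReal.half_pos hη.ne')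
  refine ⟨g, ?_⟩
  calc besNorm p (u - ⇑g) = besNorm p ((u - v) + (v - ⇑g)) := by rw [sub_add_sub_cancel]
    _ ≤ besNorm p (u - v) + besNorm p (v - ⇑g) :=
      besNorm_add_le hp1.out (hu.sub hv.1) (hv.1.sub g.aestronglyMeasurable)
    _ < η := by
      rw [← ENNReal.add_halves η]
      exact ENNReal.add_lt_add huv hg

theorem exists_besNorm_sub_eq_zero [Nontrivial V] (hp : p ≠ ∞) {w : V → ℝ}
    (hw : AEStronglyMeasurable w volume) {c : ℝ≥0∞} (hc : besNorm p w < c) (R : ℝ) :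
    ∃ v : V → ℝ, AEStronglyMeasurable v volume ∧ besNorm p (w - v) = 0 ∧
      (∀ y ∈ ball 0 R, v y = 0) ∧ ∀ r, eLpNorm v p (unifBall V r) ≤ c := by
  obtain ⟨R₀, hR₀⟩ := eventually_atTop.1 (eventually_lt_of_limsup_lt hc)
  set R' := max R R₀
  refine ⟨(ball 0 R')ᶜ.indicator w, hw.indicator measurableSet_ball.compl, ?_,
    fun y hy => indicator_of_notMem (not_not.2 (ball_subset_ball (le_max_left _ _) hy)) w,
    fun r => ?_⟩
  · rw [sub_eq_of_eq_add (indicator_self_add_compl (ball 0 R') w).symm]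
    exact besNorm_eq_zero_of_memLp hp
      (memLp_indicator_ball_of_lt_top hw ((hR₀ R' (le_max_right _ _)).trans_le le_top))
  · rcases le_or_gt R' r with hr | hr
    · exact (eLpNorm_indicator_le _).trans (hR₀ r ((le_max_right _ _).trans hr)).le
    · have hzero : (ball 0 R')ᶜ.indicator w =ᵐ[unifBall V r] 0 := by
        refine Measure.smul_absolutelyContinuous.ae_le ?_
        filter_upwards [ae_restrict_mem measurableSet_ball] with y hy
        exact indicator_of_notMem (not_not.2 (ball_subset_ball hr.le hy)) w
      rw [eLpNorm_congr_ae hzero, eLpNorm_zero]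
      exact zero_le

theorem besNorm_tsum_sub_sum_range_le {v : ℕ → V → ℝ} (hv : ∀ n, AEStronglyMeasurable (v n) volume)
    (hs : ∀ y, Summable fun n => v n y) {c : ℕ → ℝ≥0∞}
    (hc : ∀ n r, eLpNorm (v n) p (unifBall V r) ≤ c n) (m : ℕ) :
    besNorm p ((fun y => ∑' n, v n y) - ∑ n ∈ Finset.range m, v n) ≤ ∑' n, c (n + m) := by
  have htail : (fun y => ∑' n, v n y) - ∑ n ∈ Finset.range m, v n
      = fun y => ∑' n, v (n + m) y := by
    ext y
    rw [Pi.sub_apply, Finset.sum_apply, ← (hs y).sum_add_tsum_nat_add m, add_sub_cancel_left]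
  rw [htail]
  refine limsup_le_of_le (by isBoundedDefault) (Eventually.of_forall fun r => ?_)
  exact (eLpNorm_tsum_le hp1.out
    (fun n => (hv (n + m)).mono_ac (unifBall_absolutelyContinuous r))
    (ae_of_all _ fun y => (summable_nat_add_iff m).2 (hs y))).trans
      (ENNReal.tsum_le_tsum fun n => hc (n + m) r)

theorem completeSpace_bes_of_subsingleton [Subsingleton V] : CompleteSpace (Bes V p) := by
  have : FiniteDimensional ℝ (BesFun V p) :=
    inferInstanceAs (FiniteDimensional ℝ (besSubmodule V p))
  have : FiniteDimensional ℝ (Bes V p) := inferInstance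
  exact FiniteDimensional.complete ℝ _

/-- The class in `𝓑^p_AP(V)` of a function of `B^p_AP(V)`, as a linear map. -/
noncomputable def besClass : besSubmodule V p →ₗ[ℝ] Bes V p where
  toFun := (SeparationQuotient.mk : BesFun V p → Bes V p)
  map_add' _ _ := rfl
  map_smul' _ _ := rfl

theorem besClass_surjective : Function.Surjective (besClass : besSubmodule V p → Bes V p) :=
  SeparationQuotient.surjective_mk (X := BesFun V p)

theorem norm_besClass (u : besSubmodule V p) : ‖besClass u‖ = (besNorm p u.1).toReal := rfl

theorem exists_besClass_eq_vanishing_on_ball [Nontrivial V] (hp : p ≠ ∞) (u : Bes V p) {c : ℝ}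
    (hc : ‖u‖ < c) (R : ℝ) :
    ∃ v : besSubmodule V p, besClass v = u ∧ (∀ y ∈ ball 0 R, v.1 y = 0) ∧
      ∀ r, eLpNorm v.1 p (unifBall V r) ≤ ENNReal.ofReal c := by
  obtain ⟨w, rfl⟩ := besClass_surjective u
  have hwc : besNorm p w.1 < ENNReal.ofReal c :=
    (ENNReal.lt_ofReal_iff_toReal_lt (besNorm_lt_top w.2).ne).2 hc
  obtain ⟨v, hv, hwv, hvR, hvc⟩ := exists_besNorm_sub_eq_zero hp w.2.1 hwc R
  have hsub : w.1 - v ∈ besSubmodule V p :=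
    mem_besSubmodule_of_forall_exists (w.2.1.sub hv) fun η hη =>
      ⟨0, zero_mem _, by rwa [sub_zero, hwv]⟩
  have hvmem : v ∈ besSubmodule V p := by simpa using sub_mem w.2 hsub
  refine ⟨⟨v, hvmem⟩, (sub_eq_zero.1 ?_).symm, hvR, hvc⟩
  rw [← map_sub, ← norm_eq_zero, norm_besClass]
  exact congrArg ENNReal.toReal hwv

/-- Marcinkiewicz's argument: with representatives vanishing on larger and larger balls, an
absolutely convergent series of classes becomes a locally finite series of functions. -/
theorem completeSpace_bes_of_nontrivial [Nontrivial V] (hp : p ≠ ∞) :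
    CompleteSpace (Bes V p) := by
  refine NormedAddCommGroup.completeSpace_of_summable_imp_tendsto fun u hu => ?_
  set c : ℕ → ℝ := fun n => ‖u n‖ + (1 / 2) ^ n
  have hsum : ∑' n, ENNReal.ofReal (c n) ≠ ∞ := (hu.add summable_geometric_two).tsum_ofReal_ne_top
  choose v hvu hv hvc using fun n : ℕ => exists_besClass_eq_vanishing_on_ball hp (u n) (c := c n)
    (lt_add_of_pos_right _ (by positivity)) n
  have hs := summable_of_eq_zero_on_ball hv
  have hmeas : AEStronglyMeasurable (fun y => ∑' n, (v n).1 y) volume :=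
    aestronglyMeasurable_of_tendsto_ae atTop
      (fun m => Finset.aestronglyMeasurable_sum (Finset.range m) fun n _ => (v n).2.1)
      (ae_of_all _ fun y => by simpa only [Finset.sum_apply] using (hs y).hasSum.tendsto_sum_nat)
  have hlim : Tendsto (fun m => besNorm p
      ((fun y => ∑' n, (v n).1 y) - ∑ n ∈ Finset.range m, (v n).1)) atTop (𝓝 0) :=
    tendsto_of_tendsto_of_tendsto_of_le_of_le tendsto_const_nhds
      (ENNReal.tendsto_sum_nat_add _ hsum) (fun _ => zero_le)
      (besNorm_tsum_sub_sum_range_le (fun n => (v n).2.1) hs hvc)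
  have hmem : (fun y => ∑' n, (v n).1 y) ∈ besSubmodule V p :=
    mem_besSubmodule_of_forall_exists hmeas fun η hη => by
      obtain ⟨m, hm⟩ := (hlim.eventually_lt_const hη).exists
      exact ⟨_, sum_mem fun n _ => (v n).2, hm⟩
  refine ⟨besClass ⟨_, hmem⟩, tendsto_iff_norm_sub_tendsto_zero.2 ?_⟩
  refine ((ENNReal.tendsto_toReal ENNReal.zero_ne_top).comp hlim).congr fun m => ?_
  rw [norm_sub_rev, ← Finset.sum_congr rfl fun n _ => hvu n, ← map_sum, ← map_sub, norm_besClass]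
  simp only [Function.comp_apply, AddSubgroupClass.coe_sub, AddSubmonoidClass.coe_finsetSum]

theorem completeSpace_bes (hp : p ≠ ∞) : CompleteSpace (Bes V p) := by
  rcases subsingleton_or_nontrivial V
  · exact completeSpace_bes_of_subsingleton
  · exact completeSpace_bes_of_nontrivial hp

end Completeness

section GelfandIsometry

variable {V : Type*} [NormedAddCommGroup V] [NormedSpace ℝ V] [FiniteDimensional ℝ V]
  [MeasureSpace V] [BorelSpace V] [(volume : Measure V).IsAddHaarMeasure]
  {p : ℝ≥0∞} [Fact (1 ≤ p)]

theorem neBot_comap_toBes (u : Bes V p) : NeBot (comap (AP.toBes p) (𝓝 u)) :=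
  comap_neBot fun _ ht => AP.denseRange_toBes.mem_nhds ht

section ExtendBes

variable {X : Type*} [MetricSpace X] [CompleteSpace X] [Nonempty X] {T : AP V → X}

theorem isometry_extendBes (hT : ∀ g h, dist (T g) (T h) = dist (g.toBes p) (h.toBes p)) :
    Isometry (extendBes T : Bes V p → X) := by
  refine Isometry.of_dist_eq fun u v => ?_
  have := neBot_comap_toBes u
  have := neBot_comap_toBes v
  have hext := ((tendsto_extendBes hT u).comp tendsto_fst).dist
    ((tendsto_extendBes hT v).comp (tendsto_snd (f := comap (AP.toBes p) (𝓝 u))))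
  have hbes := ((tendsto_comap (f := AP.toBes p) (x := 𝓝 u)).comp tendsto_fst).dist
    ((tendsto_comap (f := AP.toBes p) (x := 𝓝 v)).comp
      (tendsto_snd (f := comap (AP.toBes p) (𝓝 u))))
  exact tendsto_nhds_unique hext (hbes.congr fun q => (hT q.1 q.2).symm)

theorem extendBes_toBes (hT : ∀ g h, dist (T g) (T h) = dist (g.toBes p) (h.toBes p)) (g : AP V) :
    extendBes T (g.toBes p) = T g := by
  have := neBot_comap_toBes (g.toBes p)
  refine tendsto_nhds_unique (tendsto_extendBes hT (g.toBes p)) (tendsto_iff_dist_tendsto_zero.2 ?_)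
  simp only [hT]
  exact tendsto_iff_dist_tendsto_zero.1 tendsto_comap

end ExtendBes

theorem norm_extendBes {X : Type*} [NormedAddCommGroup X] [CompleteSpace X] {T : AP V → X}
    (hT : ∀ g h, dist (T g) (T h) = dist (g.toBes p) (h.toBes p)) (hT0 : T 0 = 0) (u : Bes V p) :
    ‖extendBes T u‖ = ‖u‖ := by
  have hzero : extendBes T (0 : Bes V p) = 0 := (extendBes_toBes hT 0).trans hT0
  rw [← dist_zero_right, ← dist_zero_right, ← hzero, (isometry_extendBes hT).dist_eq]

theorem isometry_hat (hp : p ≠ ∞) : Isometry (hat : Bes V p → Lp ℝ p (bohrMeasure V)) :=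
  isometry_extendBes (dist_gelfandLp hp)

theorem gelfandLp_zero : gelfandLp p (0 : AP V) = 0 := by
  rw [gelfandLp, ← MemLp.toLp_zero MemLp.zero']
  exact MemLp.toLp_congr _ _ (ae_of_all _ fun s => map_zero s)

theorem norm_hat (hp : p ≠ ∞) (u : Bes V p) : ‖hat u‖ = ‖u‖ :=
  norm_extendBes (dist_gelfandLp hp) gelfandLp_zero u

theorem hat_toBes (hp : p ≠ ∞) (g : AP V) : hat (g.toBes p) = gelfandLp p g :=
  extendBes_toBes (dist_gelfandLp hp) g

theorem denseRange_gelfandLp (hp : p ≠ ∞) :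
    DenseRange (gelfandLp p : AP V → Lp ℝ p (bohrMeasure V)) := by
  have : (bohrMeasure V).Regular := RealRMK.regular_rieszMeasure _
  refine (ContinuousMap.toLp_denseRange ℝ (bohrMeasure V) ℝ hp).mono ?_
  rintro _ ⟨φ, rfl⟩
  refine ⟨gelfand.symm φ, Lp.ext ((memLp_gelfand _).coeFn_toLp.trans ?_)⟩
  rw [AlgEquiv.apply_symm_apply]
  exact (ContinuousMap.coeFn_toLp _ φ).symm

theorem hat_surjective (hp : p ≠ ∞) :
    Function.Surjective (hat : Bes V p → Lp ℝ p (bohrMeasure V)) := by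
  have := completeSpace_bes (V := V) hp
  have hdense : DenseRange (hat : Bes V p → Lp ℝ p (bohrMeasure V)) :=
    (denseRange_gelfandLp hp).mono (range_subset_iff.2 fun g => ⟨g.toBes p, hat_toBes hp g⟩)
  rw [← range_eq_univ, ← hdense.closure_range]
  exact (isometry_hat hp).isClosedEmbedding.isClosed_range.closure_eq.symm

theorem exists_memLp_hat_eq (hp : p ≠ ∞) {α : Type*} [MeasurableSpace α] {m : Measure α} {q : ℝ≥0∞}
    {F : α → Lp ℝ p (bohrMeasure V)} (hF : MemLp F q m) :
    ∃ w : α → Bes V p, MemLp w q m ∧ ∀ x, hat (w x) = F x := by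
  obtain ⟨inv, hinv⟩ := (hat_surjective (V := V) hp).hasRightInverse
  have hiso : Isometry inv := Isometry.of_dist_eq fun a b => by
    rw [← (isometry_hat hp).dist_eq, hinv, hinv]
  refine ⟨inv ∘ F, hF.of_le (hiso.continuous.comp_aestronglyMeasurable hF.1) ?_, fun x => hinv _⟩
  exact ae_of_all _ fun x => by rw [Function.comp_apply, ← norm_hat hp, hinv]

end GelfandIsometry

section PartialIntegral

variable {X Y : Type*} [MeasurableSpace X] [MeasurableSpace Y] {μ : Measure X} {ν : Measure Y}
  [IsProbabilityMeasure μ] [IsProbabilityMeasure ν] {p : ℝ≥0∞} [hp1 : Fact (1 ≤ p)]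

theorem coeFn_partialIntegral (f : Lp ℝ p (μ.prod ν)) :
    partialIntegral f =ᵐ[μ] fun x => ∫ y, f (x, y) ∂ν :=
  (memLp_partialIntegral hp1.out (Lp.memLp f)).coeFn_toLp

theorem partialIntegral_sub (f g : Lp ℝ p (μ.prod ν)) :
    partialIntegral (f - g) = partialIntegral f - partialIntegral g := by
  refine Lp.ext ?_
  filter_upwards [coeFn_partialIntegral (f - g), coeFn_partialIntegral f, coeFn_partialIntegral g,
    Lp.coeFn_sub (partialIntegral f) (partialIntegral g),
    Measure.ae_ae_of_ae_prod (Lp.coeFn_sub f g), ae_integrable_prodMk hp1.out (Lp.memLp f),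
    ae_integrable_prodMk hp1.out (Lp.memLp g)] with x hfg hf hg hsub hslice hfi hgi
  rw [hfg, hsub, Pi.sub_apply, hf, hg, ← integral_sub hfi hgi]
  exact integral_congr_ae hslice

theorem norm_partialIntegral_le (f : Lp ℝ p (μ.prod ν)) : ‖partialIntegral f‖ ≤ ‖f‖ := by
  refine ENNReal.toReal_mono (Lp.eLpNorm_ne_top f) ?_
  have hf := (Lp.memLp f).1
  refine le_trans (eLpNorm_mono_enorm_ae (g := fun x => eLpNorm (fun y => f (x, y)) p ν) ?_)
    (eLpNorm_eLpNorm_prodMk_le hf)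
  filter_upwards [coeFn_partialIntegral f, hf.prodMk_left] with x hx hslice
  rw [hx, enorm_eq_self]
  exact (enorm_integral_le_lintegral_enorm _).trans <| eLpNorm_one_eq_lintegral_enorm.symm.le.trans
    (eLpNorm_le_eLpNorm_of_exponent_le hp1.out hslice)

theorem continuous_partialIntegral :
    Continuous (partialIntegral : Lp ℝ p (μ.prod ν) → Lp ℝ p μ) :=
  (LipschitzWith.mk_one fun f g => by
    rw [dist_eq_norm, dist_eq_norm, ← partialIntegral_sub]
    exact norm_partialIntegral_le _).continuous

end PartialIntegral

section GelfandPairing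

variable {V : Type*} [NormedAddCommGroup V] [NormedSpace ℝ V] [FiniteDimensional ℝ V]
  [MeasureSpace V] [BorelSpace V] [(volume : Measure V).IsAddHaarMeasure]
  {p q : ℝ≥0∞} [Fact (1 ≤ p)] [Fact (1 ≤ q)]

variable (V q) in
/-- The map `g ↦ ĝ` from `AP(V)` to `L^q(K)` as a continuous linear map. -/
noncomputable def gelfandLpCLM : AP V →L[ℝ] Lp ℝ q (bohrMeasure V) :=
  ContinuousMap.toLp q (bohrMeasure V) ℝ ∘L
    gelfand.toLinearMap.mkContinuous 1 fun g => by
      rw [one_mul]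
      exact (ContinuousMap.norm_le _ (norm_nonneg g)).2 fun s => abs_character_le s g

theorem coeFn_gelfandLpCLM (g : AP V) : gelfandLpCLM V q g =ᵐ[bohrMeasure V] gelfand g :=
  ContinuousMap.coeFn_toLp _ _

variable [ENNReal.HolderConjugate p q]

variable (V p q) in
/-- The pairing `(F, g) ↦ ∫ F ĝ` of `L^p(K)` and `AP(V)`. -/
noncomputable def gelfandPairing : Lp ℝ p (bohrMeasure V) →L[ℝ] AP V →L[ℝ] ℝ :=
  ((ContinuousLinearMap.mul ℝ ℝ).lpPairing (bohrMeasure V) p q).bilinearComp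
    (ContinuousLinearMap.id ℝ _) (gelfandLpCLM V q)

theorem gelfandPairing_apply (F : Lp ℝ p (bohrMeasure V)) (g : AP V) :
    gelfandPairing V p q F g = ∫ s, F s * s g ∂(bohrMeasure V) := by
  refine (ContinuousLinearMap.lpPairing_eq_integral _ _ _).trans (integral_congr_ae ?_)
  filter_upwards [coeFn_gelfandLpCLM (q := q) g] with s hs
  exact congrArg (F s * ·) (hs.trans (gelfand_apply g s))

end GelfandPairing

section ConstInSecond

variable {V W : Type*} [NormedAddCommGroup V] [InnerProductSpace ℝ V] [FiniteDimensional ℝ V]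
  [MeasurableSpace V] [BorelSpace V] [NormedAddCommGroup W] [InnerProductSpace ℝ W]
  [FiniteDimensional ℝ W] [MeasurableSpace W] [BorelSpace W] {p q : ℝ≥0∞}

theorem gelfandProdLp_zero : gelfandProdLp p (0 : AP (WithLp 2 (V × W))) = 0 := by
  rw [gelfandProdLp, ← MemLp.toLp_zero MemLp.zero']
  exact MemLp.toLp_congr _ _ (ae_of_all _ fun k => map_zero (prodCharacter k.1 k.2))

variable [Fact (1 ≤ p)]

theorem isometry_hatProd (hp : p ≠ ∞) : Isometry
    (hatProd : Bes (WithLp 2 (V × W)) p → Lp ℝ p ((bohrMeasure V).prod (bohrMeasure W))) :=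
  isometry_extendBes (dist_gelfandProdLp hp)

theorem hatProd_toBes (hp : p ≠ ∞) (g : AP (WithLp 2 (V × W))) :
    hatProd (g.toBes p) = gelfandProdLp p g :=
  extendBes_toBes (dist_gelfandProdLp hp) g

theorem norm_hatProd (hp : p ≠ ∞) (u : Bes (WithLp 2 (V × W)) p) : ‖hatProd u‖ = ‖u‖ :=
  norm_extendBes (dist_gelfandProdLp hp) gelfandProdLp_zero u

theorem continuous_constInSecond :
    Continuous (constInSecond : Bes V p → Bes (WithLp 2 (V × W)) p) :=
  SeparationQuotient.continuous_lift
    (SeparationQuotient.continuous_mk.comp BesFun.continuous_compFst)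

theorem constInSecond_toBes (g : AP V) :
    (constInSecond (g.toBes p) : Bes (WithLp 2 (V × W)) p) = g.compFst.toBes p := rfl

theorem norm_constInSecond_le (u : Bes V p) :
    ‖(constInSecond u : Bes (WithLp 2 (V × W)) p)‖
      ≤ ((ballRatio V W) ^ (1 / p).toReal).toReal * ‖u‖ := by
  obtain ⟨u, rfl⟩ := SeparationQuotient.surjective_mk u
  have hC : (ballRatio V W) ^ (1 / p).toReal ≠ ∞ :=
    ENNReal.rpow_ne_top_of_nonneg ENNReal.toReal_nonneg ballRatio_ne_top
  have hnorm := ENNReal.toReal_mono (ENNReal.mul_ne_top hC (besNorm_lt_top u.2).ne)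
    (besNorm_comp_fst_le (W := W) (p := p) u.2.1)
  rwa [ENNReal.toReal_mul] at hnorm

variable [Fact (1 ≤ q)] [ENNReal.HolderConjugate p q]

theorem integral_mul_gelfandProd (F : Lp ℝ p ((bohrMeasure V).prod (bohrMeasure W)))
    (c : AP (WithLp 2 (V × W))) :
    ∫ k, F k * gelfandProd c k ∂((bohrMeasure V).prod (bohrMeasure W))
      = (ContinuousLinearMap.mul ℝ ℝ).lpPairing _ p q F (gelfandProdLp q c) := by
  rw [ContinuousLinearMap.lpPairing_eq_integral]
  refine integral_congr_ae ?_
  filter_upwards [(memLp_continuousMap_prod (gelfandProd c) q _).coeFn_toLp] with k hk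
  rw [gelfandProdLp, hk, ContinuousLinearMap.mul_apply']

theorem integral_gelfandProd_mul_compFst (g : AP V) (c : AP (WithLp 2 (V × W))) :
    ∫ k, gelfandProd g.compFst k * gelfandProd c k ∂((bohrMeasure V).prod (bohrMeasure W))
      = ∫ s, s g * s (avgSnd c) ∂(bohrMeasure V) := by
  have hint := (memLp_continuousMap_prod (gelfandProd (g.compFst : AP (WithLp 2 (V × W)))
    * gelfandProd c) 1 ((bohrMeasure V).prod (bohrMeasure W))).integrable le_rfl
  refine (integral_prod _ hint).trans ?_
  simp only [ContinuousMap.mul_apply, gelfandProd_compFst, integral_const_mul, character_avgSnd]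

theorem integral_hatProd_constInSecond (hp : p ≠ ∞) (w : Bes V p) (c : AP (WithLp 2 (V × W))) :
    ∫ k, hatProd (constInSecond w) k * gelfandProd c k ∂((bohrMeasure V).prod (bohrMeasure W))
      = gelfandPairing V p q (hat w) (avgSnd c) := by
  induction w using AP.denseRange_toBes.induction_on with
  | hp =>
    simp only [integral_mul_gelfandProd (q := q)]
    exact isClosed_eq
      ((((ContinuousLinearMap.mul ℝ ℝ).lpPairing _ p q).flip (gelfandProdLp q c)).continuous.comp
        ((isometry_hatProd hp).continuous.comp continuous_constInSecond))
      (((gelfandPairing V p q).flip (avgSnd c)).continuous.comp (isometry_hat hp).continuous)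
  | ih g =>
    have hleft : hatProd (constInSecond (g.toBes p)) =ᵐ[(bohrMeasure V).prod (bohrMeasure W)]
        gelfandProd (g.compFst : AP (WithLp 2 (V × W))) := by
      rw [constInSecond_toBes, hatProd_toBes hp]
      exact (memLp_continuousMap_prod _ _ _).coeFn_toLp
    have hright : hat (g.toBes p) =ᵐ[bohrMeasure V] gelfand g := by
      rw [hat_toBes hp]
      exact (memLp_gelfand g).coeFn_toLp
    rw [gelfandPairing_apply]
    exact (integral_congr_ae (hleft.mul .rfl)).trans <|
      (integral_gelfandProd_mul_compFst g c).trans (integral_congr_ae (hright.mul .rfl)).symm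

theorem integral_mul_gelfandProd_compFst
    (F : Lp ℝ p ((bohrMeasure V).prod (bohrMeasure W))) (g : AP V) :
    ∫ k, F k * gelfandProd (g.compFst : AP (WithLp 2 (V × W))) k
        ∂((bohrMeasure V).prod (bohrMeasure W))
      = gelfandPairing V p q (partialIntegral F) g := by
  rw [gelfandPairing_apply]
  refine (integral_prod _ (integrable_bilin (q := q) (ContinuousLinearMap.mul ℝ ℝ) (Lp.memLp F)
    (memLp_continuousMap_prod _ q _))).trans ?_
  refine integral_congr_ae ?_
  filter_upwards [coeFn_partialIntegral F] with s hs
  simp only [ContinuousLinearMap.mul_apply', gelfandProd_compFst, integral_mul_const, hs]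

end ConstInSecond

section MicroTrace

variable {V : Type*} [NormedAddCommGroup V] {T : ℝ} {q : ℝ≥0∞}
  {f : V × ℝ → AP (WithLp 2 (V × ℝ))}

/-- The function `(x, τ, y) ↦ ∫_τ^T M(f(x, t, y, ·)) dt`, where `M` is the mean value in the
microscopic time variable. -/
noncomputable def backwardMean (T : ℝ) (f : V × ℝ → AP (WithLp 2 (V × ℝ))) (z : V × ℝ) : AP V :=
  ∫ t in z.2..T, avgSnd (f (z.1, t))

variable [MeasurableSpace V] {μ : Measure V} [SFinite μ]

theorem memLp_backwardMean (hq : 1 ≤ q) (hf : MemLp f q (μ.prod (volume.restrict (Ioo 0 T)))) :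
    MemLp (fun z => ((backwardMean T f z).compFst : AP (WithLp 2 (V × ℝ)))) q
      (μ.prod (volume.restrict (Ioo 0 T))) :=
  compFstCLM.comp_memLp' (memLp_intervalIntegral_last hq (avgSnd.comp_memLp' hf))

variable [InnerProductSpace ℝ V]

/-- The trace `(x, t) ↦ f(x, t, x / e, t / e)` at the scale `e` of a function with values in the
almost periodic functions. -/
noncomputable def microTrace (f : V × ℝ → AP (WithLp 2 (V × ℝ))) (e : ℝ) (z : V × ℝ) : ℝ :=
  f z (WithLp.toLp 2 (e⁻¹ • z.1, e⁻¹ * z.2))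

variable [FiniteDimensional ℝ V] [BorelSpace V]

theorem memLp_microTrace {m : Measure (V × ℝ)} (hf : MemLp f q m) (e : ℝ) :
    MemLp (microTrace f e) q m := by
  refine hf.of_le (AP.continuous_eval.comp_aestronglyMeasurable (hf.1.prodMk ?_))
    (ae_of_all _ fun z => (f z).abs_apply_le _)
  exact (by fun_prop : Continuous fun z : V × ℝ =>
    WithLp.toLp 2 (e⁻¹ • z.1, e⁻¹ * z.2)).aestronglyMeasurable

/-- The difference between the integrals over `(τ, T)` of the trace `t ↦ f(x, t, x / e, t / e)` and
of its mean value in the microscopic time variable, at `z = (x, τ)`. -/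
noncomputable def backwardDefect (T : ℝ) (f : V × ℝ → AP (WithLp 2 (V × ℝ))) (e : ℝ)
    (z : V × ℝ) : ℝ :=
  (∫ t in z.2..T, microTrace f e (z.1, t))
    - microTrace (fun z => (backwardMean T f z).compFst) e z

theorem microTrace_compFst_backwardMean {z : V × ℝ}
    (hf : IntegrableOn (fun t => f (z.1, t)) (Ioo z.2 T)) (hz : z.2 ≤ T) (e : ℝ) :
    microTrace (fun z => (backwardMean T f z).compFst) e z
      = ∫ t in Ioo z.2 T, avgSnd (f (z.1, t)) (e⁻¹ • z.1) := by
  rw [microTrace, AP.compFst_apply, backwardMean, intervalIntegral.integral_of_le hz,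
    integral_Ioc_eq_integral_Ioo]
  exact ((evalCLM (e⁻¹ • z.1)).integral_comp_comm (avgSnd.integrable_comp hf)).symm

theorem backwardDefect_eq_integral_oscillation {z : V × ℝ}
    (hf : IntegrableOn (fun t => f (z.1, t)) (Ioo z.2 T)) (hz : z.2 ≤ T) (e : ℝ) :
    backwardDefect T f e z
      = ∫ t in Ioo z.2 T, oscillation (fun t => f (z.1, t)) e (e⁻¹ • z.1) t := by
  rw [backwardDefect, microTrace_compFst_backwardMean hf hz, intervalIntegral.integral_of_le hz,
    integral_Ioc_eq_integral_Ioo]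
  exact (integral_sub (integrable_AP_eval hf (by fun_prop : Continuous fun t : ℝ =>
      WithLp.toLp 2 (e⁻¹ • z.1, e⁻¹ * t)).aestronglyMeasurable)
    (integrable_AP_eval (avgSnd.integrable_comp hf) aestronglyMeasurable_const)).symm

theorem memLp_backwardDefect (hq : 1 ≤ q) (hf : MemLp f q (μ.prod (volume.restrict (Ioo 0 T))))
    (e : ℝ) : MemLp (backwardDefect T f e) q (μ.prod (volume.restrict (Ioo 0 T))) :=
  (memLp_intervalIntegral_last hq (memLp_microTrace hf e)).sub
    (memLp_microTrace (memLp_backwardMean hq hf) e)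

theorem abs_backwardDefect_le (hq : 1 ≤ q) (hf : MemLp f q (μ.prod (volume.restrict (Ioo 0 T))))
    (e : ℝ) : ∀ᵐ z ∂(μ.prod (volume.restrict (Ioo 0 T))),
      |backwardDefect T f e z| ≤ 2 * ∫ t in Ioo 0 T, ‖f (z.1, t)‖ := by
  filter_upwards [ae_integrable_prodMk_fst hq hf, ae_snd_mem_Ioo] with z hslice hz
  have hsub : Ioo z.2 T ⊆ Ioo 0 T := Ioo_subset_Ioo_left hz.1.le
  rw [backwardDefect_eq_integral_oscillation (IntegrableOn.mono_set hslice hsub) hz.2.le]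
  refine (abs_integral_oscillation_le (IntegrableOn.mono_set hslice hsub) _ _).trans ?_
  gcongr ?_ * ?_
  exact setIntegral_mono_set hslice.norm (ae_of_all _ fun t => norm_nonneg _) hsub.eventuallyLE

theorem tendsto_backwardDefect (hq : 1 ≤ q)
    (hf : MemLp f q (μ.prod (volume.restrict (Ioo 0 T)))) :
    ∀ᵐ z ∂(μ.prod (volume.restrict (Ioo 0 T))),
      Tendsto (fun e => backwardDefect T f e z) (𝓝[>] 0) (𝓝 0) := by
  filter_upwards [ae_integrable_prodMk_fst hq hf, ae_snd_mem_Ioo] with z hslice hz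
  have hslice' := IntegrableOn.mono_set hslice (Ioo_subset_Ioo_left (b := T) hz.1.le)
  simp only [backwardDefect_eq_integral_oscillation hslice' hz.2.le]
  refine Metric.tendsto_nhds.2 fun η hη => ?_
  filter_upwards [Metric.tendstoUniformly_iff.1 (averages_of_integrableOn hslice') η hη] with e he
  rw [dist_comm]
  exact he (e⁻¹ • z.1)

theorem tendsto_integral_mul_backwardDefect {p : ℝ≥0∞} [ENNReal.HolderConjugate p q]
    (hf : MemLp f q (μ.prod (volume.restrict (Ioo 0 T)))) {u : ℕ → V × ℝ → ℝ}
    (hu : ∀ n, MemLp (u n) p (μ.prod (volume.restrict (Ioo 0 T))))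
    (hc : ∀ φ : V × ℝ → ℝ, MemLp φ q (μ.prod (volume.restrict (Ioo 0 T))) →
      CauchySeq fun n => ∫ z, u n z * φ z ∂(μ.prod (volume.restrict (Ioo 0 T))))
    {e : ℕ → ℝ} (he : Tendsto e atTop (𝓝[>] 0)) :
    Tendsto (fun n => ∫ z, u n z * backwardDefect T f (e n) z
      ∂(μ.prod (volume.restrict (Ioo 0 T)))) atTop (𝓝 0) := by
  have hq : 1 ≤ q := ENNReal.HolderTriple.le q p 1
  refine tendsto_integral_mul_of_abs_le hu hc
    (((memLp_integral_norm_prodMk hq hf).const_mul 2).comp_fst _)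
    (fun n => (memLp_backwardDefect hq hf (e n)).1) (fun n => abs_backwardDefect_le hq hf (e n)) ?_
  filter_upwards [tendsto_backwardDefect hq hf] with z hz using hz.comp he

end MicroTrace

section TimePrimitive

variable {p q : ℝ≥0∞}

section Limit

variable {V : Type*} [NormedAddCommGroup V] [InnerProductSpace ℝ V] [FiniteDimensional ℝ V]
  [MeasurableSpace V] [BorelSpace V] {T : ℝ} [Fact (1 ≤ p)]

theorem memLp_partialIntegral_hatProd {W α : Type*} [NormedAddCommGroup W] [InnerProductSpace ℝ W]
    [FiniteDimensional ℝ W] [MeasurableSpace W] [BorelSpace W] [MeasurableSpace α] {m : Measure α}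
    (hp : p ≠ ∞) {v : α → Bes (WithLp 2 (V × W)) p} (hv : MemLp v q m) :
    MemLp (fun z => partialIntegral (hatProd (v z))) q m :=
  hv.of_le ((continuous_partialIntegral.comp (isometry_hatProd hp).continuous)
    |>.comp_aestronglyMeasurable hv.1)
    (ae_of_all _ fun _ => (norm_partialIntegral_le _).trans_eq (norm_hatProd hp _))

theorem memLp_constInSecond {W α : Type*} [NormedAddCommGroup W] [InnerProductSpace ℝ W]
    [FiniteDimensional ℝ W] [MeasurableSpace W] [BorelSpace W] [MeasurableSpace α] {m : Measure α}
    {w : α → Bes V p} (hw : MemLp w q m) :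
    MemLp (fun z => (constInSecond (w z) : Bes (WithLp 2 (V × W)) p)) q m :=
  hw.of_le_mul (continuous_constInSecond.comp_aestronglyMeasurable hw.1)
    (ae_of_all _ fun z => norm_constInSecond_le (w z))

theorem integral_hatProd_constInSecond_primitive [ENNReal.HolderConjugate p q] (hp : p ≠ ∞)
    {μ : Measure V} [SFinite μ] {f : V × ℝ → AP (WithLp 2 (V × ℝ))}
    (hf : MemLp f q (μ.prod (volume.restrict (Ioo 0 T))))
    {v₀ : V × ℝ → Bes (WithLp 2 (V × ℝ)) p}
    (hv₀ : MemLp v₀ p (μ.prod (volume.restrict (Ioo 0 T)))) {w₀ : V × ℝ → Bes V p}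
    (hw : ∀ z, hat (w₀ z) = ∫ τ in (0 : ℝ)..z.2, partialIntegral (hatProd (v₀ (z.1, τ)))) :
    ∫ z, ∫ k, hatProd (constInSecond (w₀ z)) k * gelfandProd (f z) k
        ∂((bohrMeasure V).prod (bohrMeasure ℝ)) ∂(μ.prod (volume.restrict (Ioo 0 T)))
      = ∫ z, ∫ k, hatProd (v₀ z) k * gelfandProd (backwardMean T f z).compFst k
        ∂((bohrMeasure V).prod (bohrMeasure ℝ)) ∂(μ.prod (volume.restrict (Ioo 0 T))) := by
  have : Fact (1 ≤ q) := ⟨ENNReal.HolderTriple.le q p 1⟩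
  simp only [integral_mul_gelfandProd_compFst (q := q),
    integral_hatProd_constInSecond (q := q) hp, hw]
  exact integral_bilin_intervalIntegral (f := fun z => partialIntegral (hatProd (v₀ z)))
    (g := fun z => avgSnd (f z)) (gelfandPairing V p q) (memLp_partialIntegral_hatProd hp hv₀)
    (avgSnd.comp_memLp' hf)

end Limit

variable {N : ℕ} {Ω : Set (Space N)} {T : ℝ}

theorem restrict_cyl : (volume : Measure (Space N × ℝ)).restrict (cyl Ω T)
    = (volume.restrict Ω).prod (volume.restrict (Ioo 0 T)) :=
  (Measure.prod_restrict _ _).symm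

theorem integral_timePrimitive_mul_microTrace [ENNReal.HolderConjugate p q] {u : Space N × ℝ → ℝ}
    (hu : MemLp u p (volume.restrict (cyl Ω T))) {f : Space N × ℝ → AP (MicroSpaceTime N)}
    (hf : MemLp f q (volume.restrict (cyl Ω T))) (e : ℝ) :
    ∫ z in cyl Ω T, timePrimitive u z * microTrace f e z
      = (∫ z in cyl Ω T, u z * backwardDefect T f e z)
        + ∫ z in cyl Ω T, u z * microTrace (fun z => (backwardMean T f z).compFst) e z := by
  have hq : 1 ≤ q := ENNReal.HolderTriple.le q p 1
  rw [restrict_cyl] at hu hf ⊢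
  refine Eq.trans ?_ (integral_add (hu.integrable_mul (memLp_backwardDefect hq hf e))
    (hu.integrable_mul (memLp_microTrace (memLp_backwardMean hq hf) e)))
  refine (integral_bilin_intervalIntegral (ContinuousLinearMap.mul ℝ ℝ) hu
    (memLp_microTrace hf e)).trans (integral_congr_ae (ae_of_all _ fun z => ?_))
  simp only [ContinuousLinearMap.mul_apply', backwardDefect, ← mul_add, sub_add_cancel]

variable [hp1 : Fact (1 ≤ p)]

theorem memLp_timePrimitive {u : Space N × ℝ → ℝ} (hu : MemLp u p (volume.restrict (cyl Ω T))) :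
    MemLp (timePrimitive u) p (volume.restrict (cyl Ω T)) := by
  rw [restrict_cyl] at hu ⊢
  exact memLp_intervalIntegral_zero hp1.out hu

namespace WeakSigmaConverges

variable {ι : Type*} {l : Filter ι} {ε : ι → ℝ} {v : ι → Space N × ℝ → ℝ}
  {v₀ : Space N × ℝ → Bes (MicroSpaceTime N) p}

theorem exists_tendsto_integral_mul {Q : Set (Space N × ℝ)}
    (hv : WeakSigmaConverges l ε Q p v v₀) (hpq : p⁻¹ + q⁻¹ = 1) {φ : Space N × ℝ → ℝ}
    (hφ : MemLp φ q (volume.restrict Q)) :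
    ∃ a, Tendsto (fun i => ∫ z in Q, v i z * φ z) l (𝓝 a) := by
  refine ⟨_, (hv.tendsto q hpq (fun z => φ z • (1 : AP (MicroSpaceTime N))) ?_).congr fun i => ?_⟩
  · exact hφ.of_le (hφ.1.smul_const _) (ae_of_all _ fun z => by rw [norm_smul, norm_one, mul_one])
  · simp only [AP.smul_apply, AP.one_apply, mul_one]

theorem tendsto_integral_mul_backwardDefect [l.IsCountablyGenerated] (hε : Tendsto ε l (𝓝[>] 0))
    (hv : WeakSigmaConverges l ε (cyl Ω T) p v v₀) (hpq : p⁻¹ + q⁻¹ = 1)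
    {f : Space N × ℝ → AP (MicroSpaceTime N)} (hf : MemLp f q (volume.restrict (cyl Ω T))) :
    Tendsto (fun i => ∫ z in cyl Ω T, v i z * backwardDefect T f (ε i) z) l (𝓝 0) := by
  have : ENNReal.HolderConjugate p q := ENNReal.holderConjugate_iff.2 hpq
  refine tendsto_of_seq_tendsto fun x hx => ?_
  have hcauchy : ∀ φ : Space N × ℝ → ℝ, MemLp φ q (volume.restrict (cyl Ω T)) →
      CauchySeq fun n => ∫ z in cyl Ω T, v (x n) z * φ z := fun φ hφ => by
    obtain ⟨a, ha⟩ := hv.exists_tendsto_integral_mul hpq hφ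
    exact (ha.comp hx).cauchySeq
  have hmem := fun n => hv.memLp (x n)
  rw [restrict_cyl] at *
  exact APSigma.tendsto_integral_mul_backwardDefect hf hmem hcauchy (hε.comp hx)

theorem timePrimitive [l.IsCountablyGenerated] (hp : p ≠ ∞) (hε : Tendsto ε l (𝓝[>] 0))
    (hv : WeakSigmaConverges l ε (cyl Ω T) p v v₀) {w₀ : Space N × ℝ → Bes (Space N) p}
    (hw₀ : MemLp w₀ p (volume.restrict (cyl Ω T)))
    (hw : ∀ z, hat (w₀ z) = ∫ τ in (0 : ℝ)..z.2, partialIntegral (hatProd (v₀ (z.1, τ)))) :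
    WeakSigmaConverges l ε (cyl Ω T) p (fun i => timePrimitive (v i))
      (fun z => constInSecond (w₀ z)) := by
  refine ⟨fun i => memLp_timePrimitive (hv.memLp i), memLp_constInSecond hw₀, fun q hpq f hf => ?_⟩
  have : ENNReal.HolderConjugate p q := ENNReal.holderConjugate_iff.2 hpq
  have hg : MemLp (fun z => ((backwardMean T f z).compFst : AP (MicroSpaceTime N))) q
      (volume.restrict (cyl Ω T)) := by
    rw [restrict_cyl] at hf ⊢
    exact memLp_backwardMean (ENNReal.HolderTriple.le q p 1) hf
  have hsum := (hv.tendsto_integral_mul_backwardDefect hε hpq hf).add (hv.tendsto q hpq _ hg)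
  have hlimit := integral_hatProd_constInSecond_primitive hp (restrict_cyl ▸ hf)
    (restrict_cyl ▸ hv.memLp_limit) hw
  rw [zero_add, restrict_cyl, ← hlimit, ← restrict_cyl] at hsum
  exact hsum.congr fun i => (integral_timePrimitive_mul_microTrace (hv.memLp i) hf (ε i)).symm

end WeakSigmaConverges

end TimePrimitive

end APSigma

theorem corollary4p2_general {N : ℕ} {Ω : Set (Space N)} {T : ℝ}
    {p : ℝ≥0∞} [Fact (1 ≤ p)] (hp : p ≠ ∞)
    {ι : Type*} {l : Filter ι} [l.IsCountablyGenerated] {ε : ι → ℝ} (hε : Tendsto ε l (𝓝[>] 0))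
    {v : ι → Space N × ℝ → ℝ} {v₀ : Space N × ℝ → Bes (MicroSpaceTime N) p}
    (hv : WeakSigmaConverges l ε (cyl Ω T) p v v₀) :
    ∃ w₀ : Space N × ℝ → Bes (Space N) p,
      MemLp w₀ p (volume.restrict (cyl Ω T)) ∧
      (∀ᵐ z ∂(volume.restrict (cyl Ω T)),
        IntervalIntegrable (fun τ => partialIntegral (hatProd (v₀ (z.1, τ)))) volume 0 z.2 ∧
        hat (w₀ z) = ∫ τ in (0 : ℝ)..z.2, partialIntegral (hatProd (v₀ (z.1, τ)))) ∧
      WeakSigmaConverges l ε (cyl Ω T) p (fun i => timePrimitive (v i))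
        (fun z => constInSecond (w₀ z)) := by
  have hp1 : 1 ≤ p := Fact.out
  have hmean := memLp_partialIntegral_hatProd hp hv.memLp_limit
  rw [restrict_cyl] at hmean
  obtain ⟨w₀, hw₀, hw⟩ := exists_memLp_hat_eq hp (memLp_intervalIntegral_zero hp1 hmean)
  rw [← restrict_cyl] at hw₀
  refine ⟨w₀, hw₀, ?_, hv.timePrimitive hp hε hw₀ hw⟩
  rw [restrict_cyl]
  filter_upwards [ae_integrable_prodMk_fst hp1 hmean, ae_snd_mem_Ioo] with z hslice hz
  refine ⟨(intervalIntegrable_iff_integrableOn_Ioc_of_le hz.1.le).2 ?_, hw z⟩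
  exact IntegrableOn.mono_set hslice (Ioc_subset_Ioo_right hz.2)

theorem corollary4p2 {N : ℕ} (Ω : Set (Space N)) (hΩ : IsOpen Ω) (T : ℝ) (hT : 0 < T)
    (p : ℝ≥0∞) [Fact (1 ≤ p)] (hp : p ≠ ∞)
    {ι : Type*} (l : Filter ι) [l.IsCountablyGenerated] (ε : ι → ℝ) (hε : Tendsto ε l (𝓝[>] 0))
    (v : ι → Space N × ℝ → ℝ) (v₀ : Space N × ℝ → Bes (MicroSpaceTime N) p)
    (hv : WeakSigmaConverges l ε (cyl Ω T) p v v₀) :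
    ∃ w₀ : Space N × ℝ → Bes (Space N) p,
      MemLp w₀ p (volume.restrict (cyl Ω T)) ∧
      (∀ᵐ z ∂(volume.restrict (cyl Ω T)),
        IntervalIntegrable (fun τ => partialIntegral (hatProd (v₀ (z.1, τ)))) volume 0 z.2 ∧
        hat (w₀ z) = ∫ τ in (0 : ℝ)..z.2, partialIntegral (hatProd (v₀ (z.1, τ)))) ∧
      WeakSigmaConverges l ε (cyl Ω T) p (fun i => timePrimitive (v i))
        (fun z => constInSecond (w₀ z)) :=
  corollary4p2_general hp hε hv
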